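/- Let $\mathscr A=\{(a_0,a_1,a_2,a_3;t)\in\mathbb C^4\times(\mathbb C\setminus\{0\}) : a_0+a_1+a_2+a_3=1\}$. On $\mathbb P^1\times\mathbb P^1$ with affine coordinates $(q,p)$ put $Q=1/q$, $P=1/p$. For $\boldsymbol a\in\mathscr A$ let $\varepsilon_{\boldsymbol a}:S_{\boldsymbol a}\to\mathbb P^1\times\mathbb P^1$ be the blow-up at the eight (partly infinitely near) points $$b_1:(Q,p)=(0,-t),\quad b_2:\left(\tfrac{p+t}{Q},Q\right)=(-a_0,0),\quad b_3:(Q,p)=(0,0),\quad b_4:\left(\tfrac pQ,Q\right)=(-a_2,0),$$ $$b_5:(q,P)=(0,0),\quad b_6:\left(\tfrac qP,P\right)=(a_1,0),\quad b_7:(q,P)=(1,0),\quad b_8:\left(\tfrac{q-1}P,P\right)=(a_3,0).$$ Let $\mathrm{Pic}_{\mathcal S}=\langle H_q,H_p,E_1,\dots,E_8\rangle_{\mathbb Z}$ with $H_q.H_p=1$, $E_i.E_i=-1$, and all other products of basis elements zero. Let $\iota_{\boldsymbol a}:\mathrm{Pic}_{\mathcal S}\to\mathrm{Pic}(S_{\boldsymbol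 a})$ send $H_q,H_p$ to the pull-backs of the classes of the fibres $q=\mathrm{const}$, $p=\mathrm{const}$, and $E_i$ to the class of the total transform of the exceptional curve over $b_i$. Put $$\alpha_0=H_p-E_1-E_2,\quad \alpha_1=H_q-E_5-E_6,\quad \alpha_2=H_p-E_3-E_4,\quad \alpha_3=H_q-E_7-E_8,$$ a basis of type $A_3^{(1)}$ of the orthogonal complement $Q^\perp$ of the classes of the components $D_0=E_1-E_2$, $D_1=E_3-E_4$, $D_2=H_q-E_1-E_3$, $D_3=H_p-E_5-E_7$, $D_4=E_5-E_6$, $D_5=E_7-E_8$ of the anticanonical divisor. Let $\omega=dq\wedge dp$, and let $\chi_{\boldsymbol a}:\iota_{\boldsymbol a}(Q^\perp)\to\mathbb C$ be the period map of $S_{\boldsymbol a}$ for $\omega$. It is the additive map that vanishes on nodal curves (irreducible curves of self-intersection $-2$ with class in $\iota_{\boldsymbol a}(Q^\perp)$) and satisfies $\chi_{\boldsymbol a}(C^1-C^0)=2\pi i\int_{D_k\cap C^0}^{D_k\cap C^1}\mathrm{Res}_{D_k}\omega$ for exceptional curves $C^0,C^1$ whose difference has self-intersection $-2$ and which meet $D_k$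 once and no other component (residues normalised by $2\pi i\,\mathrm{Res}(\eta\wedge df/f)=\eta$ along $f=0$). Let $$r_i(F)=F+(F.\alpha_i)\alpha_i\quad(i=0,1,2,3),$$ and let $\sigma_1,\sigma_2$ act on the basis of $\mathrm{Pic}_{\mathcal S}$ by the permutations $$\sigma_1=(H_qH_p)(E_1E_7)(E_2E_8)(E_3E_5)(E_4E_6),\qquad \sigma_2=(E_1E_3)(E_2E_4).$$ For each $w\in\{r_0,r_1,r_2,r_3,\sigma_1,\sigma_2\}$ and $\boldsymbol a\in\mathscr A$ define $\bar{\boldsymbol a}$ and the birational map $\varphi^{(w)}_{\boldsymbol a}:(q,p)\mapsto(\bar q,\bar p)$ of $\mathbb P^1\times\mathbb P^1$ by $w:(a_0,a_1,a_2,a_3;t;q,p)\mapsto(\bar a_0,\bar a_1,\bar a_2,\bar a_3;\bar t;\bar q,\bar p)$, where \begin{align*} r_0&:\ \mapsto\left(-a_0,\,a_0+a_1,\,a_2,\,a_0+a_3;\ t;\ q+\tfrac{a_0}{p+t},\ p\right),\\ r_1&:\ \mapsto\left(a_0+a_1,\,-a_1,\,a_1+a_2,\,a_3;\ t;\ q,\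 p-\tfrac{a_1}{q}\right),\\ r_2&:\ \mapsto\left(a_0,\,a_1+a_2,\,-a_2,\,a_2+a_3;\ t;\ q+\tfrac{a_2}{p},\ p\right),\\ r_3&:\ \mapsto\left(a_0+a_3,\,a_1,\,a_2+a_3,\,-a_3;\ t;\ q,\ p-\tfrac{a_3}{q-1}\right),\\ \sigma_1&:\ \mapsto\left(a_3,\,a_2,\,a_1,\,a_0;\ -t;\ -\tfrac pt,\ qt\right),\\ \sigma_2&:\ \mapsto\left(a_2,\,a_1,\,a_0,\,a_3;\ -t;\ q,\ p+t\right). \end{align*} Then these formulas give the Cremona action of $w$. Precisely, for every $\boldsymbol a\in\mathscr A$: 1. $\bar{\boldsymbol a}\in\mathscr A$, and $\varphi^{(w)}_{\boldsymbol a}$ lifts to an isomorphism $\tilde\varphi=\varepsilon_{\bar{\boldsymbol a}}^{-1}\circ\varphi^{(w)}_{\boldsymbol a}\circ\varepsilon_{\boldsymbol a}:S_{\boldsymbol a}\to S_{\bar{\boldsymbol a}}$ with $\tilde\varphi^*\omega=\omega$. The root variables $\chi_{\boldsymbol a}(\iota_{\boldsymbol a}(\alpha_i))$ and $\chi_{\bar{\boldsymbol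 a}}(\iota_{\bar{\boldsymbol a}}(\alpha_i))$ are $a_i$ and $\bar a_i$, and $\chi_{\bar{\boldsymbol a}}(\iota_{\bar{\boldsymbol a}}(\alpha_i))=\chi_{\boldsymbol a}(\iota_{\boldsymbol a}(w(\alpha_i)))$ for $i=0,\dots,3$. 2. If $w=\sigma_1$ or $w=\sigma_2$, or if $w=r_i$ and $a_i\neq0$, then $\tilde\varphi$ induces $w$ by pull-back, that is, $\tilde\varphi^*\circ\iota_{\bar{\boldsymbol a}}=\iota_{\boldsymbol a}\circ w$. Moreover $(\bar{\boldsymbol a},\tilde\varphi)$ is the only pair of a parameter in $\mathscr A$ and an isomorphism from $S_{\boldsymbol a}$ to the corresponding surface that has the properties in 1 and 2. -/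

import Mathlib

noncomputable section

namespace D5Surface

/-! ## Rational surfaces with function field `ℂ(q, p)`

An irreducible variety over `ℂ` with function field `K` is encoded, as usual for models of a
function field, by the set of local rings (subrings of `K`) of its closed points.  In this language
a birational map `X ⇢ Y` is a `ℂ`-automorphism of `K` (pull-back of rational functions), and it is
an isomorphism exactly when it matches the local rings of `Y` with those of `X`. -/

/-- The field `ℂ(q, p)` of rational functions on `ℙ¹ × ℙ¹`. -/
abbrev K : Type := FractionRing (MvPolynomial (Fin 2) ℂ)

/-- The affine coordinate `q` on `ℙ¹ × ℙ¹`. -/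
def q : K := algebraMap (MvPolynomial (Fin 2) ℂ) K (MvPolynomial.X 0)

/-- The affine coordinate `p` on `ℙ¹ × ℙ¹`. -/
def p : K := algebraMap (MvPolynomial (Fin 2) ℂ) K (MvPolynomial.X 1)

/-- Constant rational functions. -/
def con (c : ℂ) : K := algebraMap ℂ K c

/-- An affine chart `𝔸²`, given by its two coordinate functions. -/
structure Chart where
  x : K
  y : K

namespace Chart

/-- A polynomial in the coordinates of the chart. -/
def poly (ch : Chart) (g : MvPolynomial (Fin 2) ℂ) : K := MvPolynomial.aeval ![ch.x, ch.y] g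

/-- The local ring, inside `K`, of the point `(c, d)` of the chart. -/
def localRing (ch : Chart) (c d : ℂ) : Subring K where
  carrier := {f | ∃ g h : MvPolynomial (Fin 2) ℂ,
    MvPolynomial.eval ![c, d] h ≠ 0 ∧ ch.poly h ≠ 0 ∧ f = ch.poly g / ch.poly h}
  mul_mem' := by
    rintro _ _ ⟨g, h, hh, hh', rfl⟩ ⟨g', h', kh, kh', rfl⟩
    refine ⟨g * g', h * h', ?_, ?_, ?_⟩
    · rw [map_mul]; exact mul_ne_zero hh kh
    · simp only [poly, map_mul] at *; exact mul_ne_zero hh' kh'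
    · simp only [poly, map_mul] at *; field_simp
  one_mem' := ⟨1, 1, by simp, by simp [poly], by simp [poly]⟩
  add_mem' := by
    rintro _ _ ⟨g, h, hh, hh', rfl⟩ ⟨g', h', kh, kh', rfl⟩
    refine ⟨g * h' + h * g', h * h', ?_, ?_, ?_⟩
    · rw [map_mul]; exact mul_ne_zero hh kh
    · simp only [poly, map_mul] at *; exact mul_ne_zero hh' kh'
    · simp only [poly, map_mul, map_add] at *; field_simp
  zero_mem' := ⟨0, 1, by simp, by simp [poly], by simp [poly]⟩
  neg_mem' := by
    rintro _ ⟨g, h, hh, hh', rfl⟩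
    exact ⟨-g, h, hh, hh', by simp only [poly, map_neg]; ring⟩

/-- The local ring of `K` along the irreducible curve `F = 0` of the chart: quotients of
polynomials whose denominator is not divisible by `F`. -/
def curveRing (ch : Chart) (F : MvPolynomial (Fin 2) ℂ) : Set K :=
  {f | ∃ g h : MvPolynomial (Fin 2) ℂ, ¬ F ∣ h ∧ ch.poly h ≠ 0 ∧ f = ch.poly g / ch.poly h}

/-- First chart `(U, V) ↦ (c + V, d + U V)` of the blow-up of the point `(c, d)`. -/
def blowUp₀ (ch : Chart) (c d : ℂ) : Chart := ⟨(ch.y - con d) / (ch.x - con c), ch.x - con c⟩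

/-- Second chart `(u, v) ↦ (c + u v, d + v)` of the blow-up of the point `(c, d)`. -/
def blowUp₁ (ch : Chart) (c d : ℂ) : Chart := ⟨(ch.x - con c) / (ch.y - con d), ch.y - con d⟩

end Chart

/-- The charts `𝒰₀₀, 𝒰₁₀, 𝒰₀₁, 𝒰₁₁` of `ℙ¹ × ℙ¹`, with `Q = 1 / q`, `P = 1 / p`. -/
def U₀₀ : Chart := ⟨q, p⟩
def U₁₀ : Chart := ⟨q⁻¹, p⟩
def U₀₁ : Chart := ⟨q, p⁻¹⟩
def U₁₁ : Chart := ⟨q⁻¹, p⁻¹⟩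

/-- `ℙ¹ × ℙ¹`, as the set of local rings of its points. -/
def P1P1 : Set (Subring K) :=
  {O | ∃ c d : ℂ, O = U₀₀.localRing c d ∨ O = U₁₀.localRing c d ∨
    O = U₀₁.localRing c d ∨ O = U₁₁.localRing c d}

/-- The blow-up of the surface `X` at the point with coordinates `(c, d)` in the chart `ch`: the
point is replaced by the points of the exceptional curve, which is `V = 0` in the first and `v = 0`
in the second chart of the blow-up. -/
def blowUp (X : Set (Subring K)) (ch : Chart) (c d : ℂ) : Set (Subring K) :=
  (X \ {ch.localRing c d}) ∪
    {O | ∃ e : ℂ, O = (ch.blowUp₀ c d).localRing e 0 ∨ O = (ch.blowUp₁ c d).localRing e 0}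

/-! ## Divisors and Picard groups -/

/-- A prime divisor of the surface `X`, given by its local ring: a discrete valuation ring of `K`
that is the localisation of the local ring of some point of `X` at a prime ideal. -/
@[ext]
structure PrimeDivisor (X : Set (Subring K)) where
  ring : ValuationSubring K
  isDVR : IsDiscreteValuationRing ring
  isLocalization : ∃ O ∈ X, ∀ f : K,
    f ∈ ring ↔ ∃ g ∈ O, ∃ h ∈ O, h ≠ 0 ∧ h⁻¹ ∈ ring ∧ f = g / h

/-- `HasOrd R f n`: the rational function `f` vanishes to order `n` along the divisor with local
ring `R`. -/
def HasOrd (R : ValuationSubring K) (f : K) (n : ℤ) : Prop :=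
  ∃ π : R, Irreducible π ∧ ∃ u : Rˣ, f = (π : K) ^ n * ((u : R) : K)

/-- The free abelian group on the prime divisors. -/
abbrev Divisor (X : Set (Subring K)) : Type := PrimeDivisor X →₀ ℤ

/-- The order of vanishing is additive. -/
theorem HasOrd.mul {R : ValuationSubring K} [IsDiscreteValuationRing R] {f g : K} {m n : ℤ}
    (hf : HasOrd R f m) (hg : HasOrd R g n) : HasOrd R (f * g) (m + n) := by
  obtain ⟨π, hπ, u, rfl⟩ := hf
  obtain ⟨ϖ, hϖ, v, rfl⟩ := hg
  obtain ⟨w, rfl⟩ := IsDiscreteValuationRing.associated_of_irreducible R hπ hϖ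
  refine ⟨π, hπ, u * v * w ^ n, ?_⟩
  have hπ0 : (π : K) ≠ 0 := by
    intro h
    exact hπ.ne_zero (Subtype.ext h)
  have hw : (((w ^ n : Rˣ) : R) : K) = ((w : R) : K) ^ n := by
    have := map_zpow ((Units.coeHom K).comp (Units.map (R.subtype : R →* K))) w n
    exact this
  push_cast
  rw [hw, zpow_add₀ hπ0, mul_zpow]
  ring

theorem HasOrd.inv {R : ValuationSubring K} {f : K} {n : ℤ} (hf : HasOrd R f n) :
    HasOrd R f⁻¹ (-n) := by
  obtain ⟨π, hπ, u, rfl⟩ := hf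
  refine ⟨π, hπ, u⁻¹, ?_⟩
  have hu : (((u⁻¹ : Rˣ) : R) : K) = (((u : Rˣ) : R) : K)⁻¹ := by
    exact eq_inv_of_mul_eq_one_left (congrArg (Subtype.val : R → K) u.inv_mul)
  rw [hu, zpow_neg, mul_inv]

/-- The group of principal divisors, i.e. divisors of nonzero rational functions. -/
def principal (X : Set (Subring K)) : AddSubgroup (Divisor X) where
  carrier := {D | ∃ f : K, f ≠ 0 ∧ ∀ C : PrimeDivisor X, HasOrd C.ring f (D C)}
  zero_mem' := by
    refine ⟨1, one_ne_zero, fun C => ?_⟩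
    have := C.isDVR
    obtain ⟨π, hπ⟩ := IsDiscreteValuationRing.exists_irreducible C.ring
    exact ⟨π, hπ, 1, by simp⟩
  add_mem' := by
    rintro D D' ⟨f, hf, h⟩ ⟨g, hg, h'⟩
    refine ⟨f * g, mul_ne_zero hf hg, fun C => ?_⟩
    have := C.isDVR
    exact (h C).mul (h' C)
  neg_mem' := by
    rintro D ⟨f, hf, h⟩
    exact ⟨f⁻¹, inv_ne_zero hf, fun C => (h C).inv⟩

/-- The Picard group (group of divisors modulo linear equivalence) of the smooth surface `X`. -/
abbrev Pic (X : Set (Subring K)) : Type := Divisor X ⧸ principal X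

/-- The class of a divisor. -/
def cls {X : Set (Subring K)} (D : Divisor X) : Pic X := QuotientAddGroup.mk D

/-- The class of a prime divisor. -/
def PrimeDivisor.cls {X : Set (Subring K)} (C : PrimeDivisor X) : Pic X :=
  D5Surface.cls (Finsupp.single C 1)

open Classical in
/-- The class of the prime divisor of `X` whose local ring is the given subset of `K`. -/
def classOf (X : Set (Subring K)) (s : Set K) : Pic X :=
  if h : ∃ C : PrimeDivisor X, (C.ring : Set K) = s then h.choose.cls else 0

/-! ## Isomorphisms and their action on Picard groups -/

/-- An isomorphism `φ : X → Y`, given by the pull-back `φ^*` of rational functions, which has to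
match the local rings of the points of `Y` with those of `X`. -/
structure SurfaceIso (X Y : Set (Subring K)) where
  pull : K ≃ₐ[ℂ] K
  map_mem_iff : ∀ O : Subring K, O.map (pull : K →+* K) ∈ X ↔ O ∈ Y

namespace SurfaceIso

variable {X Y : Set (Subring K)}

/-- The inverse isomorphism. -/
def symm (φ : SurfaceIso X Y) : SurfaceIso Y X where
  pull := φ.pull.symm
  map_mem_iff O := by
    rw [← φ.map_mem_iff, Subring.map_map]
    have : ((φ.pull : K →+* K).comp (φ.pull.symm : K →+* K)) = RingHom.id K := by
      ext x; simp
    rw [this, Subring.map_id]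

/-- The preimage under `φ` of a prime divisor. -/
def preimage (φ : SurfaceIso X Y) (C : PrimeDivisor Y) : PrimeDivisor X where
  ring := C.ring.comap (φ.pull.symm : K →+* K)
  isDVR := by
    have := C.isDVR
    let e : C.ring ≃+* (C.ring.comap (φ.pull.symm : K →+* K)) :=
      { toFun := fun f => ⟨φ.pull f, by simp [ValuationSubring.mem_comap]⟩
        invFun := fun f => ⟨φ.pull.symm f, f.2⟩
        left_inv := fun f => by ext; simp
        right_inv := fun f => by ext; simp
        map_mul' := fun f g => by ext; simp
        map_add' := fun f g => by ext; simp }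
    exact IsDiscreteValuationRing.RingEquivClass.isDiscreteValuationRing e
  isLocalization := by
    obtain ⟨O, hO, h⟩ := C.isLocalization
    refine ⟨O.map (φ.pull : K →+* K), (φ.map_mem_iff O).2 hO, fun f => ?_⟩
    rw [ValuationSubring.mem_comap, h]
    constructor
    · rintro ⟨a, ha, b, hb, hb0, hbi, hf⟩
      refine ⟨φ.pull a, ⟨a, ha, rfl⟩, φ.pull b, ⟨b, hb, rfl⟩, ?_, ?_, ?_⟩
      · simpa using hb0
      · simpa [ValuationSubring.mem_comap] using hbi
      · have := congrArg φ.pull hf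
        simpa using this
    · rintro ⟨_, ⟨a, ha, rfl⟩, _, ⟨b, hb, rfl⟩, hb0, hbi, rfl⟩
      refine ⟨a, ha, b, hb, ?_, ?_, ?_⟩
      · simpa using hb0
      · simpa [ValuationSubring.mem_comap] using hbi
      · simp

/-- Taking preimages is a bijection between the prime divisors of `Y` and those of `X`. -/
def primeEquiv (φ : SurfaceIso X Y) : PrimeDivisor Y ≃ PrimeDivisor X where
  toFun := φ.preimage
  invFun := φ.symm.preimage
  left_inv C := by
    ext f
    simp [preimage, symm, ValuationSubring.mem_comap]
  right_inv C := by
    ext f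
    simp [preimage, symm, ValuationSubring.mem_comap]

theorem hasOrd_preimage (φ : SurfaceIso X Y) (C : PrimeDivisor Y) {f : K} {n : ℤ}
    (h : HasOrd C.ring f n) : HasOrd (φ.preimage C).ring (φ.pull f) n := by
  obtain ⟨π, hπ, u, rfl⟩ := h
  let e : C.ring ≃+* (φ.preimage C).ring :=
    { toFun := fun f => ⟨φ.pull f, by simp [preimage, ValuationSubring.mem_comap]⟩
      invFun := fun f => ⟨φ.pull.symm f, f.2⟩
      left_inv := fun f => by ext; simp
      right_inv := fun f => by ext; simp
      map_mul' := fun f g => by ext; simp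
      map_add' := fun f g => by ext; simp }
  refine ⟨e π, (MulEquiv.irreducible_iff e).2 hπ, Units.map (e : C.ring →* _) u, ?_⟩
  rw [map_mul, map_zpow₀]
  rfl

/-- Pull-back of divisors. -/
def pullDivisor (φ : SurfaceIso X Y) : Divisor Y →+ Divisor X :=
  (Finsupp.domCongr φ.primeEquiv : Divisor Y ≃+ Divisor X)

theorem pullDivisor_principal (φ : SurfaceIso X Y) :
    principal Y ≤ (principal X).comap φ.pullDivisor := by
  rintro D ⟨f, hf, h⟩
  refine ⟨φ.pull f, by simpa using hf, fun C => ?_⟩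
  have h1 := φ.hasOrd_preimage _ (h (φ.primeEquiv.symm C))
  have h2 : φ.preimage (φ.primeEquiv.symm C) = C := φ.primeEquiv.apply_symm_apply C
  rw [h2] at h1
  exact h1

/-- The pull-back `φ^* : Pic Y → Pic X`. -/
def pullPic (φ : SurfaceIso X Y) : Pic Y →+ Pic X :=
  QuotientAddGroup.map _ _ φ.pullDivisor φ.pullDivisor_principal

end SurfaceIso

/-! ## The family of surfaces -/

/-- The parameters `(a₀, a₁, a₂, a₃; t)`. -/
@[ext]
structure Params where
  a : Fin 4 → ℂ
  t : ℂ

/-- The parameter space `𝒜`. -/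
def paramSpace : Set Params := {A | A.a 0 + A.a 1 + A.a 2 + A.a 3 = 1 ∧ A.t ≠ 0}

/-- The charts `𝒲₁⁽⁰⁾, 𝒲₃⁽⁰⁾, 𝒲₅⁽¹⁾, 𝒲₇⁽¹⁾` containing `b₂, b₄, b₆, b₈`. -/
def W₁ (A : Params) : Chart := U₁₀.blowUp₀ 0 (-A.t)
def W₃ : Chart := U₁₀.blowUp₀ 0 0
def W₅ : Chart := U₀₁.blowUp₁ 0 0
def W₇ : Chart := U₀₁.blowUp₁ 1 0

/-- The surface `S_𝒂`: the blow-up of `ℙ¹ × ℙ¹` at `b₁, …, b₈`, where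
`b₁ : (Q, p) = (0, -t)`, `b₂ : (U₁, V₁) = (-a₀, 0)`, `b₃ : (Q, p) = (0, 0)`,
`b₄ : (U₃, V₃) = (-a₂, 0)`, `b₅ : (q, P) = (0, 0)`, `b₆ : (u₅, v₅) = (a₁, 0)`,
`b₇ : (q, P) = (1, 0)`, `b₈ : (u₇, v₇) = (a₃, 0)`. -/
def S (A : Params) : Set (Subring K) :=
  let X₁ := blowUp P1P1 U₁₀ 0 (-A.t)
  let X₂ := blowUp X₁ (W₁ A) (-A.a 0) 0
  let X₃ := blowUp X₂ U₁₀ 0 0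
  let X₄ := blowUp X₃ W₃ (-A.a 2) 0
  let X₅ := blowUp X₄ U₀₁ 0 0
  let X₆ := blowUp X₅ W₅ (A.a 1) 0
  let X₇ := blowUp X₆ U₀₁ 1 0
  blowUp X₇ W₇ (A.a 3) 0

/-- The abstract Picard lattice `⟨H_q, H_p, E₁, …, E₈⟩`. -/
abbrev PicLattice : Type := Fin 10 → ℤ

def Hq : PicLattice := Pi.single 0 1
def Hp : PicLattice := Pi.single 1 1

/-- The basis element `E i`, for `i = 1, …, 8` (stored in coordinate `i + 1`). -/
def E (i : Fin 9) : PicLattice := Pi.single i.succ 1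

/-- The intersection form: `H_q.H_p = 1`, `E_i.E_i = -1`, all other products of basis elements
vanish. -/
def inter (F G : PicLattice) : ℤ :=
  F 0 * G 1 + F 1 * G 0 - ∑ i : Fin 8, F (i.natAdd 2) * G (i.natAdd 2)

/-- The class of the irreducible curve of `S_𝒂` that is the (strict transform of the) curve `F = 0`
of the given chart. -/
def curveClass (A : Params) (ch : Chart) (F : MvPolynomial (Fin 2) ℂ) : Pic (S A) :=
  classOf (S A) (ch.curveRing F)

/-- The class of the strict transform of the exceptional curve over the point `(c, d)`
of the chart. -/
def excClass (A : Params) (ch : Chart) (c d : ℂ) : Pic (S A) :=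
  curveClass A (ch.blowUp₀ c d) (MvPolynomial.X 1)

/-- The geometric basis of `Pic (S_𝒂)`: the pull-backs of the classes of the fibres of `q` and `p`
(represented by `q = 2` and `p = t`, which contain none of the centres), and the total transforms of
the eight exceptional curves. As `b₂` lies on the exceptional curve over `b₁`, the total transform
of the latter is its strict transform plus the exceptional curve over `b₂`, and so on. -/
def geometricBasis (A : Params) : Fin 10 → Pic (S A) :=
  let e₂ := excClass A (W₁ A) (-A.a 0) 0
  let e₄ := excClass A W₃ (-A.a 2) 0
  let e₆ := excClass A W₅ (A.a 1) 0
  let e₈ := excClass A W₇ (A.a 3) 0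
  ![curveClass A U₀₀ (MvPolynomial.X 0 - MvPolynomial.C 2),
    curveClass A U₀₀ (MvPolynomial.X 1 - MvPolynomial.C A.t),
    excClass A U₁₀ 0 (-A.t) + e₂, e₂,
    excClass A U₁₀ 0 0 + e₄, e₄,
    excClass A U₀₁ 0 0 + e₆, e₆,
    excClass A U₀₁ 1 0 + e₈, e₈]

/-- The identification `ι_𝒂` of the lattice with `Pic (S_𝒂)`. -/
def ι (A : Params) (F : PicLattice) : Pic (S A) := ∑ i, F i • geometricBasis A i

/-! ## Roots and the generators of `W(A₃⁽¹⁾) ⋊ Aut(A₃⁽¹⁾)` on the Picard lattice -/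

/-- The symmetry root basis. -/
def α : Fin 4 → PicLattice :=
  ![Hp - E 1 - E 2, Hq - E 5 - E 6, Hp - E 3 - E 4, Hq - E 7 - E 8]

/-- The surface root basis: classes of the components of the anticanonical divisor. -/
def δcomp : Fin 6 → PicLattice :=
  ![E 1 - E 2, E 3 - E 4, Hq - E 1 - E 3, Hp - E 5 - E 7, E 5 - E 6, E 7 - E 8]

/-- The anticanonical class. -/
def antiK : PicLattice := 2 • Hq + 2 • Hp - ∑ i : Fin 8, E i.succ

/-- The simple reflections `r_i (F) = F + (F.α_i) α_i`. -/
def r (i : Fin 4) (F : PicLattice) : PicLattice := F + inter F (α i) • α i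

/-- `σ₁ = (H_q H_p)(E₁ E₇)(E₂ E₈)(E₃ E₅)(E₄ E₆)`. -/
def σ₁ (F : PicLattice) : PicLattice :=
  F 0 • Hp + F 1 • Hq + F 2 • E 7 + F 3 • E 8 + F 4 • E 5 + F 5 • E 6 + F 6 • E 3 + F 7 • E 4 +
    F 8 • E 1 + F 9 • E 2

/-- `σ₂ = (E₁ E₃)(E₂ E₄)`. -/
def σ₂ (F : PicLattice) : PicLattice :=
  F 0 • Hq + F 1 • Hp + F 2 • E 3 + F 3 • E 4 + F 4 • E 1 + F 5 • E 2 + F 6 • E 5 + F 7 • E 6 +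
    F 8 • E 7 + F 9 • E 8

/-! ## The rational two-form and the period map -/

/-- Rational two-forms. -/
abbrev TwoForm : Type := ⋀[K]^2 (Ω[K⁄ℂ])

/-- The two-form `df ∧ dg`. -/
def dwedge (f g : K) : TwoForm :=
  exteriorPower.ιMulti K 2 ![KaehlerDifferential.D ℂ K f, KaehlerDifferential.D ℂ K g]

/-- The two-form `ω = dq ∧ dp` on each `S_𝒂`. -/
def ω : TwoForm := dwedge q p

/-- `φ^* ω = ω`, where `φ^* (dq ∧ dp) = d(φ^* q) ∧ d(φ^* p)`. -/
def PreservesForm {X Y : Set (Subring K)} (φ : SurfaceIso X Y) : Prop :=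
  dwedge (φ.pull q) (φ.pull p) = ω

/-- `HasResidue R u`: the form `ω` has at most a simple pole along the curve with local ring `R`,
and its residue there (normalised by `2πi Res (η ∧ df / f) = η` for a local equation `f`) is the
differential of the restriction of `u` to the curve. -/
def HasResidue (R : ValuationSubring K) (u : K) : Prop :=
  u ∈ R ∧ ∃ f : R, Irreducible f ∧ ω - (f : K)⁻¹ • dwedge u f ∈
    AddSubgroup.closure {η : TwoForm | ∃ a ∈ R, ∃ b ∈ R, ∃ c ∈ R, η = a • dwedge b c}

/-- The rational function `u` is regular at the point with local ring `O`, with value `c`. -/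
def HasValue (O : Subring K) (u : K) (c : ℂ) : Prop :=
  u - con c ∈ O ∧ (u - con c = 0 ∨ (u - con c)⁻¹ ∉ O)

/-- The point of `X` with local ring `O` lies on both curves. -/
def IsCommonPoint {X : Set (Subring K)} (C D : PrimeDivisor X) (O : Subring K) : Prop :=
  O ∈ X ∧ O ≤ C.ring.toSubring ∧ O ≤ D.ring.toSubring

/-- `C` is an exceptional curve on `S_𝒂` in the class `F` (by the genus formula: an irreducible
curve with `C.C = -1` and `C.K = -1`). -/
def IsExceptional (A : Params) (C : PrimeDivisor (S A)) (F : PicLattice) : Prop :=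
  C.cls = ι A F ∧ inter F F = -1 ∧ inter F antiK = 1

/-- `F` lies in the lattice `Q^⊥`. -/
def InQperp (F : PicLattice) : Prop := ∀ j, inter F (δcomp j) = 0

/-- `F ∈ Q^⊥` is the class of a nodal curve of `S_𝒂` (such a curve is not a component of the
anticanonical divisor, the components not being orthogonal to themselves). -/
def IsNodalClass (A : Params) (F : PicLattice) : Prop :=
  InQperp F ∧ inter F F = -2 ∧ ∃ C : PrimeDivisor (S A), C.cls = ι A F

/-- The residue formula
`χ (C¹ - C⁰) = 2πi ∫ Res_{D_k} ω`, integrated along `D_k` from `D_k ∩ C⁰` to `D_k ∩ C¹`, for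
exceptional curves `C¹`, `C⁰` that meet a component `D_k` of the anticanonical divisor once and no
other component. If `2πi Res_{D_k} ω = du` then the integral is the difference of the values of
`u` at the two points. -/
def ResiduePeriod (A : Params) (F : PicLattice) (c : ℂ) : Prop :=
  ∃ (F₁ F₀ : PicLattice) (C₁ C₀ D : PrimeDivisor (S A)) (k : Fin 6) (O₁ O₀ : Subring K)
    (u : K) (c₁ c₀ : ℂ),
    F = F₁ - F₀ ∧ InQperp F ∧ inter F F = -2 ∧
    IsExceptional A C₁ F₁ ∧ IsExceptional A C₀ F₀ ∧ D.cls = ι A (δcomp k) ∧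
    (∀ j, inter F₁ (δcomp j) = if j = k then 1 else 0) ∧
    (∀ j, inter F₀ (δcomp j) = if j = k then 1 else 0) ∧
    IsCommonPoint C₁ D O₁ ∧ IsCommonPoint C₀ D O₀ ∧
    HasResidue D.ring u ∧ HasValue O₁ u c₁ ∧ HasValue O₀ u c₀ ∧ c = c₁ - c₀

/-- The graph of the period map `χ_𝒂 ∘ ι_𝒂 : Q^⊥ → ℂ`: it is additive, is given by the residue
formula on differences of exceptional curves, and vanishes on nodal curves, on which the
two-form `ω` restricts to zero. -/
def periodGraph (A : Params) : AddSubgroup (PicLattice × ℂ) :=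
  AddSubgroup.closure
    ({x | ResiduePeriod A x.1 x.2} ∪ {x | IsNodalClass A x.1 ∧ x.2 = 0})

/-- `χ_𝒂 (ι_𝒂 F) = c`. -/
def HasPeriod (A : Params) (F : PicLattice) (c : ℂ) : Prop := (F, c) ∈ periodGraph A

/-! ## The Cremona action -/

/-- The two-form is preserved, and the root variables evolve by
`χ_𝒃 (ι_𝒃 (α_i)) = χ_𝒂 (ι_𝒂 (w α_i))`, where `𝒂`, `𝒃` are the root variables of `S_𝒂`, `S_𝒃`. -/
def PreservesPeriods (w : PicLattice → PicLattice) (A B : Params)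
    (φ : SurfaceIso (S A) (S B)) : Prop :=
  PreservesForm φ ∧ ∀ i, HasPeriod A (α i) (A.a i) ∧ HasPeriod B (α i) (B.a i) ∧
    HasPeriod A (w (α i)) (B.a i)

/-- `φ` induces `w` by pull-back: `φ^* ∘ ι_𝒃 = ι_𝒂 ∘ w`. -/
def Induces (w : PicLattice → PicLattice) (A B : Params) (φ : SurfaceIso (S A) (S B)) : Prop :=
  ∀ F, φ.pullPic (ι B F) = ι A (w F)

/-- The Cremona action of `w` at the parameter `𝒂 ∈ 𝒜` is `(𝒂, (q, p)) ↦ (𝒃, (q', p'))`.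
The birational map `(q, p) ↦ (q', p')` of `ℙ¹ × ℙ¹` lifts to an isomorphism `S_𝒂 → S_𝒃` that
preserves two-forms and is compatible with the root variables. Moreover, under the hypothesis `nd`,
it induces `w` by pull-back, and `𝒃` and the map are the only ones with all these properties. -/
def CremonaGivenBy (w : PicLattice → PicLattice) (nd : Prop) (A B : Params) (q' p' : K) : Prop :=
  B ∈ paramSpace ∧ ∃ φ : SurfaceIso (S A) (S B),
    φ.pull q = q' ∧ φ.pull p = p' ∧ PreservesPeriods w A B φ ∧
    (nd → Induces w A B φ ∧
      ∀ B' ∈ paramSpace, ∀ ψ : SurfaceIso (S A) (S B'),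
        PreservesPeriods w A B' ψ → Induces w A B' ψ → B' = B ∧ ψ.pull = φ.pull)

end D5Surface

end

/-!
A surface is handled through the local rings of its points. The basic tool is the calculus of
values of rational functions at points (`IsPoint`, `HasValue`): two points of charts coincide as
soon as the coordinates of each chart are regular with the right values at the point of the other
one (`Chart.Good.localRing_eq`). Every identification of points below is such an evaluation.

The surface `S A` is `ℙ¹ × ℙ¹` without four base points, together with four *towers*, each lying
over one of them and consisting of two exceptional curves (`mem_S`). The towers are numbered like
the symmetry roots and treated uniformly. A prime divisor of `S A` is either a curve of the affine
`(q, p)`-plane or one of ten boundary curves, namely the fibres `q = ∞`, `p = ∞` and the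
exceptional curves of the towers (`loc_or_bd`). The divisors of `q - c` and `p - c` are computed,
and show that the boundary curves have the expected classes (`cls_bd`). These classes span the
lattice, so that the action of an isomorphism on the Picard lattice can be read off from the
preimages of the boundary curves (`induces_of_bd`).

*Periods.* In the `i`-th tower let `L` be the strict transform of the line through the base point
and `G` the second exceptional curve. The class of `L` is `α i + [G]`, unless the second centre
lies on `L`, which happens exactly if `a i = 0`. Along the first exceptional curve the residue of
`ω` is the differential of an affine coordinate, up to sign, and this coordinate takes the values
`0` on `L` and `± a i` on `G`. If `a i = 0` then `L` itself is a nodal curve in the class `α i`. In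
both cases the period of `α i` is `a i` (`hasPeriod_α`), and the remaining periods follow by
additivity.

*Isomorphisms.* The maps of `σ₁` and `σ₂` are automorphisms of `ℙ¹ × ℙ¹` that match the centres of
the blow-ups (`map_mem_S`). The map of `r 0` is a shear, regular away from the fibre `p = -t`, and
the identity if `a₀ = 0`. If `a₀ ≠ 0`, it matches the other three towers, and exchanges the fibre
`p = -t` with the second exceptional curve of the tower `0` (`shear_mem_S_of_ne_zero`,
`shearIso_induces`). The other reflections are conjugates of `r 0` by `σ₁` and `σ₂` (`r_two`,
`r_three`, `r_one`), and so are the corresponding maps.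

*Uniqueness.* If two isomorphisms induce the same map on the lattice, then one composed with the
inverse of the other acts trivially on the Picard lattice. A boundary curve is the only curve in
its class (`eq_bd_of_cls_eq`), so such an isomorphism preserves the ten boundary curves. Hence it
transforms `q` and `p` by affine maps (`pull_ax`), and the positions of the centres together with
the normalisation `a₀ + a₁ + a₂ + a₃ = 1` force it to be the identity (`rigid`).
-/

noncomputable section

namespace D5Surface

/-! ### Charts that generate the function field -/

namespace Chart

/-- The two coordinate functions of the chart generate the function field. -/
def Good (ch : Chart) : Prop := IntermediateField.adjoin ℂ (Set.range ![ch.x, ch.y]) = ⊤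

/-- The chart with the two coordinates exchanged. -/
def swap (ch : Chart) : Chart := ⟨ch.y, ch.x⟩

/-- The chart obtained by applying an automorphism of the function field to the coordinates. -/
def map (σ : K ≃ₐ[ℂ] K) (ch : Chart) : Chart := ⟨σ ch.x, σ ch.y⟩

variable {ch ch' : Chart}

@[simp] theorem poly_add (g h : MvPolynomial (Fin 2) ℂ) :
    ch.poly (g + h) = ch.poly g + ch.poly h := map_add _ _ _
@[simp] theorem poly_sub (g h : MvPolynomial (Fin 2) ℂ) :
    ch.poly (g - h) = ch.poly g - ch.poly h := map_sub _ _ _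
@[simp] theorem poly_mul (g h : MvPolynomial (Fin 2) ℂ) :
    ch.poly (g * h) = ch.poly g * ch.poly h := map_mul _ _ _
@[simp] theorem poly_pow (g : MvPolynomial (Fin 2) ℂ) (n : ℕ) :
    ch.poly (g ^ n) = ch.poly g ^ n := map_pow _ _ _
@[simp] theorem poly_one : ch.poly 1 = 1 := map_one _
@[simp] theorem poly_zero : ch.poly 0 = 0 := map_zero _
@[simp] theorem poly_C (c : ℂ) : ch.poly (MvPolynomial.C c) = con c := by
  simp [poly, con]
@[simp] theorem poly_X0 : ch.poly (MvPolynomial.X 0) = ch.x := by simp [poly]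
@[simp] theorem poly_X1 : ch.poly (MvPolynomial.X 1) = ch.y := by simp [poly]

end Chart

theorem con_add (a b : ℂ) : con (a + b) = con a + con b := map_add _ _ _
theorem con_sub (a b : ℂ) : con (a - b) = con a - con b := map_sub _ _ _
theorem con_mul (a b : ℂ) : con (a * b) = con a * con b := map_mul _ _ _
theorem con_neg (a : ℂ) : con (-a) = -con a := map_neg _ _
theorem con_inv (a : ℂ) : con a⁻¹ = (con a)⁻¹ := map_inv₀ _ _
theorem con_div (a b : ℂ) : con (a / b) = con a / con b := map_div₀ _ _ _
@[simp] theorem con_zero : con 0 = 0 := map_zero _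
@[simp] theorem con_one : con 1 = 1 := map_one _
@[simp] theorem con_eq_zero {a : ℂ} : con a = 0 ↔ a = 0 := map_eq_zero _
theorem con_ne_zero {a : ℂ} (h : a ≠ 0) : con a ≠ 0 := mt con_eq_zero.1 h

theorem trdeg_K : Algebra.trdeg ℂ K = 2 := by
  have : Algebra.IsAlgebraic (MvPolynomial (Fin 2) ℂ) K :=
    (IsFractionRing.isAlgebraic_iff' (MvPolynomial (Fin 2) ℂ) (MvPolynomial (Fin 2) ℂ) K).1
      inferInstance
  rw [← trdeg_add_eq ℂ (MvPolynomial (Fin 2) ℂ) (A := K),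
    trdeg_eq_zero (R := MvPolynomial (Fin 2) ℂ) (A := K), add_zero,
    MvPolynomial.trdeg_of_isDomain]
  simp

namespace Chart
variable {ch ch' : Chart}

theorem Good.exists_eq_div (hch : ch.Good) (f : K) :
    ∃ g h, ch.poly h ≠ 0 ∧ f = ch.poly g / ch.poly h := by
  have hf : f ∈ IntermediateField.adjoin ℂ (Set.range ![ch.x, ch.y]) := by
    rw [show IntermediateField.adjoin ℂ (Set.range ![ch.x, ch.y]) = ⊤ from hch]; trivial
  obtain ⟨g, h, rfl⟩ := (IntermediateField.mem_adjoin_range_iff _ _ _).1 hf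
  by_cases h0 : ch.poly h = 0
  · exact ⟨0, 1, by simp, by simp only [poly] at h0 ⊢; simp [h0]⟩
  · exact ⟨g, h, h0, rfl⟩

/-- The coordinates span an extension over which the function field is algebraic, and two elements
with that property are a transcendence basis because the transcendence degree is `2`. -/
theorem Good.algebraicIndependent (hch : ch.Good) : AlgebraicIndependent ℂ ![ch.x, ch.y] := by
  have : Algebra.IsAlgebraic (Algebra.adjoin ℂ (Set.range ![ch.x, ch.y])) K := by
    constructor
    intro f
    obtain ⟨g, h, h0, rfl⟩ := hch.exists_eq_div f
    have key (g : MvPolynomial (Fin 2) ℂ) :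
        IsAlgebraic (Algebra.adjoin ℂ (Set.range ![ch.x, ch.y])) (ch.poly g) := by
      have hg : ch.poly g ∈ Algebra.adjoin ℂ (Set.range ![ch.x, ch.y]) := by
        rw [Algebra.adjoin_range_eq_range_aeval]; exact ⟨g, rfl⟩
      exact isAlgebraic_algebraMap (⟨_, hg⟩ : Algebra.adjoin ℂ (Set.range ![ch.x, ch.y]))
    rw [div_eq_mul_inv]
    exact (key g).mul (key h).inv
  refine (Algebra.IsAlgebraic.isTranscendenceBasis_of_le_trdeg_of_finite ℂ ![ch.x, ch.y] ?_).1
  simp [trdeg_K]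

theorem Good.poly_injective (hch : ch.Good) : Function.Injective ch.poly :=
  hch.algebraicIndependent

theorem Good.poly_ne_zero (hch : ch.Good) {g : MvPolynomial (Fin 2) ℂ} (hg : g ≠ 0) :
    ch.poly g ≠ 0 := by
  rw [← poly_zero (ch := ch)]
  exact hch.poly_injective.ne hg

theorem Good.poly_ne_zero_of_eval (hch : ch.Good) {g : MvPolynomial (Fin 2) ℂ} {v : Fin 2 → ℂ}
    (hg : MvPolynomial.eval v g ≠ 0) : ch.poly g ≠ 0 :=
  hch.poly_ne_zero (by rintro rfl; simp at hg)

/-- A chart generates the function field as soon as its coordinates generate those of a chart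
that does. -/
theorem Good.of_mem (hch : ch.Good)
    (hx : ch.x ∈ IntermediateField.adjoin ℂ (Set.range ![ch'.x, ch'.y]))
    (hy : ch.y ∈ IntermediateField.adjoin ℂ (Set.range ![ch'.x, ch'.y])) : ch'.Good := by
  rw [Good, eq_top_iff, ← show IntermediateField.adjoin ℂ (Set.range ![ch.x, ch.y]) = ⊤ from hch,
    IntermediateField.adjoin_le_iff]
  rintro _ ⟨i, rfl⟩
  fin_cases i
  · exact hx
  · exact hy

theorem x_mem_adjoin : ch.x ∈ IntermediateField.adjoin ℂ (Set.range ![ch.x, ch.y]) :=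
  IntermediateField.subset_adjoin _ _ ⟨0, rfl⟩
theorem y_mem_adjoin : ch.y ∈ IntermediateField.adjoin ℂ (Set.range ![ch.x, ch.y]) :=
  IntermediateField.subset_adjoin _ _ ⟨1, rfl⟩
theorem con_mem_adjoin (c : ℂ) (S : Set K) : con c ∈ IntermediateField.adjoin ℂ S :=
  IntermediateField.algebraMap_mem _ c

theorem Good.swap (hch : ch.Good) : ch.swap.Good :=
  hch.of_mem (y_mem_adjoin (ch := ch.swap)) (x_mem_adjoin (ch := ch.swap))

theorem Good.x_sub_ne_zero (hch : ch.Good) (c : ℂ) : ch.x - con c ≠ 0 := by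
  have := hch.poly_ne_zero_of_eval (g := .X 0 - .C c) (v := ![c + 1, 0]) (by simp)
  simpa using this

theorem Good.y_sub_ne_zero (hch : ch.Good) (c : ℂ) : ch.y - con c ≠ 0 := hch.swap.x_sub_ne_zero c
theorem Good.x_ne_zero (hch : ch.Good) : ch.x ≠ 0 := by simpa using hch.x_sub_ne_zero 0
theorem Good.y_ne_zero (hch : ch.Good) : ch.y ≠ 0 := hch.swap.x_ne_zero

theorem Good.blowUp₀ (hch : ch.Good) (c d : ℂ) : (ch.blowUp₀ c d).Good := by
  have h0 := hch.x_sub_ne_zero c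
  have h1 := x_mem_adjoin (ch := ch.blowUp₀ c d)
  have h2 := y_mem_adjoin (ch := ch.blowUp₀ c d)
  refine hch.of_mem ?_ ?_
  · have := add_mem h2 (con_mem_adjoin c _)
    simpa [Chart.blowUp₀] using this
  · have := add_mem (mul_mem h1 h2) (con_mem_adjoin d _)
    rwa [show (ch.blowUp₀ c d).x * (ch.blowUp₀ c d).y + con d = ch.y by
      simp only [Chart.blowUp₀]; field_simp; ring] at this

theorem Good.blowUp₁ (hch : ch.Good) (c d : ℂ) : (ch.blowUp₁ c d).Good :=
  hch.swap.blowUp₀ d c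

theorem Good.inv (hch : ch.Good) : Good ⟨ch.x⁻¹, ch.y⟩ := by
  refine hch.of_mem ?_ (y_mem_adjoin (ch := ⟨ch.x⁻¹, ch.y⟩))
  have := inv_mem (x_mem_adjoin (ch := ⟨ch.x⁻¹, ch.y⟩))
  simpa using this

theorem Good.map (hch : ch.Good) (σ : K ≃ₐ[ℂ] K) : (ch.map σ).Good := by
  have h : IntermediateField.map σ.toAlgHom (IntermediateField.adjoin ℂ (Set.range ![ch.x, ch.y])) =
      ⊤ := by
    rw [show IntermediateField.adjoin ℂ (Set.range ![ch.x, ch.y]) = ⊤ from hch, eq_top_iff]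
    intro f _
    exact ⟨σ.symm f, trivial, σ.apply_symm_apply f⟩
  rw [IntermediateField.adjoin_map, ← Set.range_comp] at h
  rw [Good, ← h]
  congr 2
  funext i
  fin_cases i <;> rfl

end Chart

theorem good_U₀₀ : U₀₀.Good := by
  rw [Chart.Good, eq_top_iff]
  intro f _
  rw [IntermediateField.mem_adjoin_range_iff]
  obtain ⟨g, h, _, rfl⟩ := IsFractionRing.div_surjective (A := MvPolynomial (Fin 2) ℂ) f
  have key : ∀ g : MvPolynomial (Fin 2) ℂ, algebraMap _ K g =
      MvPolynomial.aeval ![U₀₀.x, U₀₀.y] g := by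
    intro g
    have : (IsScalarTower.toAlgHom ℂ (MvPolynomial (Fin 2) ℂ) K) =
        MvPolynomial.aeval ![U₀₀.x, U₀₀.y] := by
      ext i; fin_cases i <;> simp [U₀₀, q, p]
    exact DFunLike.congr_fun this g
  exact ⟨g, h, by rw [key, key]⟩

/-! ### Values of rational functions at points -/

/-- The subring `O` is the local ring of a point of some chart. -/
def IsPoint (O : Subring K) : Prop := ∃ (ch : Chart) (c d : ℂ), ch.Good ∧ O = ch.localRing c d

namespace Chart
variable {ch ch' : Chart} {c d c' d' : ℂ}

theorem Good.isPoint (hch : ch.Good) (c d : ℂ) : IsPoint (ch.localRing c d) := ⟨ch, c, d, hch, rfl⟩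

/-- The value of `g / h` at the point `(c, d)` of a chart is `g (c, d) / h (c, d)`. -/
theorem Good.hasValue_iff (hch : ch.Good) {f : K} {v : ℂ} :
    HasValue (ch.localRing c d) f v ↔ ∃ g h : MvPolynomial (Fin 2) ℂ,
      MvPolynomial.eval ![c, d] h ≠ 0 ∧ ch.poly h ≠ 0 ∧ f = ch.poly g / ch.poly h ∧
        MvPolynomial.eval ![c, d] g = v * MvPolynomial.eval ![c, d] h := by
  constructor
  · rintro ⟨⟨g, h, hh, hh', hf⟩, h2⟩
    refine ⟨g + .C v * h, h, hh, hh', ?_, ?_⟩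
    · have : f = ch.poly g / ch.poly h + con v := by rw [← hf]; ring
      rw [this]; simp only [poly_add, poly_mul, poly_C]; field_simp
    · have hg : MvPolynomial.eval ![c, d] g = 0 := by
        by_contra hg
        have hg' := hch.poly_ne_zero_of_eval hg
        rcases h2 with h2 | h2
        · rw [h2] at hf
          exact div_ne_zero hg' hh' hf.symm
        · exact h2 ⟨h, g, hg, hg', by rw [hf, inv_div]⟩
      simp [hg]
  · rintro ⟨g, h, hh, hh', hf, hv⟩
    have hf' : f - con v = ch.poly (g - .C v * h) / ch.poly h := by
      rw [hf]; simp only [poly_sub, poly_mul, poly_C]; field_simp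
    refine ⟨⟨_, h, hh, hh', hf'⟩, ?_⟩
    by_contra! H
    obtain ⟨H0, g', h', k1, k2, k3⟩ := H
    have hk : ch.poly (g - .C v * h) ≠ 0 := by
      intro h0; rw [h0, zero_div] at hf'; exact H0 hf'
    have e : ch.poly (h * h') = ch.poly (g' * (g - .C v * h)) := by
      rw [hf', inv_div, div_eq_div_iff hk k2] at k3
      rw [poly_mul, poly_mul, k3]
    have e' := congrArg (MvPolynomial.eval ![c, d]) (hch.poly_injective e)
    simp [hv] at e'
    tauto

end Chart

namespace IsPoint
variable {O : Subring K} {f g : K} {v w : ℂ}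

theorem exists_value (hO : IsPoint O) (hf : f ∈ O) : ∃ v, HasValue O f v := by
  obtain ⟨ch, c, d, hch, rfl⟩ := hO
  obtain ⟨g, h, hh, hh', hf⟩ := hf
  exact ⟨_, hch.hasValue_iff.2 ⟨g, h, hh, hh', hf, (div_mul_cancel₀ _ hh).symm⟩⟩

theorem con (_hO : IsPoint O) (v : ℂ) : HasValue O (con v) v := by
  simp [HasValue, O.zero_mem]

theorem add (hO : IsPoint O) (hf : HasValue O f v) (hg : HasValue O g w) :
    HasValue O (f + g) (v + w) := by
  obtain ⟨ch, c, d, hch, rfl⟩ := hO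
  rw [hch.hasValue_iff] at *
  obtain ⟨a, b, h1, h2, rfl, h3⟩ := hf
  obtain ⟨a', b', h1', h2', rfl, h3'⟩ := hg
  refine ⟨a * b' + b * a', b * b', by simp [h1, h1'], by simp [h2, h2'], ?_, ?_⟩
  · simp only [Chart.poly_add, Chart.poly_mul]; field_simp
  · simp only [map_add, map_mul, h3, h3']; ring

theorem mul (hO : IsPoint O) (hf : HasValue O f v) (hg : HasValue O g w) :
    HasValue O (f * g) (v * w) := by
  obtain ⟨ch, c, d, hch, rfl⟩ := hO
  rw [hch.hasValue_iff] at *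
  obtain ⟨a, b, h1, h2, rfl, h3⟩ := hf
  obtain ⟨a', b', h1', h2', rfl, h3'⟩ := hg
  refine ⟨a * a', b * b', by simp [h1, h1'], by simp [h2, h2'], ?_, ?_⟩
  · simp only [Chart.poly_mul]; field_simp
  · simp only [map_mul, h3, h3']; ring

theorem inv (hO : IsPoint O) (hf : HasValue O f v) (hv : v ≠ 0) : HasValue O f⁻¹ v⁻¹ := by
  obtain ⟨ch, c, d, hch, rfl⟩ := hO
  rw [hch.hasValue_iff] at *
  obtain ⟨a, b, h1, h2, rfl, h3⟩ := hf
  have h4 : MvPolynomial.eval ![c, d] a ≠ 0 := by rw [h3]; exact mul_ne_zero hv h1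
  refine ⟨b, a, h4, hch.poly_ne_zero_of_eval h4, by rw [inv_div], ?_⟩
  rw [h3]; field_simp

theorem ne_zero (hO : IsPoint O) (hf : HasValue O f v) (hv : v ≠ 0) : f ≠ 0 := by
  obtain ⟨ch, c, d, hch, rfl⟩ := hO
  rw [hch.hasValue_iff] at *
  obtain ⟨a, b, h1, h2, rfl, h3⟩ := hf
  refine div_ne_zero (hch.poly_ne_zero_of_eval (v := ![c, d]) ?_) h2
  rw [h3]; exact mul_ne_zero hv h1

theorem neg (hO : IsPoint O) (hf : HasValue O f v) : HasValue O (-f) (-v) := by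
  have := hO.mul (hO.con (-1)) hf
  simpa [con_neg] using this

theorem sub (hO : IsPoint O) (hf : HasValue O f v) (hg : HasValue O g w) :
    HasValue O (f - g) (v - w) := by
  rw [sub_eq_add_neg, sub_eq_add_neg]; exact hO.add hf (hO.neg hg)

theorem div (hO : IsPoint O) (hf : HasValue O f v) (hg : HasValue O g w) (hw : w ≠ 0) :
    HasValue O (f / g) (v / w) := by
  rw [div_eq_mul_inv, div_eq_mul_inv]; exact hO.mul hf (hO.inv hg hw)

theorem unique (hO : IsPoint O) (hf : HasValue O f v) (hg : HasValue O f w) : v = w := by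
  by_contra h
  have := hO.ne_zero (hO.sub hf hg) (sub_ne_zero.2 h)
  simp at this

theorem poly (hO : IsPoint O) {ch : Chart} (hx : HasValue O ch.x v) (hy : HasValue O ch.y w)
    (g : MvPolynomial (Fin 2) ℂ) : HasValue O (ch.poly g) (MvPolynomial.eval ![v, w] g) := by
  induction g using MvPolynomial.induction_on with
  | C a => simpa using hO.con a
  | add g h hg hh => simpa using hO.add hg hh
  | mul_X g i hg =>
    rw [Chart.poly_mul, map_mul, MvPolynomial.eval_X]
    refine hO.mul hg ?_
    fin_cases i
    · simpa using hx
    · simpa using hy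

end IsPoint

theorem HasValue.mem {O : Subring K} {f : K} {v : ℂ} (hO : IsPoint O) (hf : HasValue O f v) :
    f ∈ O := by
  simpa using O.add_mem hf.1 (show con v ∈ O by
    obtain ⟨ch, c, d, -, rfl⟩ := hO
    exact ⟨.C v, 1, by simp, by simp, by simp⟩)

theorem HasValue.congr {O : Subring K} {f g : K} {v w : ℂ} (hf : HasValue O f v) (h : f = g)
    (h' : v = w) : HasValue O g w := h ▸ h' ▸ hf

namespace Chart
variable {ch ch' : Chart} {c d c' d' : ℂ}

theorem Good.hasValue_x (hch : ch.Good) (c d : ℂ) : HasValue (ch.localRing c d) ch.x c :=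
  hch.hasValue_iff.2 ⟨.X 0, 1, by simp, by simp, by simp, by simp⟩

theorem Good.hasValue_y (hch : ch.Good) (c d : ℂ) : HasValue (ch.localRing c d) ch.y d :=
  hch.hasValue_iff.2 ⟨.X 1, 1, by simp, by simp, by simp, by simp⟩

end Chart

/-- If the coordinates of a chart take the values `c`, `d` at a point `O`, then all functions
regular at the point `(c, d)` of the chart are regular at `O`, with the same value. -/
theorem IsPoint.mono {O : Subring K} (hO : IsPoint O) {ch : Chart} (hch : ch.Good) {c d : ℂ}
    (hx : HasValue O ch.x c) (hy : HasValue O ch.y d) {f : K} {v : ℂ}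
    (hf : HasValue (ch.localRing c d) f v) : HasValue O f v := by
  obtain ⟨g, h, h1, h2, rfl, h3⟩ := hch.hasValue_iff.1 hf
  refine (hO.div (hO.poly hx hy g) (hO.poly hx hy h) h1).congr rfl ?_
  rw [h3]; field_simp

theorem IsPoint.localRing_le {O : Subring K} (hO : IsPoint O) {ch : Chart} (hch : ch.Good) {c d : ℂ}
    (hx : HasValue O ch.x c) (hy : HasValue O ch.y d) : ch.localRing c d ≤ O := by
  intro f hf
  obtain ⟨v, hv⟩ := (hch.isPoint c d).exists_value hf
  exact (hO.mono hch hx hy hv).mem hO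

/-- Two points of charts have the same local ring if the coordinates of each chart are regular at
the point of the other one, with the right values. -/
theorem Chart.Good.localRing_eq {ch ch' : Chart} (hch : ch.Good) (hch' : ch'.Good) {c d c' d' : ℂ}
    (hx : HasValue (ch.localRing c d) ch'.x c') (hy : HasValue (ch.localRing c d) ch'.y d')
    (hx' : HasValue (ch'.localRing c' d') ch.x c) (hy' : HasValue (ch'.localRing c' d') ch.y d) :
    ch.localRing c d = ch'.localRing c' d' :=
  le_antisymm ((hch'.isPoint c' d').localRing_le hch hx' hy')
    ((hch.isPoint c d).localRing_le hch' hx hy)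

theorem Chart.Good.localRing_swap {ch : Chart} (hch : ch.Good) (c d : ℂ) :
    ch.swap.localRing d c = ch.localRing c d :=
  hch.swap.localRing_eq hch (hch.swap.hasValue_y d c) (hch.swap.hasValue_x d c)
    (hch.hasValue_y c d) (hch.hasValue_x c d)

theorem Chart.map_poly (σ : K ≃ₐ[ℂ] K) (ch : Chart) (g : MvPolynomial (Fin 2) ℂ) :
    (ch.map σ).poly g = σ (ch.poly g) := by
  induction g using MvPolynomial.induction_on with
  | C a => simp [con]
  | add g h hg hh => simp [hg, hh]
  | mul_X g i hg =>
    rw [poly_mul, poly_mul, map_mul, hg]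
    fin_cases i
    · simp [show (ch.map σ).x = σ ch.x from rfl]
    · simp [show (ch.map σ).y = σ ch.y from rfl]

theorem map_con (σ : K ≃ₐ[ℂ] K) (c : ℂ) : σ (con c) = con c := σ.commutes c

theorem Chart.localRing_map (σ : K ≃ₐ[ℂ] K) (ch : Chart) (c d : ℂ) :
    (ch.localRing c d).map (σ : K →+* K) = (ch.map σ).localRing c d := by
  ext f
  constructor
  · rintro ⟨_, ⟨g, h, h1, h2, rfl⟩, rfl⟩
    exact ⟨g, h, h1, by rw [map_poly]; simpa using h2, by simp [map_poly]⟩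
  · rintro ⟨g, h, h1, h2, rfl⟩
    refine ⟨ch.poly g / ch.poly h, ⟨g, h, h1, ?_, rfl⟩, by simp [map_poly]⟩
    rw [map_poly] at h2; simpa using h2

theorem Chart.blowUp₀_map (σ : K ≃ₐ[ℂ] K) (ch : Chart) (c d : ℂ) :
    (ch.blowUp₀ c d).map σ = (ch.map σ).blowUp₀ c d := by
  simp [Chart.map, Chart.blowUp₀, map_con]

theorem Chart.blowUp₁_map (σ : K ≃ₐ[ℂ] K) (ch : Chart) (c d : ℂ) :
    (ch.blowUp₁ c d).map σ = (ch.map σ).blowUp₁ c d := by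
  simp [Chart.map, Chart.blowUp₁, map_con]

open Chart

/-! ### Points of exceptional curves -/

/-- The points of the exceptional curve of the blow-up of the point `(c, d)` of the chart. -/
def Exc (ch : Chart) (c d : ℂ) : Set (Subring K) :=
  {O | ∃ e : ℂ, O = (ch.blowUp₀ c d).localRing e 0 ∨ O = (ch.blowUp₁ c d).localRing e 0}

theorem blowUp_eq (X : Set (Subring K)) (ch : Chart) (c d : ℂ) :
    blowUp X ch c d = (X \ {ch.localRing c d}) ∪ Exc ch c d := rfl

theorem Exc_swap (ch : Chart) (c d : ℂ) : Exc ch.swap d c = Exc ch c d := by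
  ext O; exact exists_congr fun e => or_comm

theorem Exc.isPoint {ch : Chart} (hch : ch.Good) {c d : ℂ} {O : Subring K} (hO : O ∈ Exc ch c d) :
    IsPoint O := by
  obtain ⟨e, rfl | rfl⟩ := hO
  · exact (hch.blowUp₀ c d).isPoint e 0
  · exact (hch.blowUp₁ c d).isPoint e 0

namespace Chart
variable {ch ch' : Chart} {c d c' d' : ℂ}

theorem Good.blowUp₀_val_x (hch : ch.Good) (c d e : ℂ) :
    HasValue ((ch.blowUp₀ c d).localRing e 0) ch.x c := by
  have hb := hch.blowUp₀ c d
  exact ((hb.isPoint e 0).add (hb.hasValue_y e 0) ((hb.isPoint e 0).con c)).congr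
    (by simp [Chart.blowUp₀]) (by simp)

theorem Good.blowUp₀_val_y (hch : ch.Good) (c d e : ℂ) :
    HasValue ((ch.blowUp₀ c d).localRing e 0) ch.y d := by
  have hb := hch.blowUp₀ c d
  have h0 := hch.x_sub_ne_zero c
  have hp := hb.isPoint e 0
  exact (hp.add (hp.mul (hb.hasValue_x e 0) (hb.hasValue_y e 0)) (hp.con d)).congr
    (by simp only [Chart.blowUp₀]; field_simp; ring) (by simp)

theorem Good.blowUp₁_val_x (hch : ch.Good) (c d e : ℂ) :
    HasValue ((ch.blowUp₁ c d).localRing e 0) ch.x c := hch.swap.blowUp₀_val_y d c e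

theorem Good.blowUp₁_val_y (hch : ch.Good) (c d e : ℂ) :
    HasValue ((ch.blowUp₁ c d).localRing e 0) ch.y d := hch.swap.blowUp₀_val_x d c e

/-- Functions keep their value at the centre on the whole exceptional curve. -/
theorem Good.hasValue_of_mem_Exc (hch : ch.Good) {O : Subring K} (hO : O ∈ Exc ch c d) {f : K}
    {v : ℂ} (hf : HasValue (ch.localRing c d) f v) : HasValue O f v := by
  have hp := Exc.isPoint hch hO
  obtain ⟨e, rfl | rfl⟩ := hO
  · exact hp.mono hch (hch.blowUp₀_val_x c d e) (hch.blowUp₀_val_y c d e) hf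
  · exact hp.mono hch (hch.blowUp₁_val_x c d e) (hch.blowUp₁_val_y c d e) hf

/-- The maximal ideal of the local ring of a point is generated by the two coordinates. -/
theorem Good.exists_linear (hch : ch.Good) {f : K} (hf : HasValue (ch.localRing c d) f 0) :
    ∃ a b : K, ∃ v w : ℂ, HasValue (ch.localRing c d) a v ∧ HasValue (ch.localRing c d) b w ∧
      f = a * (ch.x - con c) + b * (ch.y - con d) := by
  have key (g : MvPolynomial (Fin 2) ℂ) : ∃ A B : MvPolynomial (Fin 2) ℂ,
      g = .C (MvPolynomial.eval ![c, d] g) + A * (.X 0 - .C c) + B * (.X 1 - .C d) := by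
    induction g using MvPolynomial.induction_on with
    | C a => exact ⟨0, 0, by simp⟩
    | add g h hg hh =>
      obtain ⟨A, B, h1⟩ := hg
      obtain ⟨A', B', h2⟩ := hh
      refine ⟨A + A', B + B', ?_⟩
      rw [map_add, MvPolynomial.C_add]
      linear_combination h1 + h2
    | mul_X g i hg =>
      obtain ⟨A, B, h1⟩ := hg
      rw [map_mul, MvPolynomial.C_mul, MvPolynomial.eval_X]
      fin_cases i
      · refine ⟨A * .X 0 + .C (MvPolynomial.eval ![c, d] g), B * .X 0, ?_⟩
        simp only [Fin.zero_eta, Matrix.cons_val_zero]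
        linear_combination .X 0 * h1
      · refine ⟨A * .X 1, B * .X 1 + .C (MvPolynomial.eval ![c, d] g), ?_⟩
        simp only [Fin.mk_one, Matrix.cons_val_one, Matrix.cons_val_fin_one]
        linear_combination .X 1 * h1
  obtain ⟨g, h, h1, h2, rfl, h3⟩ := hch.hasValue_iff.1 hf
  obtain ⟨A, B, hg⟩ := key g
  have hp := hch.isPoint c d
  have hv := hp.poly (hch.hasValue_x c d) (hch.hasValue_y c d)
  refine ⟨ch.poly A / ch.poly h, ch.poly B / ch.poly h, _, _, hp.div (hv A) (hv h) h1,
    hp.div (hv B) (hv h) h1, ?_⟩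
  have hg' := congrArg ch.poly hg
  rw [h3] at hg'
  simp only [zero_mul, MvPolynomial.C_0, zero_add, poly_add, poly_mul, poly_sub, poly_X0, poly_X1,
    poly_C] at hg'
  rw [hg']; ring

theorem Good.hasValue_x_sub (hch : ch.Good) (c d : ℂ) :
    HasValue (ch.localRing c d) (ch.x - con c) 0 :=
  ((hch.isPoint c d).sub (hch.hasValue_x c d) ((hch.isPoint c d).con c)).congr rfl (sub_self c)

theorem Good.hasValue_y_sub (hch : ch.Good) (c d : ℂ) :
    HasValue (ch.localRing c d) (ch.y - con d) 0 :=
  ((hch.isPoint c d).sub (hch.hasValue_y c d) ((hch.isPoint c d).con d)).congr rfl (sub_self d)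

/-- If two charts are centred at the same point, a point of one exceptional curve, seen in the first
chart of the blow-up, is a point of the first chart of the other blow-up as long as the quotient `s`
of the first coordinates does not vanish at it. -/
theorem Good.exc_aux (hch : ch.Good) (hch' : ch'.Good)
    (h : ch.localRing c d = ch'.localRing c' d') {e s : ℂ} (hs : s ≠ 0)
    (hval : HasValue ((ch.blowUp₀ c d).localRing e 0) ((ch'.x - con c') / (ch.x - con c)) s) :
    ∃ e', (ch.blowUp₀ c d).localRing e 0 = (ch'.blowUp₀ c' d').localRing e' 0 := by
  have hb := hch.blowUp₀ c d
  have hb' := hch'.blowUp₀ c' d'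
  have hp := hb.isPoint e 0
  have x0 := hch.x_sub_ne_zero c
  have x0' := hch'.x_sub_ne_zero c'
  have up : ∀ {f v}, HasValue (ch.localRing c d) f v →
      HasValue ((ch.blowUp₀ c d).localRing e 0) f v :=
    fun hf => hch.hasValue_of_mem_Exc ⟨e, Or.inl rfl⟩ hf
  -- Each pair of coordinates centred at the point is a linear combination of the other pair, with
  -- regular coefficients; the values of these coefficients relate the directions at the point.
  obtain ⟨γ, δ, γ₀, δ₀, hγ, hδ, hy'⟩ := hch.exists_linear (h ▸ hch'.hasValue_y_sub c' d')
  obtain ⟨α', β', α₀', β₀', hα', hβ', hx⟩ := hch'.exists_linear (h ▸ hch.hasValue_x_sub c d)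
  obtain ⟨γ', δ', γ₀', δ₀', hγ', hδ', hy⟩ := hch'.exists_linear (h ▸ hch.hasValue_y_sub c d)
  set x := ch.x - con c
  set y := ch.y - con d
  set x' := ch'.x - con c'
  set y' := ch'.y - con d'
  have hr : HasValue ((ch.blowUp₀ c d).localRing e 0) (y' / x) (γ₀ + δ₀ * e) :=
    (hp.add (up hγ) (hp.mul (up hδ) (hb.hasValue_x e 0))).congr
      (by simp only [Chart.blowUp₀]; rw [hy']; simp only [x, y] at *; field_simp) rfl
  set r := γ₀ + δ₀ * e
  have e1 : α₀' * s + β₀' * r = 1 := by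
    refine hp.unique (f := 1) ?_ (by simpa using hp.con 1)
    refine (hp.add (hp.mul (up (h ▸ hα')) hval) (hp.mul (up (h ▸ hβ')) hr)).congr ?_ rfl
    rw [← mul_div_assoc, ← mul_div_assoc, ← add_div, ← hx, div_self x0]
  have e2 : γ₀' * s + δ₀' * r = e := by
    refine hp.unique ?_ (hb.hasValue_x e 0)
    refine (hp.add (hp.mul (up (h ▸ hγ')) hval) (hp.mul (up (h ▸ hδ')) hr)).congr ?_ rfl
    rw [← mul_div_assoc, ← mul_div_assoc, ← add_div, ← hy]
    rfl
  refine ⟨r / s, hb.localRing_eq hb' ?_ ?_ ?_ ?_⟩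
  · refine (hp.div hr hval hs).congr ?_ rfl
    change y' / x / (x' / x) = y' / x'
    field_simp
  · exact up (h ▸ hch'.hasValue_x_sub c' d')
  all_goals
    have hp' := hb'.isPoint (r / s) 0
    have up' : ∀ {f v}, HasValue (ch'.localRing c' d') f v →
        HasValue ((ch'.blowUp₀ c' d').localRing (r / s) 0) f v :=
      fun hf => hch'.hasValue_of_mem_Exc ⟨r / s, Or.inl rfl⟩ hf
  · have k1 : HasValue ((ch'.blowUp₀ c' d').localRing (r / s) 0) (x / x') (1 / s) := by
      refine (hp'.add (up' hα') (hp'.mul (up' hβ') (hb'.hasValue_x _ 0))).congr ?_ ?_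
      · change α' + β' * (y' / x') = x / x'
        rw [hx]; field_simp
      · rw [← e1]; field_simp
    have k2 : HasValue ((ch'.blowUp₀ c' d').localRing (r / s) 0) (y / x') (e / s) := by
      refine (hp'.add (up' hγ') (hp'.mul (up' hδ') (hb'.hasValue_x _ 0))).congr ?_ ?_
      · change γ' + δ' * (y' / x') = y / x'
        rw [hy]; field_simp
      · rw [← e2]; field_simp
    refine (hp'.div k2 k1 (by simpa using hs)).congr ?_ (by field_simp)
    change y / x' / (x / x') = y / x
    field_simp
  · exact up' (h ▸ hch.hasValue_x_sub c d)

/-- If two charts are centred at the same point, a point of one exceptional curve lies on the other: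
the quotients of the two new coordinates by the old first one are regular, and do not vanish
simultaneously, at the given point. -/
theorem Good.exc_point (hch : ch.Good) (hch' : ch'.Good)
    (h : ch.localRing c d = ch'.localRing c' d') (e : ℂ) :
    ∃ e', (ch.blowUp₀ c d).localRing e 0 = (ch'.blowUp₀ c' d').localRing e' 0 ∨
      (ch.blowUp₀ c d).localRing e 0 = (ch'.swap.blowUp₀ d' c').localRing e' 0 := by
  have hb := hch.blowUp₀ c d
  have hp := hb.isPoint e 0
  have x0 := hch.x_sub_ne_zero c
  have up : ∀ {f v}, HasValue (ch.localRing c d) f v →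
      HasValue ((ch.blowUp₀ c d).localRing e 0) f v :=
    fun hf => hch.hasValue_of_mem_Exc ⟨e, Or.inl rfl⟩ hf
  have lin : ∀ {f}, HasValue (ch.localRing c d) f 0 →
      ∃ s, HasValue ((ch.blowUp₀ c d).localRing e 0) (f / (ch.x - con c)) s := by
    intro f hf
    obtain ⟨α, β, α₀, β₀, hα, hβ, rfl⟩ := hch.exists_linear hf
    refine ⟨_, (hp.add (up hα) (hp.mul (up hβ) (hb.hasValue_x e 0))).congr ?_ rfl⟩
    simp only [Chart.blowUp₀]; field_simp
  obtain ⟨s, hs⟩ := lin (h ▸ hch'.hasValue_x_sub c' d')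
  obtain ⟨r, hr⟩ := lin (h ▸ hch'.hasValue_y_sub c' d')
  by_cases s0 : s = 0
  · by_cases r0 : r = 0
    · exfalso
      obtain ⟨α', β', α₀', β₀', hα', hβ', hx⟩ := hch'.exists_linear (h ▸ hch.hasValue_x_sub c d)
      have : α₀' * s + β₀' * r = 1 := by
        refine hp.unique (f := 1) ?_ (by simpa using hp.con 1)
        refine (hp.add (hp.mul (up (h ▸ hα')) hs) (hp.mul (up (h ▸ hβ')) hr)).congr ?_ rfl
        rw [← mul_div_assoc, ← mul_div_assoc, ← add_div, ← hx, div_self x0]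
      simp [s0, r0] at this
    · obtain ⟨e', he'⟩ := hch.exc_aux hch'.swap (h.trans (hch'.localRing_swap c' d').symm) r0 hr
      exact ⟨e', Or.inr he'⟩
  · obtain ⟨e', he'⟩ := hch.exc_aux hch' h s0 hs
    exact ⟨e', Or.inl he'⟩

/-- The points of the exceptional curve depend only on the local ring of the centre. -/
theorem Good.Exc_eq (hch : ch.Good) (hch' : ch'.Good)
    (h : ch.localRing c d = ch'.localRing c' d') : Exc ch c d = Exc ch' c' d' := by
  have key {ch ch' : Chart} {c d c' d' : ℂ} (hch : ch.Good) (hch' : ch'.Good)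
      (h : ch.localRing c d = ch'.localRing c' d') : Exc ch c d ⊆ Exc ch' c' d' := by
    rintro O ⟨e, rfl | rfl⟩
    · exact hch.exc_point hch' h e
    · exact hch.swap.exc_point hch' ((hch.localRing_swap c d).trans h) e
  exact (key hch hch' h).antisymm (key hch' hch h.symm)

end Chart

theorem Exc_map (σ : K ≃ₐ[ℂ] K) {ch : Chart} {c d : ℂ} {O : Subring K} (hO : O ∈ Exc ch c d) :
    O.map (σ : K →+* K) ∈ Exc (ch.map σ) c d := by
  obtain ⟨e, rfl | rfl⟩ := hO
  · exact ⟨e, Or.inl (by rw [localRing_map, blowUp₀_map])⟩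
  · exact ⟨e, Or.inr (by rw [localRing_map, blowUp₁_map])⟩

/-! ### Localisations of charts at prime ideals -/

/-- `R` is the localisation of the coordinate ring of the chart at a prime ideal. -/
def Loc (ch : Chart) (R : ValuationSubring K) : Prop :=
  (∀ g, ch.poly g ∈ R) ∧ ∀ f ∈ R, ∃ g h, R.valuation (ch.poly h) = 1 ∧ f = ch.poly g / ch.poly h

/-- `R` is the localisation of the local ring `O` at a prime ideal. -/
def LocAt (O : Subring K) (R : ValuationSubring K) : Prop :=
  (∀ f ∈ O, f ∈ R) ∧ ∀ f ∈ R, ∃ g ∈ O, ∃ h ∈ O, R.valuation h = 1 ∧ f = g / h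

section valuation
variable {R : ValuationSubring K}

theorem mem_iff_val {f : K} : f ∈ R ↔ R.valuation f ≤ 1 := (R.valuation_le_one_iff f).symm

theorem val_eq_one_of_mem {f : K} (h0 : f ≠ 0) (h : f ∈ R) (h' : f⁻¹ ∈ R) : R.valuation f = 1 := by
  rw [mem_iff_val] at h h'
  refine h.antisymm ?_
  rw [map_inv₀] at h'
  exact (inv_le_one₀ (by simpa [zero_lt_iff] using h0)).1 h'

theorem ne_zero_of_val {f : K} (h : R.valuation f = 1) : f ≠ 0 := by
  rintro rfl; simp at h

theorem inv_mem_of_val {f : K} (h : R.valuation f = 1) : f⁻¹ ∈ R := by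
  rw [mem_iff_val, map_inv₀, h, inv_one]

theorem mem_of_val {f : K} (h : R.valuation f = 1) : f ∈ R := mem_iff_val.2 h.le

theorem val_mul_lt {f g : K} (hf : R.valuation f ≤ 1) (hg : R.valuation g < 1) :
    R.valuation (f * g) < 1 := by
  rw [map_mul, mul_comm]
  exact mul_lt_one_of_lt_of_le hg hf

theorem val_con {c : ℂ} (hc : c ≠ 0) (hR : ∀ c, con c ∈ R) : R.valuation (con c) = 1 :=
  val_eq_one_of_mem (con_ne_zero hc) (hR c) (by rw [← con_inv]; exact hR _)

theorem val_irreducible [IsDiscreteValuationRing R] {π : R} (hπ : Irreducible π) :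
    R.valuation (π : K) < 1 ∧ ∀ f : K, R.valuation f < 1 → R.valuation f ≤ R.valuation (π : K) := by
  refine ⟨?_, fun f hf => ?_⟩
  · rw [← R.valuation_lt_one_iff, IsLocalRing.mem_maximalIdeal]
    exact hπ.not_isUnit
  · have hf' : f ∈ R := mem_iff_val.2 hf.le
    have : (⟨f, hf'⟩ : R) ∈ IsLocalRing.maximalIdeal R := (R.valuation_lt_one_iff _).2 hf
    rw [hπ.maximalIdeal_eq, Ideal.mem_span_singleton] at this
    obtain ⟨w, hw⟩ := this
    have hw' : f = π * w := congrArg Subtype.val hw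
    rw [hw', map_mul]
    exact mul_le_of_le_one_right' (R.valuation_le_one w)

theorem HasOrd.val_zpow {f : K} {n : ℤ} (h : HasOrd R f n) :
    ∃ π : R, Irreducible π ∧ R.valuation f = R.valuation (π : K) ^ n := by
  obtain ⟨π, hπ, u, rfl⟩ := h
  refine ⟨π, hπ, ?_⟩
  rw [map_mul, map_zpow₀, R.valuation_unit, mul_one]

theorem HasOrd.lt_one_iff [IsDiscreteValuationRing R] {f : K} {n : ℤ} (h : HasOrd R f n) :
    R.valuation f < 1 ↔ 0 < n := by
  obtain ⟨π, hπ, h1⟩ := h.val_zpow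
  have h0 : 0 < R.valuation (π : K) := by
    rw [zero_lt_iff, Ne, map_eq_zero]; exact fun h => hπ.ne_zero (Subtype.ext h)
  rw [h1, zpow_lt_one_iff_right_of_lt_one₀ h0 (val_irreducible hπ).1]

theorem HasOrd.le_one_iff [IsDiscreteValuationRing R] {f : K} {n : ℤ} (h : HasOrd R f n) :
    R.valuation f ≤ 1 ↔ 0 ≤ n := by
  obtain ⟨π, hπ, h1⟩ := h.val_zpow
  have h0 : 0 < R.valuation (π : K) := by
    rw [zero_lt_iff, Ne, map_eq_zero]; exact fun h => hπ.ne_zero (Subtype.ext h)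
  rw [h1, zpow_le_one_iff_right_of_lt_one₀ h0 (val_irreducible hπ).1]

theorem HasOrd.ne_zero {f : K} {n : ℤ} (h : HasOrd R f n) : f ≠ 0 := by
  obtain ⟨π, hπ, u, rfl⟩ := h
  refine mul_ne_zero (zpow_ne_zero _ fun h => hπ.ne_zero (Subtype.ext h)) ?_
  intro h0
  exact u.ne_zero (Subtype.ext h0)

theorem HasOrd.of_val [IsDiscreteValuationRing R] {f : K} (h : R.valuation f = 1) :
    HasOrd R f 0 := by
  obtain ⟨π, hπ⟩ := IsDiscreteValuationRing.exists_irreducible R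
  refine ⟨π, hπ, ⟨⟨f, mem_of_val h⟩, ⟨f⁻¹, inv_mem_of_val h⟩, ?_, ?_⟩, by simp⟩
  · ext; simp [ne_zero_of_val h]
  · ext; simp [ne_zero_of_val h]

theorem HasOrd.unique [IsDiscreteValuationRing R] {f : K} {m n : ℤ} (h : HasOrd R f m)
    (h' : HasOrd R f n) : m = n := by
  have h1 := h.mul h'.inv
  rw [mul_inv_cancel₀ h.ne_zero] at h1
  have := h1.lt_one_iff
  have := h1.le_one_iff
  simp at *
  omega

end valuation

theorem Loc.con_mem {ch : Chart} {R : ValuationSubring K} (h : Loc ch R) (c : ℂ) : con c ∈ R := by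
  simpa using h.1 (.C c)
theorem Loc.x_mem {ch : Chart} {R : ValuationSubring K} (h : Loc ch R) : ch.x ∈ R := by
  simpa using h.1 (.X 0)
theorem Loc.y_mem {ch : Chart} {R : ValuationSubring K} (h : Loc ch R) : ch.y ∈ R := by
  simpa using h.1 (.X 1)

/-- The coordinate ring of a chart and that of another one have the same localisation `R` if each is
obtained from the other by inverting functions that are units of `R`. -/
theorem Loc.change {ch ch' : Chart} {R : ValuationSubring K} (hR : Loc ch R)
    (hx : ch'.x ∈ R) (hy : ch'.y ∈ R)
    (hx' : ∃ a b, R.valuation (ch'.poly b) = 1 ∧ ch.x = ch'.poly a / ch'.poly b)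
    (hy' : ∃ a b, R.valuation (ch'.poly b) = 1 ∧ ch.y = ch'.poly a / ch'.poly b) : Loc ch' R := by
  have key (g : MvPolynomial (Fin 2) ℂ) :
      ∃ a b, R.valuation (ch'.poly b) = 1 ∧ ch.poly g = ch'.poly a / ch'.poly b := by
    induction g using MvPolynomial.induction_on with
    | C c => exact ⟨.C c, 1, by simp, by simp⟩
    | add g h hg hh =>
      obtain ⟨a, b, h1, h2⟩ := hg
      obtain ⟨a', b', h1', h2'⟩ := hh
      refine ⟨a * b' + b * a', b * b', by simp [h1, h1'], ?_⟩
      have := ne_zero_of_val h1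
      have := ne_zero_of_val h1'
      simp only [poly_add, poly_mul, h2, h2']; field_simp
    | mul_X g i hg =>
      obtain ⟨a, b, h1, h2⟩ := hg
      have hi : ∃ a b, R.valuation (ch'.poly b) = 1 ∧
          ch.poly (.X i) = ch'.poly a / ch'.poly b := by
        fin_cases i
        · simpa using hx'
        · simpa using hy'
      obtain ⟨a', b', h1', h2'⟩ := hi
      refine ⟨a * a', b * b', by simp [h1, h1'], ?_⟩
      rw [poly_mul, poly_mul, poly_mul, h2, h2', div_mul_div_comm]
  refine ⟨fun g => ?_, fun f hf => ?_⟩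
  · induction g using MvPolynomial.induction_on with
    | C c => simpa using hR.con_mem c
    | add g h hg hh => simpa using R.add_mem _ _ hg hh
    | mul_X g i hg =>
      rw [poly_mul]
      refine R.mul_mem _ _ hg ?_
      fin_cases i
      · simpa using hx
      · simpa using hy
  · obtain ⟨g, h, hv, rfl⟩ := hR.2 f hf
    obtain ⟨a, b, h1, h2⟩ := key g
    obtain ⟨a', b', h1', h2'⟩ := key h
    rw [h2', map_div₀, h1', div_one] at hv
    refine ⟨a * b', b * a', by simp [h1, hv], ?_⟩
    rw [h2, h2', poly_mul, poly_mul, div_div_div_eq]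

theorem Loc.swap {ch : Chart} {R : ValuationSubring K} (hR : Loc ch R) : Loc ch.swap R :=
  hR.change hR.y_mem hR.x_mem ⟨.X 1, 1, by simp, by simp [Chart.swap]⟩
    ⟨.X 0, 1, by simp, by simp [Chart.swap]⟩

/-- Away from the exceptional curve the blow-up is an isomorphism. -/
theorem Loc.of_blowUp₀ {ch : Chart} {c d : ℂ} {R : ValuationSubring K}
    (hR : Loc (ch.blowUp₀ c d) R) (hx : R.valuation (ch.x - con c) = 1) : Loc ch R := by
  have h0 := ne_zero_of_val hx
  refine hR.change ?_ ?_ ⟨.X 1 - .C d, .X 0 - .C c, by simpa using hx, by simp [Chart.blowUp₀]⟩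
    ⟨.X 0 - .C c, 1, by simp, by simp [Chart.blowUp₀]⟩
  · have := R.add_mem _ _ hR.y_mem (hR.con_mem c)
    simpa [Chart.blowUp₀] using this
  · have := R.add_mem _ _ (R.mul_mem _ _ hR.x_mem hR.y_mem) (hR.con_mem d)
    simpa [Chart.blowUp₀, h0] using this

/-- A chart with first coordinate inverted has the same localisations where it is a unit. -/
theorem Loc.of_inv {ch : Chart} {R : ValuationSubring K}
    (hR : Loc ⟨ch.x⁻¹, ch.y⟩ R) (hx : R.valuation ch.x = 1) : Loc ch R := by
  refine hR.change (mem_of_val hx) hR.y_mem ⟨1, .X 0, by simpa using hx, by simp⟩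
    ⟨.X 1, 1, by simp, by simp⟩

namespace Chart
variable {ch ch' : Chart} {F : MvPolynomial (Fin 2) ℂ} {R : ValuationSubring K}

/-- If `R` is a localisation of the chart in which the irreducible polynomial `F` vanishes, then the
elements of the coordinate ring vanishing in `R` are the multiples of `F`. -/
theorem Good.val_lt_one_iff_dvd (hch : ch.Good) [IsDiscreteValuationRing R] (hR : Loc ch R)
    (hF : Irreducible F) (hFR : R.valuation (ch.poly F) < 1) (g : MvPolynomial (Fin 2) ℂ) :
    R.valuation (ch.poly g) < 1 ↔ F ∣ g := by
  have le_one (g : MvPolynomial (Fin 2) ℂ) : R.valuation (ch.poly g) ≤ 1 := mem_iff_val.1 (hR.1 g)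
  constructor
  swap
  · rintro ⟨k, rfl⟩
    rw [poly_mul, map_mul]
    exact mul_lt_one_of_lt_of_le hFR (le_one k)
  obtain ⟨π, hπ⟩ := IsDiscreteValuationRing.exists_irreducible R
  obtain ⟨hπ1, hπ2⟩ := val_irreducible hπ
  obtain ⟨n, m, hm, hnm⟩ := hR.2 _ π.2
  have hn : R.valuation (ch.poly n) = R.valuation (π : K) := by rw [hnm, map_div₀, hm, div_one]
  have fac (n : MvPolynomial (Fin 2) ℂ) (h0 : n ≠ 0) : R.valuation (ch.poly n) < 1 →
      ∃ n', Irreducible n' ∧ n' ∣ n ∧ R.valuation (ch.poly n') < 1 := by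
    induction n using WfDvdMonoid.induction_on_irreducible with
    | zero => exact absurd rfl h0
    | unit u hu =>
      intro hlt
      obtain ⟨w, hw⟩ := hu.exists_right_inv
      have := congrArg (fun g => R.valuation (ch.poly g)) hw
      simp only [poly_mul, map_mul, poly_one, map_one] at this
      exact absurd this (mul_lt_one_of_lt_of_le hlt (le_one w)).ne
    | mul a i ha hi ih =>
      intro hlt
      by_cases hlt' : R.valuation (ch.poly i) < 1
      · exact ⟨i, hi, dvd_mul_right i a, hlt'⟩
      · have h1 := (le_one i).antisymm (not_lt.1 hlt')
        rw [poly_mul, map_mul, h1, one_mul] at hlt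
        obtain ⟨n', h1, h2, h3⟩ := ih ha hlt
        exact ⟨n', h1, h2.mul_left i, h3⟩
  have hn0 : n ≠ 0 := by
    rintro rfl
    rw [poly_zero, map_zero, eq_comm, map_eq_zero] at hn
    exact hπ.ne_zero (Subtype.ext hn)
  -- The numerator `n` of a uniformizer has an irreducible factor `n'` that is itself a uniformizer;
  -- it divides every polynomial that vanishes in `R`, and in particular it is associated to `F`.
  obtain ⟨n', hn', ⟨k, hk⟩, hlt⟩ := fac n hn0 (hn ▸ hπ1)
  have hle (f : K) (hf : R.valuation f < 1) : R.valuation f ≤ R.valuation (ch.poly n') := by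
    refine (hπ2 f hf).trans ?_
    rw [← hn, hk, poly_mul, map_mul]
    exact mul_le_of_le_one_right' (le_one k)
  have hdvd (g : MvPolynomial (Fin 2) ℂ) (hg : R.valuation (ch.poly g) < 1) : n' ∣ g := by
    have h0 := hch.poly_ne_zero hn'.ne_zero
    have hq : ch.poly g / ch.poly n' ∈ R := by
      rw [mem_iff_val, map_div₀]
      exact div_le_one_of_le₀ (hle _ hg) zero_le
    obtain ⟨a, b, hb, hab⟩ := hR.2 _ hq
    rw [div_eq_div_iff h0 (ne_zero_of_val hb), ← poly_mul, ← poly_mul] at hab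
    have h1 : n' ∣ g * b := ⟨a, by rw [hch.poly_injective hab, mul_comm]⟩
    refine (hn'.prime.dvd_or_dvd h1).resolve_right ?_
    rintro ⟨w, rfl⟩
    rw [poly_mul, map_mul] at hb
    exact (mul_lt_one_of_lt_of_le hlt (le_one w)).ne hb
  intro hg
  exact (hn'.associated_of_dvd hF (hdvd F hFR)).symm.dvd.trans (hdvd g hg)

/-- A prime divisor visible in a chart on which the irreducible polynomial `F` vanishes is the curve
`F = 0`. -/
theorem Good.eq_curveRing (hch : ch.Good) [IsDiscreteValuationRing R] (hR : Loc ch R)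
    (hF : Irreducible F) (hFR : R.valuation (ch.poly F) < 1) : (R : Set K) = ch.curveRing F := by
  have key := hch.val_lt_one_iff_dvd hR hF hFR
  ext f
  constructor
  · intro hf
    obtain ⟨g, h, hv, rfl⟩ := hR.2 f hf
    exact ⟨g, h, fun hd => ((key h).2 hd).ne hv, ne_zero_of_val hv, rfl⟩
  · rintro ⟨g, h, hd, h0, rfl⟩
    have hv : R.valuation (ch.poly h) = 1 :=
      (mem_iff_val.1 (hR.1 h)).antisymm (not_lt.1 (mt (key h).1 hd))
    rw [div_eq_mul_inv]
    exact R.mul_mem _ _ (hR.1 g) (inv_mem_of_val hv)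

end Chart

/-! ### Curves as valuation rings -/

namespace Chart
variable {ch ch' : Chart} {F : MvPolynomial (Fin 2) ℂ}

/-- Every rational function is a power of `F` times a unit of the local ring of the curve `F = 0`.
-/
theorem Good.exists_zpow (hch : ch.Good) (hF : Irreducible F) {f : K} (h0 : f ≠ 0) :
    ∃ n : ℤ, ∃ g h, ¬ F ∣ g ∧ ¬ F ∣ h ∧ f = ch.poly F ^ n * (ch.poly g / ch.poly h) := by
  obtain ⟨g, h, hh, rfl⟩ := hch.exists_eq_div f
  have hg : g ≠ 0 := by rintro rfl; simp at h0
  have hh' : h ≠ 0 := by rintro rfl; simp at hh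
  obtain ⟨a, g', hg', rfl⟩ := WfDvdMonoid.max_power_factor hg hF
  obtain ⟨b, h', hb, rfl⟩ := WfDvdMonoid.max_power_factor hh' hF
  refine ⟨(a : ℤ) - b, g', h', hg', hb, ?_⟩
  have hF0 := hch.poly_ne_zero hF.ne_zero
  rw [zpow_sub₀ hF0, poly_mul, poly_mul, poly_pow, poly_pow, zpow_natCast, zpow_natCast]
  rw [div_mul_div_comm]

theorem ne_zero_of_not_dvd {g : MvPolynomial (Fin 2) ℂ} (h : ¬ F ∣ g) : g ≠ 0 := by
  rintro rfl; exact h (dvd_zero _)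

/-- The local ring of an irreducible curve in a chart, as a valuation ring. -/
def curveVal (ch : Chart) (hch : ch.Good) (F : MvPolynomial (Fin 2) ℂ) (hF : Irreducible F) :
    ValuationSubring K where
  carrier := ch.curveRing F
  mul_mem' := by
    rintro _ _ ⟨g, h, hh, hh', rfl⟩ ⟨g', h', kh, kh', rfl⟩
    refine ⟨g * g', h * h', fun hd => (hF.prime.dvd_or_dvd hd).elim hh kh, ?_, ?_⟩
    · rw [poly_mul]; exact mul_ne_zero hh' kh'
    · rw [poly_mul, poly_mul, div_mul_div_comm]
  one_mem' := ⟨1, 1, hF.prime.not_dvd_one, by simp, by simp⟩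
  add_mem' := by
    rintro _ _ ⟨g, h, hh, hh', rfl⟩ ⟨g', h', kh, kh', rfl⟩
    refine ⟨g * h' + h * g', h * h', fun hd => (hF.prime.dvd_or_dvd hd).elim hh kh, ?_, ?_⟩
    · rw [poly_mul]; exact mul_ne_zero hh' kh'
    · rw [poly_mul, poly_add, poly_mul, poly_mul, div_add_div _ _ hh' kh']
  zero_mem' := ⟨0, 1, hF.prime.not_dvd_one, by simp, by simp⟩
  neg_mem' := by
    rintro _ ⟨g, h, hh, hh', rfl⟩
    exact ⟨-g, h, hh, hh', by simp only [poly, map_neg]; ring⟩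
  mem_or_inv_mem' := by
    intro f
    by_cases h0 : f = 0
    · exact Or.inl ⟨0, 1, hF.prime.not_dvd_one, by simp, by simp [h0]⟩
    obtain ⟨n, g, h, hg, hh, rfl⟩ := hch.exists_zpow hF h0
    have g0 := hch.poly_ne_zero (ne_zero_of_not_dvd hg)
    have h1 := hch.poly_ne_zero (ne_zero_of_not_dvd hh)
    rcases Int.eq_nat_or_neg n with ⟨m, rfl | rfl⟩
    · refine Or.inl ⟨F ^ m * g, h, hh, h1, ?_⟩
      rw [poly_mul, poly_pow, zpow_natCast, mul_div_assoc]
    · refine Or.inr ⟨F ^ m * h, g, hg, g0, ?_⟩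
      rw [poly_mul, poly_pow, zpow_neg, zpow_natCast, mul_inv, inv_inv, inv_div, mul_div_assoc]

variable (hch : ch.Good) (hF : Irreducible F)

theorem mem_curveVal {f : K} : f ∈ ch.curveVal hch F hF ↔
    ∃ g h, ¬ F ∣ h ∧ ch.poly h ≠ 0 ∧ f = ch.poly g / ch.poly h := Iff.rfl

theorem poly_mem_curveVal (g : MvPolynomial (Fin 2) ℂ) : ch.poly g ∈ ch.curveVal hch F hF :=
  ⟨g, 1, hF.prime.not_dvd_one, by simp, by simp⟩

theorem curveVal_poly {g : MvPolynomial (Fin 2) ℂ} (hg : ¬ F ∣ g) :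
    (ch.curveVal hch F hF).valuation (ch.poly g) = 1 :=
  have h0 := hch.poly_ne_zero (ne_zero_of_not_dvd hg)
  val_eq_one_of_mem h0 (poly_mem_curveVal hch hF g) ⟨1, g, hg, h0, by simp⟩

theorem curveVal_poly_self_lt : (ch.curveVal hch F hF).valuation (ch.poly F) < 1 := by
  have h0 := hch.poly_ne_zero hF.ne_zero
  refine lt_of_le_of_ne (mem_iff_val.1 (poly_mem_curveVal hch hF F)) fun h1 => ?_
  obtain ⟨g, h, hd, hh, hgh⟩ := inv_mem_of_val h1
  refine hd ⟨g, hch.poly_injective ?_⟩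
  rw [poly_mul]
  field_simp at hgh
  exact hgh

theorem loc_curveVal : Loc ch (ch.curveVal hch F hF) := by
  refine ⟨poly_mem_curveVal hch hF, ?_⟩
  rintro f ⟨g, h, hd, -, rfl⟩
  exact ⟨g, h, curveVal_poly hch hF hd, rfl⟩

/-- The equation of a curve is a uniformizer of its local ring. -/
theorem irreducible_poly :
    Irreducible (⟨ch.poly F, poly_mem_curveVal hch hF F⟩ : ch.curveVal hch F hF) := by
  set R := ch.curveVal hch F hF
  have unit_iff (a : R) : IsUnit a ↔ R.valuation (a : K) = 1 := R.valuation_eq_one_iff a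
  rw [irreducible_iff]
  refine ⟨fun h => (curveVal_poly_self_lt hch hF).ne ((unit_iff _).1 h), ?_⟩
  rintro ⟨a, ha⟩ ⟨b, hb⟩ hab
  rw [unit_iff, unit_iff]
  obtain ⟨g, h, hh, h0, rfl⟩ := ha
  obtain ⟨g', h', hh', h0', rfl⟩ := hb
  have hab' : ch.poly F = ch.poly g / ch.poly h * (ch.poly g' / ch.poly h') :=
    congrArg Subtype.val hab
  have e : F * (h * h') = g * g' := by
    apply hch.poly_injective
    simp only [poly_mul]
    rw [hab']; field_simp
  have hv := curveVal_poly hch hF hh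
  have hv' := curveVal_poly hch hF hh'
  simp only [map_div₀, R, hv, hv', div_one]
  have hne : ¬ F ∣ h * h' := fun hd => (hF.prime.dvd_or_dvd hd).elim hh hh'
  rcases hF.prime.dvd_or_dvd (Dvd.intro _ e) with ⟨k, rfl⟩ | ⟨k, rfl⟩
  · right
    refine curveVal_poly hch hF fun hd => hne ?_
    have e2 : h * h' = k * g' := mul_left_cancel₀ hF.ne_zero (by rw [e]; ring)
    rw [e2]
    exact hd.mul_left k
  · left
    refine curveVal_poly hch hF fun hd => hne ?_
    have e2 : h * h' = g * k := mul_left_cancel₀ hF.ne_zero (by rw [e]; ring)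
    rw [e2]
    exact hd.mul_right k

instance isDVR_curveVal : IsDiscreteValuationRing (ch.curveVal hch F hF) := by
  refine IsDiscreteValuationRing.ofHasUnitMulPowIrreducibleFactorization
    ⟨_, irreducible_poly hch hF, ?_⟩
  rintro ⟨f, hf⟩ hf0
  have hf0' : f ≠ 0 := fun h => hf0 (Subtype.ext h)
  obtain ⟨n, g, h, hg, hh, rfl⟩ := hch.exists_zpow hF hf0'
  set R := ch.curveVal hch F hF
  have hv : R.valuation (ch.poly g / ch.poly h) = 1 := by
    rw [map_div₀, curveVal_poly hch hF hg, curveVal_poly hch hF hh, div_one]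
  have hn : 0 ≤ n := by
    by_contra! hn
    have h1 := mem_iff_val.1 hf
    rw [map_mul, hv, mul_one, map_zpow₀, zpow_le_one_iff_right_of_lt_one₀
      (by rw [zero_lt_iff, Ne, map_eq_zero]; exact hch.poly_ne_zero hF.ne_zero)
      (curveVal_poly_self_lt hch hF)] at h1
    omega
  lift n to ℕ using hn
  refine ⟨n, ⟨⟨_, mem_of_val hv⟩, ⟨_, inv_mem_of_val hv⟩, ?_, ?_⟩, ?_⟩
  · ext; simpa using mul_inv_cancel₀ (ne_zero_of_val hv)
  · ext; simpa using inv_mul_cancel₀ (ne_zero_of_val hv)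
  · ext
    simp [zpow_natCast]

theorem hasOrd_curveVal_self : HasOrd (ch.curveVal hch F hF) (ch.poly F) 1 :=
  ⟨_, irreducible_poly hch hF, 1, by simp⟩

variable {c d : ℂ}

theorem not_dvd_of_eval {h : MvPolynomial (Fin 2) ℂ} (hF0 : MvPolynomial.eval ![c, d] F = 0)
    (hh : MvPolynomial.eval ![c, d] h ≠ 0) : ¬ F ∣ h := by
  rintro ⟨k, rfl⟩; simp [hF0] at hh

/-- The local ring of a curve is a localisation of the local ring of any of its points. -/
theorem locAt_curveVal (hF0 : MvPolynomial.eval ![c, d] F = 0) :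
    LocAt (ch.localRing c d) (ch.curveVal hch F hF) := by
  refine ⟨?_, ?_⟩
  · rintro f ⟨g, h, h1, h2, rfl⟩
    exact ⟨g, h, not_dvd_of_eval hF0 h1, h2, rfl⟩
  · rintro f ⟨g, h, hd, h0, rfl⟩
    exact ⟨ch.poly g, ⟨g, 1, by simp, by simp, by simp⟩, ch.poly h,
      ⟨h, 1, by simp, by simp, by simp⟩,
      curveVal_poly hch hF hd, rfl⟩

end Chart

theorem LocAt.val_one {O : Subring K} {R : ValuationSubring K} (h : LocAt O R) (hO : IsPoint O)
    {f : K} {v : ℂ} (hf : HasValue O f v) (hv : v ≠ 0) : R.valuation f = 1 :=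
  val_eq_one_of_mem (hO.ne_zero hf hv) (h.1 _ (hf.mem hO)) (h.1 _ ((hO.inv hf hv).mem hO))

/-- The localisations of the local ring of a point are localisations of the chart. -/
theorem LocAt.loc {ch : Chart} (hch : ch.Good) {c d : ℂ} {R : ValuationSubring K}
    (h : LocAt (ch.localRing c d) R) : Loc ch R := by
  have hp := hch.isPoint c d
  have hpoly (g) := hp.poly (hch.hasValue_x c d) (hch.hasValue_y c d) g
  refine ⟨fun g => h.1 _ ((hpoly g).mem hp), fun f hf => ?_⟩
  obtain ⟨_, ⟨g1, g2, h1, h1', rfl⟩, _, ⟨k1, k2, h2, h2', rfl⟩, hv, rfl⟩ := h.2 f hf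
  have e1 := h.val_one hp (hpoly g2) h1
  have e2 := h.val_one hp (hpoly k2) h2
  rw [map_div₀, e2, div_one] at hv
  exact ⟨g1 * k2, g2 * k1, by simp [e1, hv], by rw [poly_mul, poly_mul, div_div_div_eq]⟩

/-- The condition on the local ring of a prime divisor, expressed by the valuation. -/
theorem PrimeDivisor.exists_locAt {X : Set (Subring K)} (C : PrimeDivisor X) :
    ∃ O ∈ X, LocAt O C.ring := by
  obtain ⟨O, hO, h⟩ := C.isLocalization
  have hOR : ∀ f ∈ O, f ∈ C.ring := fun f hf =>
    (h f).2 ⟨f, hf, 1, O.one_mem, one_ne_zero, by simp, by simp⟩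
  refine ⟨O, hO, hOR, fun f hf => ?_⟩
  obtain ⟨a, ha, b, hb, h0, hi, rfl⟩ := (h f).1 hf
  exact ⟨a, ha, b, hb, val_eq_one_of_mem h0 (hOR b hb) hi, rfl⟩

/-- A discrete valuation ring that is a localisation of the local ring of a point of `X`, as a prime
divisor of `X`. -/
def LocAt.primeDivisor {X : Set (Subring K)} {R : ValuationSubring K}
    [hR : IsDiscreteValuationRing R]
    {O : Subring K} (hO : O ∈ X) (h : LocAt O R) : PrimeDivisor X where
  ring := R
  isDVR := hR
  isLocalization := by
    refine ⟨O, hO, fun f => ⟨fun hf => ?_, ?_⟩⟩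
    · obtain ⟨a, ha, b, hb, hv, rfl⟩ := h.2 f hf
      exact ⟨a, ha, b, hb, ne_zero_of_val hv, inv_mem_of_val hv, rfl⟩
    · rintro ⟨a, ha, b, hb, -, hi, rfl⟩
      rw [div_eq_mul_inv]
      exact R.mul_mem _ _ (h.1 a ha) hi

instance {X : Set (Subring K)} (C : PrimeDivisor X) : IsDiscreteValuationRing C.ring := C.isDVR

theorem classOf_eq {X : Set (Subring K)} (C : PrimeDivisor X) {s : Set K}
    (h : (C.ring : Set K) = s) :
    classOf X s = C.cls := by
  have hex : ∃ C : PrimeDivisor X, (C.ring : Set K) = s := ⟨C, h⟩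
  rw [classOf, dif_pos hex]
  have := hex.choose_spec
  congr 1
  ext f
  rw [← SetLike.mem_coe, this, ← h, SetLike.mem_coe]

theorem irreducible_X (i : Fin 2) : Irreducible (MvPolynomial.X i : MvPolynomial (Fin 2) ℂ) :=
  (MvPolynomial.X_prime).irreducible

/-- The exceptional curve of a blow-up, as a valuation ring. -/
def excVal (ch : Chart) (hch : ch.Good) (c d : ℂ) : ValuationSubring K :=
  (ch.blowUp₀ c d).curveVal (hch.blowUp₀ c d) (.X 1) (irreducible_X 1)

section exc
variable {ch ch' : Chart} (hch : ch.Good) (hch' : ch'.Good) {c d c' d' : ℂ}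

instance : IsDiscreteValuationRing (excVal ch hch c d) := isDVR_curveVal _ _

theorem locAt_excVal (e : ℂ) : LocAt ((ch.blowUp₀ c d).localRing e 0) (excVal ch hch c d) :=
  locAt_curveVal _ _ (by simp)

theorem excVal_x_lt : (excVal ch hch c d).valuation (ch.x - con c) < 1 := by
  have := curveVal_poly_self_lt (hch.blowUp₀ c d) (irreducible_X 1)
  rwa [poly_X1] at this

theorem excVal_y_lt : (excVal ch hch c d).valuation (ch.y - con d) < 1 := by
  have h0 := hch.x_sub_ne_zero c
  have h1 := mem_iff_val.1 (loc_curveVal (hch.blowUp₀ c d) (irreducible_X 1)).x_mem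
  have h2 : ch.y - con d = (ch.blowUp₀ c d).x * (ch.x - con c) := by
    simp only [Chart.blowUp₀]; field_simp
  rw [h2]
  exact val_mul_lt h1 (excVal_x_lt hch)

/-- A function vanishing at the centre vanishes along the exceptional curve. -/
theorem excVal_lt_one {f : K} (hf : HasValue (ch.localRing c d) f 0) :
    (excVal ch hch c d).valuation f < 1 := by
  obtain ⟨a, b, v, w, ha, hb, rfl⟩ := hch.exists_linear hf
  have mem {a v} (ha : HasValue (ch.localRing c d) a v) : (excVal ch hch c d).valuation a ≤ 1 :=
    mem_iff_val.1 ((locAt_excVal hch 0).1 _ ((hch.hasValue_of_mem_Exc ⟨0, Or.inl rfl⟩ ha).mem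
      ((hch.blowUp₀ c d).isPoint 0 0)))
  refine Valuation.map_add_lt _ ?_ ?_
  · exact val_mul_lt (mem ha) (excVal_x_lt hch)
  · exact val_mul_lt (mem hb) (excVal_y_lt hch)

/-- The two charts of a blow-up overlap in the point of the exceptional curve in direction `1`. -/
theorem blowUp_common_point {ch : Chart} (hch : ch.Good) {c d : ℂ} :
    (ch.blowUp₀ c d).localRing 1 0 = (ch.blowUp₁ c d).localRing 1 0 := by
  have h := hch.blowUp₀ c d
  have h' := hch.blowUp₁ c d
  have hx := hch.x_sub_ne_zero c
  have hy := hch.y_sub_ne_zero d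
  have hp := h.isPoint 1 0
  have hp' := h'.isPoint 1 0
  refine h.localRing_eq h' ?_ ?_ ?_ ?_
  · refine (hp.inv (h.hasValue_x 1 0) one_ne_zero).congr ?_ (by simp)
    simp [Chart.blowUp₀, Chart.blowUp₁]
  · refine (hp.mul (h.hasValue_x 1 0) (h.hasValue_y 1 0)).congr ?_ (by simp)
    simp only [Chart.blowUp₀, Chart.blowUp₁]; field_simp
  · refine (hp'.inv (h'.hasValue_x 1 0) one_ne_zero).congr ?_ (by simp)
    simp [Chart.blowUp₀, Chart.blowUp₁]
  · refine (hp'.mul (h'.hasValue_x 1 0) (h'.hasValue_y 1 0)).congr ?_ (by simp)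
    simp only [Chart.blowUp₀, Chart.blowUp₁]; field_simp

theorem excVal_swap : excVal ch.swap hch.swap d c = excVal ch hch c d := by
  refine (SetLike.coe_injective ?_).symm
  have h1 := locAt_excVal hch (c := c) (d := d) 1
  rw [blowUp_common_point hch] at h1
  exact (hch.swap.blowUp₀ d c).eq_curveRing (h1.loc (hch.swap.blowUp₀ d c)) (irreducible_X 1)
    (by rw [poly_X1]; exact excVal_y_lt hch)

/-- The exceptional curve depends only on the local ring of the centre. -/
theorem excVal_eq (h : ch.localRing c d = ch'.localRing c' d') :
    excVal ch hch c d = excVal ch' hch' c' d' := by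
  have h1 := locAt_excVal hch (c := c) (d := d) 1
  obtain ⟨e', he | he⟩ := hch.exc_point hch' h 1
  · rw [he] at h1
    refine SetLike.coe_injective ((hch'.blowUp₀ c' d').eq_curveRing
      (h1.loc (hch'.blowUp₀ c' d')) (irreducible_X 1) ?_)
    simpa using excVal_lt_one hch (h ▸ hch'.hasValue_x_sub c' d')
  · rw [he] at h1
    rw [← excVal_swap hch']
    refine SetLike.coe_injective ((hch'.swap.blowUp₀ d' c').eq_curveRing
      (h1.loc (hch'.swap.blowUp₀ d' c')) (irreducible_X 1) ?_)
    simpa using excVal_lt_one hch (h ▸ hch'.hasValue_y_sub c' d')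

/-- A prime divisor visible in the blow-up is either the exceptional curve or already visible
before the blow-up. -/
theorem Loc.eq_excVal_or {R : ValuationSubring K} [IsDiscreteValuationRing R]
    (hR : Loc (ch.blowUp₀ c d) R) : R = excVal ch hch c d ∨ Loc ch R := by
  rcases (mem_iff_val.1 hR.y_mem).lt_or_eq with h | h
  · left
    exact SetLike.coe_injective ((hch.blowUp₀ c d).eq_curveRing hR (irreducible_X 1)
      (by simpa using h))
  · exact Or.inr (hR.of_blowUp₀ h)

theorem LocAt.eq_excVal_or {O : Subring K} (hO : O ∈ Exc ch c d) {R : ValuationSubring K}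
    [IsDiscreteValuationRing R] (hR : LocAt O R) : R = excVal ch hch c d ∨ Loc ch R := by
  obtain ⟨e, rfl | rfl⟩ := hO
  · exact (hR.loc (hch.blowUp₀ c d)).eq_excVal_or hch
  · rw [← excVal_swap hch]
    exact ((hR.loc (hch.swap.blowUp₀ d c)).eq_excVal_or hch.swap).imp_right fun h => h.swap

end exc

/-! ### The four towers of infinitely near points -/

/-- The coordinate that is infinite at the base point of the `i`-th tower. Towers are numbered like
the symmetry roots: `0, 1, 2, 3` are the pairs `b₁b₂`, `b₅b₆`, `b₃b₄`, `b₇b₈`. -/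
def tx (i : Fin 4) : K := ![q, p, q, p] i

/-- The coordinate that is finite at the base point of the `i`-th tower. -/
def ty (i : Fin 4) : K := ![p, q, p, q] i

/-- The value of `ty i` at the base point of the `i`-th tower. -/
def ts (A : Params) (i : Fin 4) : ℂ := ![-A.t, 0, 0, 1] i

/-- The position on the first exceptional curve of the second point of the `i`-th tower. -/
def te (A : Params) (i : Fin 4) : ℂ := ![-A.a 0, A.a 1, -A.a 2, A.a 3] i

/-- The chart containing the base point of the `i`-th tower. -/
def tb (i : Fin 4) : Chart := ⟨(tx i)⁻¹, ty i⟩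

/-- The chart containing the second point of the `i`-th tower. -/
def tW (A : Params) (i : Fin 4) : Chart := (tb i).blowUp₀ 0 (ts A i)

/-- The base point of the `i`-th tower. -/
def basePt (A : Params) (i : Fin 4) : Subring K := (tb i).localRing 0 (ts A i)

/-- The second point of the `i`-th tower. -/
def nearPt (A : Params) (i : Fin 4) : Subring K := (tW A i).localRing (te A i) 0

/-- The points of the surface over the base point of the `i`-th tower. -/
def Tower (A : Params) (i : Fin 4) : Set (Subring K) :=
  (Exc (tb i) 0 (ts A i) \ {nearPt A i}) ∪ Exc (tW A i) (te A i) 0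

theorem good_txy (i : Fin 4) : Good ⟨tx i, ty i⟩ := by
  fin_cases i
  exacts [good_U₀₀, good_U₀₀.swap, good_U₀₀, good_U₀₀.swap]

theorem good_tb (i : Fin 4) : (tb i).Good := (good_txy i).inv
theorem good_tW (A : Params) (i : Fin 4) : (tW A i).Good := (good_tb i).blowUp₀ _ _

theorem good_U₁₀ : U₁₀.Good := good_tb 0
theorem good_U₀₁ : U₀₁.Good := (good_tb 1).swap
theorem good_U₁₁ : U₁₁.Good := good_U₀₁.inv

theorem tx_ne_zero (i : Fin 4) : tx i ≠ 0 := (good_txy i).x_ne_zero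

theorem isPoint_basePt (A : Params) (i : Fin 4) : IsPoint (basePt A i) := (good_tb i).isPoint _ _
theorem isPoint_nearPt (A : Params) (i : Fin 4) : IsPoint (nearPt A i) := (good_tW A i).isPoint _ _

theorem nearPt_mem_Exc (A : Params) (i : Fin 4) : nearPt A i ∈ Exc (tb i) 0 (ts A i) :=
  ⟨te A i, Or.inl rfl⟩

/-- The point with local ring `O` lies over the base point of the `i`-th tower. -/
def Over (A : Params) (i : Fin 4) (O : Subring K) : Prop :=
  IsPoint O ∧ HasValue O (tx i)⁻¹ 0 ∧ HasValue O (ty i) (ts A i)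

theorem over_basePt (A : Params) (i : Fin 4) : Over A i (basePt A i) :=
  ⟨isPoint_basePt A i, (good_tb i).hasValue_x _ _, (good_tb i).hasValue_y _ _⟩

theorem over_of_mem_Exc {A : Params} {i : Fin 4} {O : Subring K} (hO : O ∈ Exc (tb i) 0 (ts A i)) :
    Over A i O :=
  ⟨Exc.isPoint (good_tb i) hO, (good_tb i).hasValue_of_mem_Exc hO ((good_tb i).hasValue_x _ _),
    (good_tb i).hasValue_of_mem_Exc hO ((good_tb i).hasValue_y _ _)⟩

theorem over_nearPt (A : Params) (i : Fin 4) : Over A i (nearPt A i) :=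
  over_of_mem_Exc (nearPt_mem_Exc A i)

theorem over_of_mem_Tower {A : Params} {i : Fin 4} {O : Subring K} (hO : O ∈ Tower A i) :
    Over A i O := by
  rcases hO with hO | hO
  · exact over_of_mem_Exc hO.1
  · obtain ⟨-, h1, h2⟩ := over_nearPt A i
    exact ⟨Exc.isPoint (good_tW A i) hO, (good_tW A i).hasValue_of_mem_Exc hO h1,
      (good_tW A i).hasValue_of_mem_Exc hO h2⟩

/-- A function with a pole at a point is not regular there. -/
theorem not_hasValue_of_inv {O : Subring K} (hO : IsPoint O) {f : K} (h0 : f ≠ 0) {v : ℂ}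
    (h : HasValue O f⁻¹ 0) (h' : HasValue O f v) : False := by
  have h1 := hO.mul h h'
  rw [inv_mul_cancel₀ h0, zero_mul] at h1
  exact zero_ne_one (hO.unique h1 (by simpa using hO.con 1))

/-- Different towers lie over different points. Towers with the same axis are separated by
`ts A i`; for the towers `0` and `2` this uses `t ≠ 0`. -/
theorem Over.eq {A : Params} (ht : A.t ≠ 0) {i j : Fin 4} {O : Subring K} (hi : Over A i O)
    (hj : Over A j O) : i = j := by
  obtain ⟨hO, h1, h2⟩ := hi
  obtain ⟨-, h3, h4⟩ := hj
  by_contra hij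
  have q0 : q ≠ 0 := tx_ne_zero 0
  have p0 : p ≠ 0 := tx_ne_zero 1
  fin_cases i <;> fin_cases j <;> first
    | exact hij rfl
    | exact not_hasValue_of_inv hO q0 h1 h4
    | exact not_hasValue_of_inv hO p0 h1 h4
    | (have := hO.unique h2 h4; simp [ts, ht] at this)

/-- The direction function of the first blow-up of a tower. -/
def tu (A : Params) (i : Fin 4) : K := (ty i - con (ts A i)) * tx i

theorem tW_eq (A : Params) (i : Fin 4) : tW A i = ⟨tu A i, (tx i)⁻¹⟩ := by
  simp [tW, Chart.blowUp₀, tb, tu]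

/-- The direction function is regular at the second point of a tower, but not at the base point. -/
theorem nearPt_ne_basePt (A : Params) (i : Fin 4) : nearPt A i ≠ basePt A i := by
  intro h
  have h1 : tu A i ∈ basePt A i := by
    rw [← h]
    have := (good_tW A i).hasValue_x (te A i) 0
    have := this.mem (isPoint_nearPt A i)
    rwa [show (tW A i).x = tu A i by rw [tW_eq]] at this
  obtain ⟨g, k, hk, hk', e⟩ := h1
  have hx := tx_ne_zero i
  -- The coordinate `x` vanishing at the base point divides neither `y - s` nor the denominator `k`.
  have e' : (.X 1 - .C (ts A i)) * k = .X 0 * g := by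
    apply (good_tb i).poly_injective
    simp only [poly_mul, poly_sub, poly_X0, poly_X1, poly_C]
    rw [tu] at e
    have : (tb i).poly g = (tb i).poly k * ((ty i - con (ts A i)) * tx i) := by
      rw [e]; field_simp
    rw [this]
    simp only [tb]
    field_simp
  rcases (irreducible_X 0).prime.dvd_or_dvd (Dvd.intro _ e'.symm) with hd | hd
  · refine not_dvd_of_eval (c := 0) (d := ts A i + 1) ?_ ?_ hd <;> simp
  · exact not_dvd_of_eval (c := 0) (d := ts A i) (by simp) hk hd

theorem localRing_inv {x y : K} (h : Good ⟨x, y⟩) {c d : ℂ} (hc : c ≠ 0) :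
    (⟨x⁻¹, y⟩ : Chart).localRing c d = (⟨x, y⟩ : Chart).localRing c⁻¹ d := by
  have h' : Good ⟨x⁻¹, y⟩ := h.inv
  refine h'.localRing_eq h ?_ (h'.hasValue_y c d) ?_ (h.hasValue_y _ d)
  · have := (h'.isPoint c d).inv (h'.hasValue_x c d) hc
    simpa using this
  · have := (h.isPoint c⁻¹ d).inv (h.hasValue_x c⁻¹ d) (inv_ne_zero hc)
    simpa using this

/-- The points of `ℙ¹ × ℙ¹` are those of the affine plane, of the two affine lines at infinity, and
the corner. -/
theorem mem_P1P1 {O : Subring K} : O ∈ P1P1 ↔ (∃ c d, O = U₀₀.localRing c d) ∨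
    (∃ d, O = U₁₀.localRing 0 d) ∨ (∃ c, O = U₀₁.localRing c 0) ∨ O = U₁₁.localRing 0 0 := by
  have e10 {c d : ℂ} (hc : c ≠ 0) : U₁₀.localRing c d = U₀₀.localRing c⁻¹ d :=
    localRing_inv good_U₀₀ hc
  have e01 {c d : ℂ} (hd : d ≠ 0) : U₀₁.localRing c d = U₀₀.localRing c d⁻¹ := by
    rw [← good_U₀₁.localRing_swap, ← good_U₀₀.localRing_swap]
    exact localRing_inv good_U₀₀.swap hd
  have e11 {c d : ℂ} (hc : c ≠ 0) : U₁₁.localRing c d = U₀₁.localRing c⁻¹ d :=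
    localRing_inv good_U₀₁ hc
  have e11' {c d : ℂ} (hd : d ≠ 0) : U₁₁.localRing c d = U₁₀.localRing c d⁻¹ := by
    rw [← good_U₁₁.localRing_swap, ← good_U₁₀.localRing_swap]
    exact localRing_inv good_U₁₀.swap hd
  constructor
  · rintro ⟨c, d, h | h | h | h⟩
    · exact Or.inl ⟨c, d, h⟩
    · by_cases hc : c = 0
      · exact Or.inr (Or.inl ⟨d, hc ▸ h⟩)
      · exact Or.inl ⟨_, _, h.trans (e10 hc)⟩
    · by_cases hd : d = 0
      · exact Or.inr (Or.inr (Or.inl ⟨c, hd ▸ h⟩))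
      · exact Or.inl ⟨_, _, h.trans (e01 hd)⟩
    · by_cases hc : c = 0
      · subst hc
        by_cases hd : d = 0
        · exact Or.inr (Or.inr (Or.inr (hd ▸ h)))
        · exact Or.inr (Or.inl ⟨_, h.trans (e11' hd)⟩)
      · by_cases hd : d = 0
        · subst hd; exact Or.inr (Or.inr (Or.inl ⟨_, h.trans (e11 hc)⟩))
        · exact Or.inl ⟨_, _, (h.trans (e11 hc)).trans (e01 hd)⟩
  · rintro (⟨c, d, h⟩ | ⟨d, h⟩ | ⟨c, h⟩ | h)
    · exact ⟨c, d, Or.inl h⟩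
    · exact ⟨0, d, Or.inr (Or.inl h)⟩
    · exact ⟨c, 0, Or.inr (Or.inr (Or.inl h))⟩
    · exact ⟨0, 0, Or.inr (Or.inr (Or.inr h))⟩

theorem U₀₁_localRing (c d : ℂ) : U₀₁.localRing c d = (tb 1).localRing d c :=
  (good_tb 1).localRing_swap d c

/-- The only point of `ℙ¹ × ℙ¹` over a base point is the base point. -/
theorem Over.eq_basePt {A : Params} {i : Fin 4} {O : Subring K} (hO : Over A i O)
    (hP : O ∈ P1P1) : O = basePt A i := by
  obtain ⟨hpt, h1, h2⟩ := hO
  have q0 : q ≠ 0 := tx_ne_zero 0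
  have p0 : p ≠ 0 := tx_ne_zero 1
  have hi : (tx i = q ∧ ty i = p ∧ tb i = U₁₀) ∨ (tx i = p ∧ ty i = q ∧ tb i = tb 1) := by
    fin_cases i
    exacts [Or.inl ⟨rfl, rfl, rfl⟩, Or.inr ⟨rfl, rfl, rfl⟩, Or.inl ⟨rfl, rfl, rfl⟩,
      Or.inr ⟨rfl, rfl, rfl⟩]
  rw [basePt]
  rcases mem_P1P1.1 hP with ⟨c, d, rfl⟩ | ⟨d, rfl⟩ | ⟨c, rfl⟩ | rfl
  · exfalso
    rcases hi with ⟨ex, ey, eb⟩ | ⟨ex, ey, eb⟩ <;> rw [ex] at h1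
    · exact not_hasValue_of_inv hpt q0 h1 (good_U₀₀.hasValue_x c d)
    · exact not_hasValue_of_inv hpt p0 h1 (good_U₀₀.hasValue_y c d)
  · rcases hi with ⟨ex, ey, eb⟩ | ⟨ex, ey, eb⟩ <;> rw [ex] at h1 <;> rw [ey] at h2
    · rw [eb, hpt.unique (good_U₁₀.hasValue_y 0 d) h2]
    · exact (not_hasValue_of_inv hpt p0 h1 (good_U₁₀.hasValue_y 0 d)).elim
  · rcases hi with ⟨ex, ey, eb⟩ | ⟨ex, ey, eb⟩ <;> rw [ex] at h1 <;> rw [ey] at h2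
    · exact (not_hasValue_of_inv hpt q0 h1 (good_U₀₁.hasValue_x c 0)).elim
    · rw [eb, U₀₁_localRing, hpt.unique (good_U₀₁.hasValue_x c 0) h2]
  · exfalso
    rcases hi with ⟨ex, ey, eb⟩ | ⟨ex, ey, eb⟩ <;> rw [ey] at h2
    · exact not_hasValue_of_inv hpt p0 (good_U₁₁.hasValue_y 0 0) h2
    · exact not_hasValue_of_inv hpt q0 (good_U₁₁.hasValue_x 0 0) h2

theorem nearPt_notMem_P1P1 (A : Params) (i : Fin 4) : nearPt A i ∉ P1P1 := fun h =>
  nearPt_ne_basePt A i ((over_nearPt A i).eq_basePt h)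

/-- Blowing up the two centres of a tower replaces the base point by the tower. -/
theorem blowUp_tower (A : Params) (i : Fin 4) {X : Set (Subring K)} (h : nearPt A i ∉ X) :
    blowUp (blowUp X (tb i) 0 (ts A i)) (tW A i) (te A i) 0 = (X \ {basePt A i}) ∪ Tower A i := by
  rw [blowUp_eq, blowUp_eq, Tower]
  ext O
  simp only [Set.mem_union, Set.mem_sdiff, Set.mem_singleton_iff]
  change _ ↔ (O ∈ X ∧ ¬ O = (tb i).localRing 0 (ts A i)) ∨ _
  have : O = (tW A i).localRing (te A i) 0 → O ∉ X := by rintro rfl; exact h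
  change _ ↔ _ ∨ (_ ∧ ¬ O = (tW A i).localRing (te A i) 0) ∨ _
  tauto

theorem S_eq_blowUp (A : Params) : S A = blowUp (blowUp (blowUp (blowUp (blowUp (blowUp (blowUp
    (blowUp P1P1 (tb 0) 0 (ts A 0)) (tW A 0) (te A 0) 0)
      (tb 2) 0 (ts A 2)) (tW A 2) (te A 2) 0)
      (tb 1) 0 (ts A 1)) (tW A 1) (te A 1) 0)
      (tb 3) 0 (ts A 3)) (tW A 3) (te A 3) 0 := by
  have e01 (X : Set (Subring K)) (c : ℂ) : blowUp X U₀₁ c 0 = blowUp X (tb 1) 0 c := by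
    rw [blowUp_eq, blowUp_eq, U₀₁_localRing, ← Exc_swap]; rfl
  have h0 : tW A 0 = W₁ A := rfl
  have h1 : tW A 1 = W₅ := rfl
  have h2 : tW A 2 = W₃ := rfl
  have h3 : tW A 3 = W₇ := rfl
  have b0 : tb 0 = U₁₀ := rfl
  have b2 : tb 2 = U₁₀ := rfl
  have b3 : tb 3 = tb 1 := rfl
  have s0 : ts A 0 = -A.t := rfl
  have s1 : ts A 1 = 0 := rfl
  have s2 : ts A 2 = 0 := rfl
  have s3 : ts A 3 = 1 := rfl
  have t0 : te A 0 = -A.a 0 := rfl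
  have t1 : te A 1 = A.a 1 := rfl
  have t2 : te A 2 = -A.a 2 := rfl
  have t3 : te A 3 = A.a 3 := rfl
  rw [h0, h1, h2, h3, b0, b2, b3, s0, s1, s2, s3, t0, t1, t2, t3, S, e01, e01]

theorem S_eq {A : Params} (ht : A.t ≠ 0) : S A =
    (((((P1P1 \ {basePt A 0} ∪ Tower A 0) \ {basePt A 2}) ∪ Tower A 2) \
      {basePt A 1} ∪ Tower A 1) \ {basePt A 3}) ∪ Tower A 3 := by
  have hT {i j : Fin 4} (hij : j ≠ i) : nearPt A i ∉ Tower A j := fun h =>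
    hij ((over_of_mem_Tower h).eq ht (over_nearPt A i))
  have hP (i : Fin 4) := nearPt_notMem_P1P1 A i
  have hU {X Y T : Set (Subring K)} {O : Subring K} (h : O ∉ X) (h' : O ∉ T) :
      O ∉ X \ Y ∪ T := by
    rintro (h1 | h1)
    exacts [h h1.1, h' h1]
  rw [S_eq_blowUp, blowUp_tower A 0 (hP 0),
    blowUp_tower A 2 (hU (hP 2) (hT (by decide))),
    blowUp_tower A 1 (hU (hU (hP 1) (hT (by decide))) (hT (by decide))),
    blowUp_tower A 3 (hU (hU (hU (hP 3) (hT (by decide))) (hT (by decide))) (hT (by decide)))]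

/-- The blow-ups in the four towers do not interfere: the points of the surface are those of
`ℙ¹ × ℙ¹` other than the four base points, and the points of the four towers. -/
theorem mem_S {A : Params} (ht : A.t ≠ 0) {O : Subring K} :
    O ∈ S A ↔ (O ∈ P1P1 ∧ ∀ i, O ≠ basePt A i) ∨ ∃ i, O ∈ Tower A i := by
  have hb {i j : Fin 4} (hij : i ≠ j) (h : O ∈ Tower A i) : O ≠ basePt A j := by
    rintro rfl
    exact hij ((over_of_mem_Tower h).eq ht (over_basePt A j))
  rw [S_eq ht]
  constructor
  · rintro (⟨(⟨(⟨(⟨h, h0⟩ | h), h2⟩ | h), h1⟩ | h), h3⟩ | h)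
    · refine Or.inl ⟨h, fun i => ?_⟩
      fin_cases i
      exacts [h0, h1, h2, h3]
    · exact Or.inr ⟨0, h⟩
    · exact Or.inr ⟨2, h⟩
    · exact Or.inr ⟨1, h⟩
    · exact Or.inr ⟨3, h⟩
  · rintro (⟨h, hi⟩ | ⟨i, h⟩)
    · exact Or.inl ⟨Or.inl ⟨Or.inl ⟨Or.inl ⟨h, hi 0⟩, hi 2⟩, hi 1⟩, hi 3⟩
    · fin_cases i
      · exact Or.inl ⟨Or.inl ⟨Or.inl ⟨Or.inr h, hb (by decide) h⟩, hb (by decide) h⟩,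
          hb (by decide) h⟩
      · exact Or.inl ⟨Or.inr h, hb (by decide) h⟩
      · exact Or.inl ⟨Or.inl ⟨Or.inr h, hb (by decide) h⟩, hb (by decide) h⟩
      · exact Or.inr h

/-- Every point of the affine plane is a point of the surface. -/
theorem U₀₀_mem_S {A : Params} (ht : A.t ≠ 0) (c d : ℂ) : U₀₀.localRing c d ∈ S A := by
  refine (mem_S ht).2 (Or.inl ⟨mem_P1P1.2 (Or.inl ⟨c, d, rfl⟩), fun i h => ?_⟩)
  obtain ⟨hp, h1, -⟩ := over_basePt A i
  rw [← h] at h1 hp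
  fin_cases i
  · exact not_hasValue_of_inv hp (tx_ne_zero 0) h1 (good_U₀₀.hasValue_x c d)
  · exact not_hasValue_of_inv hp (tx_ne_zero 1) h1 (good_U₀₀.hasValue_y c d)
  · exact not_hasValue_of_inv hp (tx_ne_zero 0) h1 (good_U₀₀.hasValue_x c d)
  · exact not_hasValue_of_inv hp (tx_ne_zero 1) h1 (good_U₀₀.hasValue_y c d)

/-! ### Prime divisors of the surface -/

/-- The curves of the surface outside the affine plane: the fibres `q = ∞` and `p = ∞`, and the two
exceptional curves of each tower. -/
inductive Bdry
  | fib (k : Fin 2)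
  | fst (i : Fin 4)
  | snd (i : Fin 4)

/-- The fibre `q = ∞` for `k = 0` and `p = ∞` for `k = 1`. -/
def fibVal (k : Fin 2) : ValuationSubring K :=
  (tb (k.castLE (by decide))).curveVal (good_tb _) (.X 0) (irreducible_X 0)

/-- The valuation rings of the boundary curves. -/
def bdVal (A : Params) : Bdry → ValuationSubring K
  | .fib k => fibVal k
  | .fst i => excVal (tb i) (good_tb i) 0 (ts A i)
  | .snd i => excVal (tW A i) (good_tW A i) (te A i) 0

instance (A : Params) (b : Bdry) : IsDiscreteValuationRing (bdVal A b) := by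
  cases b
  · exact isDVR_curveVal (good_tb _) (irreducible_X 0)
  · exact isDVR_curveVal ((good_tb _).blowUp₀ _ _) (irreducible_X 1)
  · exact isDVR_curveVal ((good_tW A _).blowUp₀ _ _) (irreducible_X 1)

/-- The axis of a tower: `0` if its base point has `q = ∞`, `1` if it has `p = ∞`. -/
def axis (i : Fin 4) : Fin 2 := ![0, 1, 0, 1] i

theorem tb_axis (i : Fin 4) : tb ((axis i).castLE (by decide)) = tb i := by
  fin_cases i <;> rfl

theorem Loc.of_txy {i : Fin 4} {R : ValuationSubring K} (h : Loc ⟨tx i, ty i⟩ R) : Loc U₀₀ R := by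
  fin_cases i
  exacts [h, h.swap, h, h.swap]

theorem Loc.of_tb {i : Fin 4} {R : ValuationSubring K} [IsDiscreteValuationRing R]
    (h : Loc (tb i) R) : R = fibVal (axis i) ∨ Loc U₀₀ R := by
  rcases (mem_iff_val.1 h.x_mem).lt_or_eq with hx | hx
  · left
    refine SetLike.coe_injective ?_
    rw [(good_tb i).eq_curveRing h (irreducible_X 0) (by rwa [poly_X0]), ← tb_axis i]
    rfl
  · refine Or.inr (Loc.of_txy (i := i) (Loc.of_inv h ?_))
    have hx' : R.valuation (tx i)⁻¹ = 1 := hx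
    rwa [map_inv₀, inv_eq_one] at hx'

/-- A prime divisor of the surface is either visible in the affine plane or a boundary curve. -/
theorem loc_or_bdVal {A : Params} (ht : A.t ≠ 0) (C : PrimeDivisor (S A)) :
    Loc U₀₀ C.ring ∨ ∃ b, C.ring = bdVal A b := by
  have htb (i : Fin 4) (h : Loc (tb i) C.ring) : Loc U₀₀ C.ring ∨ ∃ b, C.ring = bdVal A b :=
    h.of_tb.symm.imp_right fun h => ⟨.fib (axis i), h⟩
  obtain ⟨O, hO, hC⟩ := C.exists_locAt
  rcases (mem_S ht).1 hO with ⟨hO, -⟩ | ⟨i, hO⟩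
  · rcases mem_P1P1.1 hO with ⟨c, d, rfl⟩ | ⟨d, rfl⟩ | ⟨c, rfl⟩ | rfl
    · exact Or.inl (hC.loc good_U₀₀)
    · exact htb 0 (hC.loc good_U₁₀)
    · exact htb 1 (hC.loc good_U₀₁).swap
    · have hL := hC.loc good_U₁₁
      rcases (mem_iff_val.1 hL.x_mem).lt_or_eq with hx | hx
      · rcases (mem_iff_val.1 hL.y_mem).lt_or_eq with hy | hy
        · exfalso
          have := (good_U₁₁.val_lt_one_iff_dvd hL (irreducible_X 0) (by rwa [poly_X0]) (.X 1)).1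
            (by rwa [poly_X1])
          rw [MvPolynomial.X_dvd_X] at this
          exact absurd this (by decide)
        · refine htb 0 ?_
          have h1 : Loc (tb 0).swap C.ring := by
            refine Loc.of_inv (ch := (tb 0).swap) hL.swap ?_
            have hy' : C.ring.valuation p⁻¹ = 1 := hy
            rwa [map_inv₀, inv_eq_one] at hy'
          exact h1.swap
      · refine htb 1 ?_
        have h1 : Loc (tb 1).swap C.ring := by
          refine Loc.of_inv (ch := (tb 1).swap) hL ?_
          have hx' : C.ring.valuation q⁻¹ = 1 := hx
          rwa [map_inv₀, inv_eq_one] at hx'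
        exact h1.swap
  · rcases hO with hO | hO
    · rcases hC.eq_excVal_or (good_tb i) hO.1 with h | h
      · exact Or.inr ⟨.fst i, h⟩
      · exact htb i h
    · rcases hC.eq_excVal_or (good_tW A i) hO with h | h
      · exact Or.inr ⟨.snd i, h⟩
      · rcases Loc.eq_excVal_or (good_tb i) h with h | h
        · exact Or.inr ⟨.fst i, h⟩
        · exact htb i h

theorem mem_Tower_fst {A : Params} {i : Fin 4} {e : ℂ} (he : e ≠ te A i) :
    (tW A i).localRing e 0 ∈ Tower A i := by
  refine Or.inl ⟨⟨e, Or.inl rfl⟩, fun h => he ?_⟩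
  have h' : (tW A i).localRing e 0 = nearPt A i := h
  have h1 := (good_tW A i).hasValue_x e 0
  rw [h'] at h1
  exact (isPoint_nearPt A i).unique h1 ((good_tW A i).hasValue_x _ _)

/-- A point of the fibre at infinity away from the base points of the towers, which are at
`p = -t, 0` on the fibre `q = ∞` and at `q = 0, 1` on the fibre `p = ∞`. -/
def fibPt (A : Params) (k : Fin 2) : Subring K :=
  (tb (k.castLE (by decide))).localRing 0 (![A.t, 2] k)

theorem fibPt_mem_S {A : Params} (ht : A.t ≠ 0) (k : Fin 2) : fibPt A k ∈ S A := by
  refine (mem_S ht).2 (Or.inl ⟨mem_P1P1.2 ?_, fun i h => ?_⟩)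
  · fin_cases k
    · exact Or.inr (Or.inl ⟨A.t, rfl⟩)
    · exact Or.inr (Or.inr (Or.inl ⟨2, (U₀₁_localRing 2 0).symm⟩))
  · obtain ⟨hp, h1, h2⟩ := over_basePt A i
    rw [← h] at h1 h2 hp
    have k1 := (good_tb (k.castLE (by decide))).hasValue_x 0 (![A.t, 2] k)
    have k2 := (good_tb (k.castLE (by decide))).hasValue_y 0 (![A.t, 2] k)
    fin_cases k <;> fin_cases i <;> first
    | exact not_hasValue_of_inv hp (tx_ne_zero 0) h1 k2
    | exact not_hasValue_of_inv hp (tx_ne_zero 1) h1 k2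
    | (have h3 := hp.unique h2 k2; simp [ts, ht, ht.symm, neg_eq_iff_add_eq_zero] at h3)

theorem locAt_bdVal {A : Params} (ht : A.t ≠ 0) (b : Bdry) : ∃ O ∈ S A, LocAt O (bdVal A b) := by
  cases b with
  | fib k => exact ⟨fibPt A k, fibPt_mem_S ht k,
      locAt_curveVal (good_tb _) (irreducible_X 0) (by simp)⟩
  | fst i =>
    exact ⟨_, (mem_S ht).2 (Or.inr ⟨i, mem_Tower_fst (e := te A i + 1) (by simp)⟩),
      locAt_excVal (good_tb i) _⟩
  | snd i =>
    exact ⟨_, (mem_S ht).2 (Or.inr ⟨i, Or.inr ⟨0, Or.inl rfl⟩⟩),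
      locAt_excVal (good_tW A i) _⟩

/-- The boundary curves as prime divisors of the surface. -/
def bd (A : Params) (ht : A.t ≠ 0) (b : Bdry) : PrimeDivisor (S A) :=
  (locAt_bdVal ht b).choose_spec.2.primeDivisor (locAt_bdVal ht b).choose_spec.1

@[simp] theorem bd_ring (A : Params) (ht : A.t ≠ 0) (b : Bdry) : (bd A ht b).ring = bdVal A b := rfl

/-- An irreducible curve of the affine plane as a prime divisor of the surface. -/
def planeCurve (A : Params) (ht : A.t ≠ 0) (F : MvPolynomial (Fin 2) ℂ) (hF : Irreducible F)
    {c d : ℂ} (hcd : MvPolynomial.eval ![c, d] F = 0) : PrimeDivisor (S A) :=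
  (locAt_curveVal good_U₀₀ hF hcd).primeDivisor (U₀₀_mem_S ht c d)

/-! ### Orders along the boundary curves -/

/-- The affine coordinates `q` and `p`. -/
def ax (k : Fin 2) : K := ![q, p] k

theorem tx_eq (i : Fin 4) : tx i = ax (axis i) := by fin_cases i <;> rfl

theorem ty_eq {i : Fin 4} {k : Fin 2} (h : axis i ≠ k) : ty i = ax k := by
  fin_cases i <;> fin_cases k <;> first | rfl | exact absurd rfl h

theorem LocAt.hasOrd_zero {O : Subring K} {R : ValuationSubring K} [IsDiscreteValuationRing R]
    (h : LocAt O R) (hO : IsPoint O) {f : K} {v : ℂ} (hf : HasValue O f v) (hv : v ≠ 0) :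
    HasOrd R f 0 := HasOrd.of_val (h.val_one hO hf hv)

section orders
variable (A : Params) (i : Fin 4)

theorem tW_x : (tW A i).x = tu A i := by rw [tW_eq]
theorem tW_y : (tW A i).y = (tx i)⁻¹ := by rw [tW_eq]

/-- A function tending to infinity has the same order as its translates. -/
theorem HasOrd.sub_con {O : Subring K} {R : ValuationSubring K} [IsDiscreteValuationRing R]
    (h : LocAt O R) (hO : IsPoint O) {f : K} {n : ℤ} (hf : HasOrd R f n) (hv : HasValue O f⁻¹ 0)
    (c : ℂ) : HasOrd R (f - con c) n := by
  have h1 : HasValue O (1 - con c * f⁻¹) 1 :=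
    (hO.sub (hO.con 1) (hO.mul (hO.con c) hv)).congr (by simp) (by simp)
  have := hf.mul (h.hasOrd_zero hO h1 one_ne_zero)
  have h0 := hf.ne_zero
  convert this using 1
  · field_simp
  · simp

/-- The first exceptional curve of a tower passes through all points with `V = 0`. -/
theorem fst_point (c : ℂ) : LocAt ((tW A i).localRing c 0) (bdVal A (.fst i)) :=
  locAt_excVal (good_tb i) c

theorem fst_tx : HasOrd (bdVal A (.fst i)) (tx i) (-1) := by
  have := (hasOrd_curveVal_self (good_tW A i) (irreducible_X 1)).inv
  rwa [poly_X1, tW_y, inv_inv] at this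

theorem fst_tu (c : ℂ) : HasOrd (bdVal A (.fst i)) (tu A i - con c) 0 := by
  have hp := (good_tW A i).isPoint (c + 1) 0
  have := hp.sub ((good_tW A i).hasValue_x (c + 1) 0) (hp.con c)
  rw [tW_x] at this
  exact (fst_point A i (c + 1)).hasOrd_zero hp this (by simp)

theorem fst_ty_sub : HasOrd (bdVal A (.fst i)) (ty i - con (ts A i)) 1 := by
  have := (fst_tu A i 0).mul (fst_tx A i).inv
  have h0 := tx_ne_zero i
  rwa [tu, con_zero, sub_zero, mul_assoc, mul_inv_cancel₀ h0, mul_one] at this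

theorem snd_point (c : ℂ) :
    LocAt (((tW A i).blowUp₀ (te A i) 0).localRing c 0) (bdVal A (.snd i)) :=
  locAt_excVal (good_tW A i) c

theorem snd_tu : HasOrd (bdVal A (.snd i)) (tu A i - con (te A i)) 1 := by
  have := hasOrd_curveVal_self ((good_tW A i).blowUp₀ (te A i) 0) (irreducible_X 1)
  rwa [poly_X1, show ((tW A i).blowUp₀ (te A i) 0).y = tu A i - con (te A i) by
    simp [Chart.blowUp₀, tW_x]] at this

theorem snd_tx : HasOrd (bdVal A (.snd i)) (tx i) (-1) := by
  have hb := (good_tW A i).blowUp₀ (te A i) 0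
  have h1 := (snd_point A i 1).hasOrd_zero (hb.isPoint 1 0) (hb.hasValue_x 1 0) one_ne_zero
  have h2 := (h1.mul (snd_tu A i)).inv
  have h3 := (snd_tu A i).ne_zero
  simp only [Chart.blowUp₀, tW_x, tW_y, con_zero, sub_zero] at h2
  rwa [div_mul_cancel₀ _ h3, inv_inv] at h2

theorem snd_tu_zero (c : ℂ) (hc : c ≠ te A i) : HasOrd (bdVal A (.snd i)) (tu A i - con c) 0 := by
  have hb := (good_tW A i).blowUp₀ (te A i) 0
  have hp := hb.isPoint 1 0
  have := hp.sub ((good_tW A i).blowUp₀_val_x (te A i) 0 1) (hp.con c)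
  rw [tW_x] at this
  exact (snd_point A i 1).hasOrd_zero hp this (sub_ne_zero.2 hc.symm)

/-- The multiplicity, in the total transform of the fibre through the base point of a tower, of the
second exceptional curve: it is `2` if the second point of the tower lies on that fibre. -/
def sndMult (A : Params) (i : Fin 4) : ℤ := if te A i = 0 then 2 else 1

theorem snd_ty_sub : HasOrd (bdVal A (.snd i)) (ty i - con (ts A i)) (sndMult A i) := by
  have h0 := tx_ne_zero i
  have e : ty i - con (ts A i) = (tu A i - con 0) * (tx i)⁻¹ := by
    rw [tu, con_zero, sub_zero]; field_simp
  rw [e, sndMult]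
  split_ifs with h
  · have := snd_tu A i
    rw [h] at this
    exact this.mul (snd_tx A i).inv
  · exact (snd_tu_zero A i 0 (Ne.symm h)).mul (snd_tx A i).inv

/-- The order of `q - c` (for `k = 0`) or `p - c` (for `k = 1`) along the boundary curves. -/
def ordLin (k : Fin 2) (c : ℂ) : Bdry → ℤ
  | .fib j => if j = k then -1 else 0
  | .fst i => if axis i = k then -1 else if c = ts A i then 1 else 0
  | .snd i => if axis i = k then -1 else if c = ts A i then sndMult A i else 0

/-- The values of `ordLin` are the orders of vanishing: a pole along the curves over infinity, a
zero along the curves over a base point on the fibre, and neither elsewhere. -/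
theorem hasOrd_ordLin (k : Fin 2) (c : ℂ) (b : Bdry) :
    HasOrd (bdVal A b) (ax k - con c) (ordLin A k c b) := by
  cases b with
  | fib j =>
    set i : Fin 4 := j.castLE (by decide)
    have hi : axis i = j := by fin_cases j <;> rfl
    have hp (d : ℂ) : LocAt ((tb i).localRing 0 d) (bdVal A (.fib j)) :=
      locAt_curveVal (good_tb i) (irreducible_X 0) (by simp)
    rw [ordLin]
    split_ifs with h
    · refine HasOrd.sub_con (hp 0) ((good_tb i).isPoint 0 0) ?_ ?_ c
      · have := (hasOrd_curveVal_self (good_tb i) (irreducible_X 0)).inv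
        rwa [poly_X0, show (tb i).x = (ax k)⁻¹ by rw [tb, tx_eq, hi, h], inv_inv] at this
      · have := (good_tb i).hasValue_x 0 0
        rwa [show (tb i).x = (ax k)⁻¹ by rw [tb, tx_eq, hi, h]] at this
    · have hpt := (good_tb i).isPoint 0 (c + 1)
      have := hpt.sub ((good_tb i).hasValue_y 0 (c + 1)) (hpt.con c)
      rw [show (tb i).y = ax k from ty_eq (i := i) (hi ▸ h)] at this
      exact (hp (c + 1)).hasOrd_zero hpt this (by simp)
  | fst i =>
    have hp := (good_tW A i).isPoint 0 0
    have hv := (good_tW A i).hasValue_y 0 0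
    rw [tW_y] at hv
    have hv2 := (good_tb i).blowUp₀_val_y 0 (ts A i) 0
    rw [ordLin]
    split_ifs with h h'
    · rw [← h, ← tx_eq]
      exact HasOrd.sub_con (fst_point A i 0) hp (fst_tx A i) hv c
    · rw [← ty_eq h, h']; exact fst_ty_sub A i
    · rw [← ty_eq h]
      exact (fst_point A i 0).hasOrd_zero hp (hp.sub hv2 (hp.con c)) (sub_ne_zero.2 (Ne.symm h'))
  | snd i =>
    have hb := (good_tW A i).blowUp₀ (te A i) 0
    have hp := hb.isPoint 0 0
    have hv := (good_tW A i).blowUp₀_val_y (te A i) 0 0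
    rw [tW_y] at hv
    have hv2 := (over_of_mem_Tower (A := A) (i := i) (Or.inr ⟨0, Or.inl rfl⟩)).2.2
    rw [ordLin]
    split_ifs with h h'
    · rw [← h, ← tx_eq]
      exact HasOrd.sub_con (snd_point A i 0) hp (snd_tx A i) hv c
    · rw [← ty_eq h, h']; exact snd_ty_sub A i
    · rw [← ty_eq h]
      exact (snd_point A i 0).hasOrd_zero hp (hp.sub hv2 (hp.con c)) (sub_ne_zero.2 (Ne.symm h'))

theorem ordLin_fst_pos {k : Fin 2} {c : ℂ} :
    0 < ordLin A k c (.fst i) ↔ axis i ≠ k ∧ c = ts A i := by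
  rw [ordLin]; split_ifs <;> simp [*]

theorem ordLin_snd_pos {k : Fin 2} {c : ℂ} :
    0 < ordLin A k c (.snd i) ↔ axis i ≠ k ∧ c = ts A i := by
  have : 0 < sndMult A i := by rw [sndMult]; split_ifs <;> decide
  rw [ordLin]; split_ifs <;> simp [*]

end orders

/-- A tower is determined by the fibre through its base point. -/
theorem tower_ext {A : Params} (ht : A.t ≠ 0) {i j : Fin 4}
    (h : ∀ k c, (axis i ≠ k ∧ c = ts A i) ↔ (axis j ≠ k ∧ c = ts A j)) : i = j := by
  have h1 := (h (1 - axis i) (ts A i)).1 ⟨by fin_cases i <;> decide, rfl⟩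
  fin_cases i <;> fin_cases j <;> simp_all [axis, ts]

/-- The boundary curves are distinct: the orders of the functions `q - c` and `p - c` determine the
type and the tower, up to the two exceptional curves of a tower, which the direction function
separates. -/
theorem bdVal_injective {A : Params} (ht : A.t ≠ 0) : Function.Injective (bdVal A) := by
  intro b b' h
  have key (k c) : ordLin A k c b = ordLin A k c b' :=
    (hasOrd_ordLin A k c b).unique (h ▸ hasOrd_ordLin A k c b')
  have fib_le (j : Fin 2) (k c) : ¬ 0 < ordLin A k c (.fib j) := by
    rw [ordLin]; split_ifs <;> simp
  have ht' (i : Fin 4) : axis i ≠ 1 - axis i := by fin_cases i <;> decide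
  have tu_ne (i : Fin 4) : bdVal A (.fst i) ≠ bdVal A (.snd i) := fun h =>
    zero_ne_one ((fst_tu A i (te A i)).unique (h ▸ snd_tu A i))
  cases b with
  | fib j =>
    cases b' with
    | fib j' =>
      have := key j 0
      simp only [ordLin, if_true] at this
      split_ifs at this with hj
      rw [hj]
    | fst i => exact absurd ((key _ _).symm ▸ (ordLin_fst_pos A i).2 ⟨ht' i, rfl⟩) (fib_le j _ _)
    | snd i => exact absurd ((key _ _).symm ▸ (ordLin_snd_pos A i).2 ⟨ht' i, rfl⟩) (fib_le j _ _)
  | fst i =>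
    cases b' with
    | fib j => exact absurd (key _ _ ▸ (ordLin_fst_pos A i).2 ⟨ht' i, rfl⟩) (fib_le j _ _)
    | fst j =>
      rw [tower_ext ht (i := i) (j := j) fun k c => by
        rw [← ordLin_fst_pos, ← ordLin_fst_pos, key]]
    | snd j =>
      have hij := tower_ext ht (i := i) (j := j) fun k c => by
        rw [← ordLin_fst_pos, ← ordLin_snd_pos, key]
      subst hij
      exact absurd h (tu_ne i)
  | snd i =>
    cases b' with
    | fib j => exact absurd (key _ _ ▸ (ordLin_snd_pos A i).2 ⟨ht' i, rfl⟩) (fib_le j _ _)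
    | fst j =>
      have hij := tower_ext ht (i := i) (j := j) fun k c => by
        rw [← ordLin_snd_pos A i, ← ordLin_fst_pos A j, key]
      subst hij
      exact absurd h.symm (tu_ne i)
    | snd j =>
      rw [tower_ext ht (i := i) (j := j) fun k c => by
        rw [← ordLin_snd_pos, ← ordLin_snd_pos, key]]

/-- No boundary curve meets the affine plane. -/
theorem not_loc_bdVal {A : Params} (b : Bdry) (h : Loc U₀₀ (bdVal A b)) : False := by
  have hk (k : Fin 2) : 0 ≤ ordLin A k 0 b := by
    rw [← (hasOrd_ordLin A k 0 b).le_one_iff, ← mem_iff_val, con_zero, sub_zero]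
    fin_cases k
    exacts [h.x_mem, h.y_mem]
  cases b with
  | fib j => simpa [ordLin] using hk j
  | fst i => simpa [ordLin] using hk (axis i)
  | snd i => simpa [ordLin] using hk (axis i)

/-! ### Divisors of functions and classes of curves -/

theorem irreducible_X_sub_C (k : Fin 2) (c : ℂ) :
    Irreducible (.X k - .C c : MvPolynomial (Fin 2) ℂ) := by
  let e : MvPolynomial (Fin 2) ℂ ≃ₐ[ℂ] MvPolynomial (Fin 2) ℂ := AlgEquiv.ofAlgHom
    (MvPolynomial.aeval fun i => .X i - .C c) (MvPolynomial.aeval fun i => .X i + .C c)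
    (by ext i; simp [MvPolynomial.algebraMap_eq]) (by ext i; simp [MvPolynomial.algebraMap_eq])
  have := (MulEquiv.irreducible_iff e).2 (irreducible_X k)
  simpa [e] using this

theorem U₀₀_poly_lin (k : Fin 2) (c : ℂ) : U₀₀.poly (.X k - .C c) = ax k - con c := by
  fin_cases k <;> simp [ax, U₀₀]

section
variable {A : Params} (ht : A.t ≠ 0)

theorem eq_planeCurve {C : PrimeDivisor (S A)} (hC : Loc U₀₀ C.ring)
    {F : MvPolynomial (Fin 2) ℂ} (hF : Irreducible F) {c d : ℂ}
    (hcd : MvPolynomial.eval ![c, d] F = 0) (hlt : C.ring.valuation (U₀₀.poly F) < 1) :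
    C = planeCurve A ht F hF hcd :=
  PrimeDivisor.ext (SetLike.coe_injective (good_U₀₀.eq_curveRing hC hF hlt))

variable (A) in
/-- The strict transform of the fibre `q = c` (for `k = 0`) or `p = c` (for `k = 1`). -/
def line (k : Fin 2) (c : ℂ) : PrimeDivisor (S A) :=
  planeCurve A ht (.X k - .C c) (irreducible_X_sub_C k c) (c := c) (d := c)
    (by fin_cases k <;> simp)

theorem line_loc (k : Fin 2) (c : ℂ) : Loc U₀₀ (line A ht k c).ring :=
  loc_curveVal good_U₀₀ (irreducible_X_sub_C k c)

theorem line_ne_bd (k : Fin 2) (c : ℂ) (b : Bdry) : line A ht k c ≠ bd A ht b := fun h =>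
  not_loc_bdVal (A := A) b (by rw [← bd_ring A ht, ← h]; exact line_loc ht k c)

theorem bd_injective : Function.Injective (bd A ht) := fun _ _ h =>
  bdVal_injective ht (congrArg PrimeDivisor.ring h)

theorem loc_or_bd (C : PrimeDivisor (S A)) : Loc U₀₀ C.ring ∨ ∃ b, C = bd A ht b :=
  (loc_or_bdVal ht C).imp_right fun ⟨b, hb⟩ => ⟨b, PrimeDivisor.ext hb⟩

variable (A) in
/-- The divisor supported on the boundary with given multiplicities. -/
def bdDiv (n : Bdry → ℤ) : Divisor (S A) :=
  ∑ j, Finsupp.single (bd A ht (.fib j)) (n (.fib j)) +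
    ∑ i, Finsupp.single (bd A ht (.fst i)) (n (.fst i)) +
    ∑ i, Finsupp.single (bd A ht (.snd i)) (n (.snd i))

theorem bdDiv_bd (n : Bdry → ℤ) (b : Bdry) : bdDiv A ht n (bd A ht b) = n b := by
  classical
  cases b <;> simp [bdDiv, Finsupp.single_apply, (bd_injective ht).eq_iff, -Fin.sum_univ_two]

theorem bdDiv_of_loc (n : Bdry → ℤ) {C : PrimeDivisor (S A)} (hC : Loc U₀₀ C.ring) :
    bdDiv A ht n C = 0 := by
  classical
  have h (b : Bdry) : bd A ht b ≠ C := by rintro rfl; exact not_loc_bdVal b hC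
  simp [bdDiv, h]

theorem cls_add {X : Set (Subring K)} (D D' : Divisor X) : cls (D + D') = cls D + cls D' := rfl

theorem cls_single {X : Set (Subring K)} (C : PrimeDivisor X) (n : ℤ) :
    cls (Finsupp.single C n) = n • C.cls := by
  rw [PrimeDivisor.cls, ← mul_one n, ← smul_eq_mul, ← Finsupp.smul_single]
  simp only [smul_eq_mul, mul_one]
  exact (QuotientAddGroup.mk' (principal X)).map_zsmul _ _

theorem cls_bdDiv (n : Bdry → ℤ) : cls (bdDiv A ht n) =
    ∑ j, n (.fib j) • (bd A ht (.fib j)).cls + ∑ i, n (.fst i) • (bd A ht (.fst i)).cls +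
      ∑ i, n (.snd i) • (bd A ht (.snd i)).cls := by
  have h {ι : Type} [Fintype ι] (f : ι → Divisor (S A)) : cls (∑ i, f i) = ∑ i, cls (f i) :=
    map_sum (QuotientAddGroup.mk' (principal (S A))) f Finset.univ
  simp only [bdDiv, cls_add, h, cls_single]

/-- The linear equivalence given by the divisor of `q - c` or `p - c`. -/
theorem cls_line_add (k : Fin 2) (c : ℂ) :
    (line A ht k c).cls + cls (bdDiv A ht (ordLin A k c)) = 0 := by
  rw [PrimeDivisor.cls, ← cls_add]
  refine (QuotientAddGroup.eq_zero_iff _).2 ⟨ax k - con c, ?_, fun C => ?_⟩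
  · rw [← U₀₀_poly_lin]
    exact good_U₀₀.poly_ne_zero (irreducible_X_sub_C k c).ne_zero
  · classical
    rw [Finsupp.add_apply, Finsupp.single_apply]
    rcases loc_or_bd ht C with hC | ⟨b, rfl⟩
    · rw [bdDiv_of_loc ht _ hC, add_zero]
      split_ifs with h
      · subst h
        have := hasOrd_curveVal_self good_U₀₀ (irreducible_X_sub_C k c)
        rwa [U₀₀_poly_lin] at this
      · refine HasOrd.of_val (le_antisymm ?_ (not_lt.1 fun hlt => h ?_))
        · rw [← U₀₀_poly_lin]; exact mem_iff_val.1 (hC.1 _)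
        · rw [← U₀₀_poly_lin] at hlt
          exact (eq_planeCurve ht hC _ _ hlt).symm
    · rw [if_neg (line_ne_bd ht k c b), zero_add, bdDiv_bd]
      exact hasOrd_ordLin A k c b

end

section classes
variable {A : Params}

theorem ι_add (F G : PicLattice) : ι A (F + G) = ι A F + ι A G := by
  simp only [ι, Pi.add_apply, add_zsmul, Finset.sum_add_distrib]

theorem ι_sub (F G : PicLattice) : ι A (F - G) = ι A F - ι A G := by
  simp [ι, sub_smul, Finset.sum_sub_distrib]

theorem ι_single (j : Fin 10) : ι A (Pi.single j 1) = geometricBasis A j := by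
  simp [ι, Pi.single_apply]

/-- The class of the total transform of the first exceptional curve of a tower. -/
def E₁ (i : Fin 4) : PicLattice := ![E 1, E 5, E 3, E 7] i

/-- The class of the second exceptional curve of a tower. -/
def E₂ (i : Fin 4) : PicLattice := ![E 2, E 6, E 4, E 8] i

/-- The classes of the boundary curves. -/
def bdClass : Bdry → PicLattice
  | .fib k => ![Hq - E 1 - E 3, Hp - E 5 - E 7] k
  | .fst i => E₁ i - E₂ i
  | .snd i => E₂ i

variable (ht : A.t ≠ 0)

theorem exc_fst (i : Fin 4) : curveClass A ((tb i).blowUp₀ 0 (ts A i)) (.X 1) =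
    (bd A ht (.fst i)).cls := classOf_eq _ rfl

theorem exc_snd (i : Fin 4) : curveClass A ((tW A i).blowUp₀ (te A i) 0) (.X 1) =
    (bd A ht (.snd i)).cls := classOf_eq _ rfl

theorem exc_swap {ch : Chart} (hch : ch.Good) (c d : ℂ) :
    curveClass A (ch.swap.blowUp₀ d c) (.X 1) = curveClass A (ch.blowUp₀ c d) (.X 1) := by
  have h := excVal_swap hch (c := c) (d := d)
  rw [curveClass, curveClass]
  exact congrArg (fun R : ValuationSubring K => classOf (S A) (R : Set K)) h

theorem line_class (k : Fin 2) (c : ℂ) : curveClass A U₀₀ (.X k - .C c) = (line A ht k c).cls :=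
  classOf_eq _ rfl

theorem geometricBasis_eq : geometricBasis A = ![(line A ht 0 2).cls, (line A ht 1 A.t).cls,
    (bd A ht (.fst 0)).cls + (bd A ht (.snd 0)).cls, (bd A ht (.snd 0)).cls,
    (bd A ht (.fst 2)).cls + (bd A ht (.snd 2)).cls, (bd A ht (.snd 2)).cls,
    (bd A ht (.fst 1)).cls + (bd A ht (.snd 1)).cls, (bd A ht (.snd 1)).cls,
    (bd A ht (.fst 3)).cls + (bd A ht (.snd 3)).cls, (bd A ht (.snd 3)).cls] := by
  have f0 : excClass A U₁₀ 0 (-A.t) = _ := exc_fst ht 0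
  have f2 : excClass A U₁₀ 0 0 = _ := exc_fst ht 2
  have f1 : excClass A U₀₁ 0 0 = _ := (exc_swap (good_tb 1) 0 0).trans (exc_fst ht 1)
  have f3 : excClass A U₀₁ 1 0 = _ := (exc_swap (good_tb 3) 0 1).trans (exc_fst ht 3)
  have s0 : excClass A (W₁ A) (-A.a 0) 0 = _ := exc_snd ht 0
  have s2 : excClass A W₃ (-A.a 2) 0 = _ := exc_snd ht 2
  have s1 : excClass A W₅ (A.a 1) 0 = _ := exc_snd ht 1
  have s3 : excClass A W₇ (A.a 3) 0 = _ := exc_snd ht 3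
  rw [geometricBasis, f0, f1, f2, f3, s0, s1, s2, s3, line_class ht, line_class ht]

theorem ι_E₂ (i : Fin 4) : ι A (E₂ i) = (bd A ht (.snd i)).cls := by
  fin_cases i <;> exact (ι_single _).trans (by rw [geometricBasis_eq ht]; rfl)

theorem ι_E₁ (i : Fin 4) : ι A (E₁ i) = (bd A ht (.fst i)).cls + (bd A ht (.snd i)).cls := by
  fin_cases i <;> exact (ι_single _).trans (by rw [geometricBasis_eq ht]; rfl)

theorem ι_Hq : ι A Hq = (line A ht 0 2).cls :=
  (ι_single _).trans (by rw [geometricBasis_eq ht]; rfl)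

theorem ι_Hp : ι A Hp = (line A ht 1 A.t).cls :=
  (ι_single _).trans (by rw [geometricBasis_eq ht]; rfl)

/-- The total transform of the fibre `q = ∞`, which is equivalent to the fibre `q = 2`. -/
theorem ι_Hq' : ι A Hq = (bd A ht (.fib 0)).cls + (bd A ht (.fst 0)).cls + (bd A ht (.snd 0)).cls +
    (bd A ht (.fst 2)).cls + (bd A ht (.snd 2)).cls := by
  have h := cls_line_add ht 0 2
  rw [cls_bdDiv] at h
  simp [ordLin, Fin.sum_univ_succ, axis, ts] at h
  rw [ι_Hq ht, ← sub_eq_zero, ← h]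
  abel

/-- The total transform of the fibre `p = ∞`, which is equivalent to the fibre `p = t`. -/
theorem ι_Hp' : ι A Hp = (bd A ht (.fib 1)).cls + (bd A ht (.fst 1)).cls + (bd A ht (.snd 1)).cls +
    (bd A ht (.fst 3)).cls + (bd A ht (.snd 3)).cls := by
  have h := cls_line_add ht 1 A.t
  rw [cls_bdDiv] at h
  simp [ordLin, Fin.sum_univ_succ, axis, ts, ht, eq_neg_iff_add_eq_zero] at h
  rw [ι_Hp ht, ← sub_eq_zero, ← h]
  abel

/-- The boundary curves have the classes given by the abstract lattice. -/
theorem cls_bd (b : Bdry) : (bd A ht b).cls = ι A (bdClass b) := by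
  cases b with
  | fib k =>
    have h (i : Fin 4) := ι_E₁ ht i
    have h1 : ι A (E 1) = _ := h 0
    have h3 : ι A (E 3) = _ := h 2
    have h5 : ι A (E 5) = _ := h 1
    have h7 : ι A (E 7) = _ := h 3
    fin_cases k
    · change _ = ι A (Hq - E 1 - E 3)
      rw [ι_sub, ι_sub, ι_Hq' ht, h1, h3]
      change (bd A ht (.fib 0)).cls = _
      abel
    · change _ = ι A (Hp - E 5 - E 7)
      rw [ι_sub, ι_sub, ι_Hp' ht, h5, h7]
      change (bd A ht (.fib 1)).cls = _
      abel
  | fst i => rw [bdClass, ι_sub, ι_E₁ ht, ι_E₂ ht]; abel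
  | snd i => rw [bdClass, ι_E₂ ht]

/-- The line through the base point of a tower. -/
abbrev towerLine (A : Params) (ht : A.t ≠ 0) (i : Fin 4) : PrimeDivisor (S A) :=
  line A ht (1 - axis i) (ts A i)

theorem α_eq (i : Fin 4) : α i = ![Hp, Hq, Hp, Hq] i - E₁ i - E₂ i := by fin_cases i <;> rfl

/-- The line through the base point of a tower passes through its second point exactly if
`te A i = 0`, and its class is the symmetry root only in that case. -/
theorem cls_towerLine (i : Fin 4) :
    (towerLine A ht i).cls = ι A (if te A i = 0 then α i else α i + E₂ i) := by
  have key : (towerLine A ht i).cls + ((bd A ht (.fst i)).cls +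
      sndMult A i • (bd A ht (.snd i)).cls) = ι A (![Hp, Hq, Hp, Hq] i) := by
    have h := cls_line_add ht (1 - axis i) (ts A i)
    rw [cls_bdDiv] at h
    fin_cases i
    · simp [ordLin, Fin.sum_univ_succ, axis, ts, ht] at h
      change (line A ht 1 (-A.t)).cls + ((bd A ht (.fst 0)).cls +
        sndMult A 0 • (bd A ht (.snd 0)).cls) = ι A Hp
      rw [ι_Hp' ht, ← sub_eq_zero, ← h]; abel
    · simp [ordLin, Fin.sum_univ_succ, axis, ts] at h
      change (line A ht 0 0).cls + ((bd A ht (.fst 1)).cls +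
        sndMult A 1 • (bd A ht (.snd 1)).cls) = ι A Hq
      rw [ι_Hq' ht, ← sub_eq_zero, ← h]; abel
    · simp [ordLin, Fin.sum_univ_succ, axis, ts, ht] at h
      change (line A ht 1 0).cls + ((bd A ht (.fst 2)).cls +
        sndMult A 2 • (bd A ht (.snd 2)).cls) = ι A Hp
      rw [ι_Hp' ht, ← sub_eq_zero, ← h]; abel
    · simp [ordLin, Fin.sum_univ_succ, axis, ts] at h
      change (line A ht 0 1).cls + ((bd A ht (.fst 3)).cls +
        sndMult A 3 • (bd A ht (.snd 3)).cls) = ι A Hq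
      rw [ι_Hq' ht, ← sub_eq_zero, ← h]; abel
  rw [← sub_eq_zero, ← sub_eq_zero.2 key, sndMult]
  split_ifs <;> simp only [ι_add, α_eq, ι_sub, ι_E₁ ht, ι_E₂ ht] <;> abel

end classes

/-! ### Two-forms -/

/-- The differential of `f` is `a dq + b dp`. -/
def HasD (f a b : K) : Prop :=
  KaehlerDifferential.D ℂ K f =
    a • KaehlerDifferential.D ℂ K q + b • KaehlerDifferential.D ℂ K p

namespace HasD
variable {f g a b a' b' : K}

theorem q : HasD q 1 0 := by simp [HasD]
theorem p : HasD p 0 1 := by simp [HasD]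
theorem con (c : ℂ) : HasD (con c) 0 0 := by simp [HasD, D5Surface.con]
theorem add (hf : HasD f a b) (hg : HasD g a' b') : HasD (f + g) (a + a') (b + b') := by
  rw [HasD] at *; rw [map_add, hf, hg]; simp only [add_smul]; abel
theorem neg (hf : HasD f a b) : HasD (-f) (-a) (-b) := by
  rw [HasD] at *; rw [map_neg, hf]; simp only [neg_smul, neg_add]
theorem sub (hf : HasD f a b) (hg : HasD g a' b') : HasD (f - g) (a - a') (b - b') := by
  rw [HasD] at *; rw [map_sub, hf, hg]; simp only [sub_smul]; abel
theorem mul (hf : HasD f a b) (hg : HasD g a' b') :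
    HasD (f * g) (f * a' + g * a) (f * b' + g * b) := by
  rw [HasD] at *; rw [Derivation.leibniz, hf, hg]; simp only [add_smul, mul_smul, smul_add]; abel
theorem inv (hf : HasD f a b) : HasD f⁻¹ (-(f⁻¹ ^ 2) * a) (-(f⁻¹ ^ 2) * b) := by
  rw [HasD] at *; rw [Derivation.leibniz_inv, hf]; simp only [neg_smul, mul_smul, smul_add, neg_mul]
theorem div (hf : HasD f a b) (hg : HasD g a' b') :
    HasD (f / g) (f * (-(g⁻¹ ^ 2) * a') + g⁻¹ * a) (f * (-(g⁻¹ ^ 2) * b') + g⁻¹ * b) := by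
  rw [div_eq_mul_inv]; exact hf.mul hg.inv

end HasD

/-- The Jacobian determinant expresses `df ∧ dg` by `dq ∧ dp`. -/
theorem HasD.dwedge {f g a b a' b' : K} (hf : HasD f a b) (hg : HasD g a' b') :
    dwedge f g = (a * b' - b * a') • ω := by
  apply Subtype.ext
  rw [HasD] at *
  simp only [D5Surface.dwedge, ω, hf, hg, exteriorPower.ιMulti_apply_coe,
    ExteriorAlgebra.ιMulti_apply, Submodule.coe_smul]
  set m := KaehlerDifferential.D ℂ K D5Surface.q
  set n := KaehlerDifferential.D ℂ K D5Surface.p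
  have h : ExteriorAlgebra.ι K n * ExteriorAlgebra.ι K m =
      -(ExteriorAlgebra.ι K m * ExteriorAlgebra.ι K n) :=
    eq_neg_of_add_eq_zero_left (ExteriorAlgebra.ι_add_mul_swap n m)
  simp [mul_add, add_mul, h, smul_smul, sub_smul]
  rw [mul_comm b' a, mul_comm a' b]
  abel

/-! ### The period map on the symmetry roots -/

theorem hasD_tx (i : Fin 4) : ∃ a b a' b', HasD (tx i) a b ∧ HasD (ty i) a' b' ∧
    a * b' - b * a' = ![1, -1, 1, -1] i := by
  fin_cases i
  · exact ⟨1, 0, 0, 1, HasD.q, HasD.p, by simp⟩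
  · exact ⟨0, 1, 1, 0, HasD.p, HasD.q, by simp⟩
  · exact ⟨1, 0, 0, 1, HasD.q, HasD.p, by simp⟩
  · exact ⟨0, 1, 1, 0, HasD.p, HasD.q, by simp⟩

section
variable (A : Params) (i : Fin 4)

/-- The orientation of the coordinates of a tower: `d tx ∧ d ty = ± dq ∧ dp`. -/
def sgn (i : Fin 4) : ℂ := ![1, -1, 1, -1] i

theorem sgn_te : -(sgn i * te A i) = A.a i := by
  fin_cases i <;> simp [sgn, te]

/-- With `V = 1 / tx i`, the local equation of the first exceptional curve, `ω` is `± du ∧ dV / V`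
for the direction function `u`. -/
theorem ω_eq : ω = ((tx i)⁻¹)⁻¹ • dwedge (con (sgn i) * tu A i) (tx i)⁻¹ := by
  obtain ⟨a, b, a', b', hx, hy, h⟩ := hasD_tx i
  have h0 := tx_ne_zero i
  have hs : con (sgn i) = a * b' - b * a' := by rw [h]; fin_cases i <;> simp [sgn, con_neg]
  have hs2 : con (sgn i) * con (sgn i) = 1 := by
    rw [← con_mul]; fin_cases i <;> simp [sgn]
  have := ((HasD.con (sgn i)).mul ((hy.sub (HasD.con (ts A i))).mul hx)).dwedge hx.inv
  rw [tu, this, smul_smul]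
  have e : ((tx i)⁻¹)⁻¹ * ((con (sgn i) * ((ty i - con (ts A i)) * a + tx i * (a' - 0)) +
      (ty i - con (ts A i)) * tx i * 0) * (-(tx i)⁻¹ ^ 2 * b) -
      (con (sgn i) * ((ty i - con (ts A i)) * b + tx i * (b' - 0)) +
        (ty i - con (ts A i)) * tx i * 0) * (-(tx i)⁻¹ ^ 2 * a)) =
      con (sgn i) * (a * b' - b * a') := by
    field_simp; ring
  rw [e, ← hs, hs2, one_smul]

/-- The residue of `ω` along the first exceptional curve is `± du` for the direction function `u`.
-/
theorem hasResidue_fst : HasResidue (bdVal A (.fst i)) (con (sgn i) * tu A i) := by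
  have hL : Loc (tW A i) (bdVal A (.fst i)) := loc_curveVal (good_tW A i) (irreducible_X 1)
  refine ⟨(bdVal A (.fst i)).mul_mem _ _ (hL.con_mem _) (by simpa [tW_x] using hL.x_mem), ?_⟩
  have hy : (tW A i).poly (.X 1) = (tx i)⁻¹ := by rw [poly_X1, tW_y]
  have hirr := irreducible_poly (good_tW A i) (irreducible_X 1)
  simp only [hy] at hirr
  refine ⟨_, hirr, ?_⟩
  change ω - ((tx i)⁻¹)⁻¹ • dwedge (con (sgn i) * tu A i) (tx i)⁻¹ ∈ _
  rw [← ω_eq A i, sub_self]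
  exact AddSubgroup.zero_mem _

variable {A} (ht : A.t ≠ 0)

/-- In the chart `(U, V)` of the first blow-up, the line through the base point is `U = 0`. -/
theorem towerLine_ring : (towerLine A ht i).ring =
    (tW A i).curveVal (good_tW A i) (.X 0) (irreducible_X 0) := by
  set R := (tW A i).curveVal (good_tW A i) (.X 0) (irreducible_X 0)
  have hL : Loc (tW A i) R := loc_curveVal _ _
  have hX1 : ¬ (.X 0 : MvPolynomial (Fin 2) ℂ) ∣ .X 1 := by
    rw [MvPolynomial.X_dvd_X]; decide
  have hy : R.valuation (tx i)⁻¹ = 1 := by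
    have := curveVal_poly (good_tW A i) (irreducible_X 0) hX1
    rwa [poly_X1, tW_y] at this
  have hx : R.valuation (tu A i) < 1 := by
    have := curveVal_poly_self_lt (good_tW A i) (irreducible_X 0)
    rwa [poly_X0, tW_x] at this
  have hL2 : Loc U₀₀ R := by
    refine Loc.of_txy (i := i) (Loc.of_inv (hL.of_blowUp₀ (ch := tb i) ?_) ?_)
    · simpa [tb] using hy
    · simpa [inv_eq_one] using hy
  have hlt : R.valuation (ty i - con (ts A i)) < 1 := by
    have e : ty i - con (ts A i) = (tx i)⁻¹ * tu A i := by
      have := tx_ne_zero i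
      rw [tu]; field_simp
    rw [e]; exact val_mul_lt hy.le hx
  refine (SetLike.coe_injective (good_U₀₀.eq_curveRing hL2
    (irreducible_X_sub_C (1 - axis i) (ts A i)) ?_)).symm
  rw [U₀₀_poly_lin, ← ty_eq (i := i) (by fin_cases i <;> decide)]
  exact hlt

/-- In the first chart of the second blow-up, the first exceptional curve is `x = 0`, since its
equation `V` is the product of both coordinates. -/
theorem fst_ring : bdVal A (.fst i) = ((tW A i).blowUp₀ (te A i) 0).curveVal
    ((good_tW A i).blowUp₀ _ _) (.X 0) (irreducible_X 0) := by
  have hb := (good_tW A i).blowUp₀ (te A i) 0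
  set R := ((tW A i).blowUp₀ (te A i) 0).curveVal hb (.X 0) (irreducible_X 0)
  have hL : Loc ((tW A i).blowUp₀ (te A i) 0) R := loc_curveVal _ _
  have hX1 : ¬ (.X 0 : MvPolynomial (Fin 2) ℂ) ∣ .X 1 := by
    rw [MvPolynomial.X_dvd_X]; decide
  have hy := curveVal_poly hb (irreducible_X 0) hX1
  have hx := curveVal_poly_self_lt hb (irreducible_X 0)
  rw [poly_X1] at hy
  rw [poly_X0] at hx
  have hL2 : Loc (tW A i) R := hL.of_blowUp₀ hy
  refine (SetLike.coe_injective ((good_tW A i).eq_curveRing hL2 (irreducible_X 1) ?_)).symm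
  have e : (tW A i).poly (.X 1) =
      ((tW A i).blowUp₀ (te A i) 0).y * ((tW A i).blowUp₀ (te A i) 0).x := by
    have := (good_tW A i).x_sub_ne_zero (te A i)
    simp only [poly_X1, Chart.blowUp₀]; field_simp; simp
  rw [e]; exact val_mul_lt hy.le hx

/-- The component of the anticanonical divisor that is the first exceptional curve of a tower. -/
def fstComp (i : Fin 4) : Fin 6 := ![0, 4, 1, 5] i

theorem inQperp_α (i : Fin 4) (j : Fin 6) : inter (α i) (δcomp j) = 0 := by
  revert i j; decide

theorem lattice_facts (i : Fin 4) : inter (α i) (α i) = -2 ∧ inter (α i + E₂ i) (α i + E₂ i) = -1 ∧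
    inter (α i + E₂ i) antiK = 1 ∧ inter (E₂ i) (E₂ i) = -1 ∧ inter (E₂ i) antiK = 1 ∧
    bdClass (.fst i) = δcomp (fstComp i) := by
  revert i; decide

theorem inter_δcomp (i : Fin 4) (j : Fin 6) :
    inter (α i + E₂ i) (δcomp j) = (if j = fstComp i then 1 else 0) ∧
      inter (E₂ i) (δcomp j) = if j = fstComp i then 1 else 0 := by
  revert i j; decide

/-- If `a i ≠ 0` then `α i` is the difference of the exceptional curves `L`, the line through the
base point, and `G`, the second exceptional curve of the tower. Both meet the first exceptional
curve, at the points where the direction function is `0` and `te A i`. If `a i = 0` then `L` is a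
nodal curve in the class `α i`. -/
theorem hasPeriod_α {A : Params} (ht : A.t ≠ 0) (i : Fin 4) : HasPeriod A (α i) (A.a i) := by
  refine AddSubgroup.subset_closure ?_
  have hQ : InQperp (α i) := inQperp_α i
  obtain ⟨hα, h1, h2, h3, h4, h5⟩ := lattice_facts i
  by_cases he : te A i = 0
  · right
    refine ⟨⟨hQ, hα, towerLine A ht i, ?_⟩, ?_⟩
    · rw [cls_towerLine, if_pos he]
    · rw [← sgn_te, he]; simp
  · left
    have hW := good_tW A i
    have hp₁ := hW.isPoint 0 0
    have hp₀ := (hW.blowUp₀ (te A i) 0).isPoint 0 0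
    refine ⟨α i + E₂ i, E₂ i, towerLine A ht i, bd A ht (.snd i), bd A ht (.fst i), fstComp i,
      (tW A i).localRing 0 0, ((tW A i).blowUp₀ (te A i) 0).localRing 0 0,
      con (sgn i) * tu A i, sgn i * 0, sgn i * te A i, by simp, hQ, hα,
      ⟨?_, ?_, ?_⟩, ⟨?_, ?_, ?_⟩, ?_, ?_, ?_, ⟨?_, ?_, ?_⟩, ⟨?_, ?_, ?_⟩,
      hasResidue_fst A i, ?_, ?_, ?_⟩
    · rw [cls_towerLine, if_neg he]
    · exact h1
    · exact h2
    · exact cls_bd ht _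
    · exact h3
    · exact h4
    · rw [cls_bd ht, h5]
    · exact fun j => (inter_δcomp i j).1
    · exact fun j => (inter_δcomp i j).2
    · exact (mem_S ht).2 (Or.inr ⟨i, mem_Tower_fst (Ne.symm he)⟩)
    · rw [towerLine_ring]
      exact (locAt_curveVal hW (irreducible_X 0) (by simp)).1
    · exact (fst_point A i 0).1
    · exact (mem_S ht).2 (Or.inr ⟨i, Or.inr ⟨0, Or.inl rfl⟩⟩)
    · exact (snd_point A i 0).1
    · rw [bd_ring, fst_ring]
      exact (locAt_curveVal (hW.blowUp₀ _ _) (irreducible_X 0) (by simp)).1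
    · have := hW.hasValue_x 0 0
      rw [tW_x] at this
      exact hp₁.mul (hp₁.con _) this
    · have := hW.blowUp₀_val_x (te A i) 0 0
      rw [tW_x] at this
      exact hp₀.mul (hp₀.con _) this
    · rw [← sgn_te]; simp

end

/-! ### Automorphisms of the function field and isomorphisms of surfaces -/

/-- The endomorphism of the function field sending `q`, `p` to given generators. -/
def Chart.Good.hom {ch : Chart} (hch : ch.Good) : K →ₐ[ℂ] K :=
  IsFractionRing.liftAlgHom (A := MvPolynomial (Fin 2) ℂ) (K := K)
    (g := MvPolynomial.aeval ![ch.x, ch.y]) hch.algebraicIndependent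

theorem Chart.Good.hom_algebraMap {ch : Chart} (hch : ch.Good) (g : MvPolynomial (Fin 2) ℂ) :
    hch.hom (algebraMap (MvPolynomial (Fin 2) ℂ) K g) = ch.poly g :=
  IsFractionRing.lift_algebraMap (A := MvPolynomial (Fin 2) ℂ) (K := K)
    (g := (MvPolynomial.aeval ![ch.x, ch.y]).toRingHom) hch.algebraicIndependent g

theorem Chart.Good.hom_bijective {ch : Chart} (hch : ch.Good) : Function.Bijective hch.hom := by
  refine ⟨hch.hom.toRingHom.injective, fun f => ?_⟩
  obtain ⟨g, h, -, rfl⟩ := hch.exists_eq_div f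
  exact ⟨algebraMap _ K g / algebraMap _ K h, by
    rw [map_div₀, hch.hom_algebraMap, hch.hom_algebraMap]⟩

/-- The automorphism of the function field sending `q`, `p` to given generators. -/
def Chart.Good.aut {ch : Chart} (hch : ch.Good) : K ≃ₐ[ℂ] K :=
  AlgEquiv.ofBijective hch.hom hch.hom_bijective

theorem Chart.Good.aut_algebraMap {ch : Chart} (hch : ch.Good) (g : MvPolynomial (Fin 2) ℂ) :
    hch.aut (algebraMap (MvPolynomial (Fin 2) ℂ) K g) = ch.poly g :=
  hch.hom_algebraMap g

@[simp] theorem Chart.Good.aut_q {ch : Chart} (hch : ch.Good) : hch.aut q = ch.x := by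
  rw [q, hch.aut_algebraMap, poly_X0]

@[simp] theorem Chart.Good.aut_p {ch : Chart} (hch : ch.Good) : hch.aut p = ch.y := by
  rw [p, hch.aut_algebraMap, poly_X1]

theorem algEquiv_ext {σ τ : K ≃ₐ[ℂ] K} (hq : σ q = τ q) (hp : σ p = τ p) : σ = τ := by
  ext f
  obtain ⟨g, h, -, rfl⟩ := good_U₀₀.exists_eq_div f
  have : U₀₀.map σ = U₀₀.map τ := by simp [Chart.map, U₀₀, hq, hp]
  rw [map_div₀, map_div₀, ← map_poly, ← map_poly, ← map_poly, ← map_poly, this]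

theorem map_injective (σ : K ≃ₐ[ℂ] K) {O O' : Subring K}
    (h : O.map (σ : K →+* K) = O'.map (σ : K →+* K)) : O = O' :=
  SetLike.coe_injective (Set.image_injective.2 σ.injective (congrArg SetLike.coe h))

theorem map_map_of_inverse {σ τ : K ≃ₐ[ℂ] K} (h : ∀ f, σ (τ f) = f) (O : Subring K) :
    (O.map (τ : K →+* K)).map (σ : K →+* K) = O := by
  rw [Subring.map_map, show (σ : K →+* K).comp (τ : K →+* K) = RingHom.id K from RingHom.ext h,
    Subring.map_id]

/-- An isomorphism of surfaces given by mutually inverse automorphisms. -/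
def SurfaceIso.ofInverse {X Y : Set (Subring K)} (σ τ : K ≃ₐ[ℂ] K) (h : ∀ f, τ (σ f) = f)
    (hσ : ∀ O ∈ Y, O.map (σ : K →+* K) ∈ X) (hτ : ∀ O ∈ X, O.map (τ : K →+* K) ∈ Y) :
    SurfaceIso X Y where
  pull := σ
  map_mem_iff O := ⟨fun hO => by simpa only [map_map_of_inverse h] using hτ _ hO, hσ O⟩

/-- Composition of isomorphisms, first `φ`, then `ψ`. -/
def SurfaceIso.trans {X Y Z : Set (Subring K)} (φ : SurfaceIso X Y) (ψ : SurfaceIso Y Z) :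
    SurfaceIso X Z where
  pull := ψ.pull.trans φ.pull
  map_mem_iff O := by
    rw [← ψ.map_mem_iff, ← φ.map_mem_iff, Subring.map_map]
    rfl

theorem HasValue.map {O : Subring K} {f : K} {v : ℂ} (h : HasValue O f v) (σ : K ≃ₐ[ℂ] K) :
    HasValue (O.map (σ : K →+* K)) (σ f) v := by
  have e : σ f - con v = σ (f - con v) := by rw [map_sub, map_con]
  refine ⟨⟨_, h.1, e.symm⟩, ?_⟩
  rw [e]
  refine h.2.imp (fun h => by rw [h, map_zero]) fun h => ?_
  rw [← map_inv₀]
  rintro ⟨g, hg, hg'⟩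
  exact h (σ.injective hg' ▸ hg)

/-- A criterion for an automorphism to match two points. -/
theorem Chart.Good.map_localRing_eq {ch ch' : Chart} (hch : ch.Good) (hch' : ch'.Good)
    {σ τ : K ≃ₐ[ℂ] K} (h : ∀ f, σ (τ f) = f) {c d c' d' : ℂ}
    (hx : HasValue (ch'.localRing c' d') (σ ch.x) c)
    (hy : HasValue (ch'.localRing c' d') (σ ch.y) d)
    (hx' : HasValue (ch.localRing c d) (τ ch'.x) c')
    (hy' : HasValue (ch.localRing c d) (τ ch'.y) d') :
    (ch.localRing c d).map (σ : K →+* K) = ch'.localRing c' d' := by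
  have hx'' := hx'.map σ
  have hy'' := hy'.map σ
  rw [h, localRing_map] at hx'' hy''
  rw [localRing_map]
  exact (hch.map σ).localRing_eq hch' hx'' hy'' hx hy

/-- An automorphism that matches the centres of two towers matches the towers. -/
theorem map_mem_Tower {A B : Params} {i j : Fin 4} {σ : K ≃ₐ[ℂ] K}
    (h₁ : (basePt B i).map (σ : K →+* K) = basePt A j)
    (h₂ : (nearPt B i).map (σ : K →+* K) = nearPt A j) {O : Subring K} (hO : O ∈ Tower B i) :
    O.map (σ : K →+* K) ∈ Tower A j := by
  rcases hO with ⟨hO, hn⟩ | hO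
  · refine Or.inl ⟨?_, fun h => hn (map_injective σ (h.trans h₂.symm))⟩
    rw [basePt, basePt, localRing_map] at h₁
    rw [← ((good_tb i).map σ).Exc_eq (good_tb j) h₁]
    exact Exc_map σ hO
  · right
    rw [nearPt, nearPt, localRing_map] at h₂
    rw [← ((good_tW B i).map σ).Exc_eq (good_tW A j) h₂]
    exact Exc_map σ hO

/-! ### Preimages of curves -/

theorem mem_comap_symm {σ : K ≃ₐ[ℂ] K} {R : ValuationSubring K} {f : K} :
    σ f ∈ R.comap (σ.symm : K →+* K) ↔ f ∈ R := by
  simp [ValuationSubring.mem_comap]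

theorem comap_curveVal (σ : K ≃ₐ[ℂ] K) {ch : Chart} (hch : ch.Good) {F : MvPolynomial (Fin 2) ℂ}
    (hF : Irreducible F) : (ch.curveVal hch F hF).comap (σ.symm : K →+* K) =
      (ch.map σ).curveVal (hch.map σ) F hF := by
  ext f
  obtain ⟨f, rfl⟩ := σ.surjective f
  rw [mem_comap_symm, mem_curveVal, mem_curveVal]
  refine exists_congr fun g => exists_congr fun h => and_congr Iff.rfl ?_
  rw [map_poly, map_poly, ← map_div₀, σ.injective.eq_iff, ne_eq, ne_eq, map_eq_zero]

/-- An automorphism that matches two points matches the exceptional curves over them. -/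
theorem comap_excVal {σ : K ≃ₐ[ℂ] K} {ch ch' : Chart} (hch : ch.Good) (hch' : ch'.Good)
    {c d c' d' : ℂ} (h : (ch.localRing c d).map (σ : K →+* K) = ch'.localRing c' d') :
    (excVal ch hch c d).comap (σ.symm : K →+* K) = excVal ch' hch' c' d' := by
  rw [localRing_map] at h
  rw [← excVal_eq (hch.map σ) hch' h, excVal, comap_curveVal, excVal]
  simp only [blowUp₀_map]

/-- An automorphism that matches two points matches curves through these points, if a local
equation of the second is divisible by that of the first. -/
theorem comap_curveVal_eq {σ : K ≃ₐ[ℂ] K} {ch ch' : Chart} (hch : ch.Good) (hch' : ch'.Good)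
    {c d c' d' : ℂ} (h : (ch.localRing c d).map (σ : K →+* K) = ch'.localRing c' d')
    {F F' : MvPolynomial (Fin 2) ℂ} (hF : Irreducible F) (hF' : Irreducible F')
    (hF0 : MvPolynomial.eval ![c, d] F = 0) {g : K} {v : ℂ}
    (hg : HasValue (ch'.localRing c' d') g v) (hgF : ch'.poly F' = g * σ (ch.poly F)) :
    (ch.curveVal hch F hF).comap (σ.symm : K →+* K) = ch'.curveVal hch' F' hF' := by
  rw [localRing_map] at h
  rw [comap_curveVal]
  set R := (ch.map σ).curveVal (hch.map σ) F hF
  have h1 : LocAt ((ch.map σ).localRing c d) R := locAt_curveVal _ _ hF0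
  rw [h] at h1
  refine SetLike.coe_injective (hch'.eq_curveRing (h1.loc hch') hF' ?_)
  rw [hgF, ← map_poly]
  exact val_mul_lt (mem_iff_val.1 (h1.1 _ (hg.mem (hch'.isPoint _ _))))
    (curveVal_poly_self_lt (hch.map σ) hF)

theorem SurfaceIso.pullPic_cls {X Y : Set (Subring K)} (φ : SurfaceIso X Y) (C : PrimeDivisor Y) :
    φ.pullPic C.cls = (φ.preimage C).cls := by
  have : φ.pullDivisor (Finsupp.single C 1) = Finsupp.single (φ.preimage C) 1 :=
    Finsupp.equivMapDomain_single _ _ _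
  exact congrArg (QuotientAddGroup.mk (s := principal X)) this

theorem SurfaceIso.pullPic_trans {X Y Z : Set (Subring K)} (φ : SurfaceIso X Y) (ψ : SurfaceIso Y Z)
    (c : Pic Z) : (φ.trans ψ).pullPic c = φ.pullPic (ψ.pullPic c) := by
  obtain ⟨D, rfl⟩ := QuotientAddGroup.mk_surjective c
  refine congrArg (QuotientAddGroup.mk (s := principal X)) ?_
  ext C
  rfl

/-- Homomorphisms on the Picard lattice are determined by the values on the boundary classes. -/
theorem hom_ext {M : Type*} [AddCommGroup M] {f g : PicLattice →+ M}
    (h : ∀ b, f (bdClass b) = g (bdClass b)) : f = g := by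
  have h2 (i) : f (E₂ i) = g (E₂ i) := h (.snd i)
  have h1 (i) : f (E₁ i) = g (E₁ i) := by
    have := h (.fst i)
    rwa [bdClass, map_sub, map_sub, h2, sub_left_inj] at this
  have hq : f Hq = g Hq := by
    have := h (.fib 0)
    rwa [show bdClass (.fib 0) = Hq - E₁ 0 - E₁ 2 from rfl, map_sub, map_sub, map_sub, map_sub, h1,
      h1, sub_left_inj, sub_left_inj] at this
  have hp : f Hp = g Hp := by
    have := h (.fib 1)
    rwa [show bdClass (.fib 1) = Hp - E₁ 1 - E₁ 3 from rfl, map_sub, map_sub, map_sub, map_sub, h1,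
      h1, sub_left_inj, sub_left_inj] at this
  refine AddMonoidHom.functions_ext' _ _ _ fun j => ?_
  ext
  change f (Pi.single j 1) = g (Pi.single j 1)
  fin_cases j
  exacts [hq, hp, h1 0, h2 0, h1 2, h2 2, h1 1, h2 1, h1 3, h2 3]

theorem inter_add (F G H : PicLattice) : inter (F + G) H = inter F H + inter G H := by
  simp only [inter, Pi.add_apply, add_mul, Finset.sum_add_distrib]; ring

theorem r_add (i : Fin 4) (F G : PicLattice) : r i (F + G) = r i F + r i G := by
  simp only [r, inter_add, add_smul]; abel

theorem σ₁_add (F G : PicLattice) : σ₁ (F + G) = σ₁ F + σ₁ G := by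
  simp only [σ₁, Pi.add_apply, add_smul]; abel

theorem σ₂_add (F G : PicLattice) : σ₂ (F + G) = σ₂ F + σ₂ G := by
  simp only [σ₂, Pi.add_apply, add_smul]; abel

/-- The action of an isomorphism on the Picard lattice is determined by the classes of the
preimages of the boundary curves. -/
theorem induces_of_bd {A B : Params} (hB : B.t ≠ 0) {φ : SurfaceIso (S A) (S B)}
    {w : PicLattice → PicLattice} (hw : ∀ F G, w (F + G) = w F + w G)
    (h : ∀ b, (φ.preimage (bd B hB b)).cls = ι A (w (bdClass b))) : Induces w A B φ := by
  let f : PicLattice →+ Pic (S A) := φ.pullPic.comp (AddMonoidHom.mk' (ι B) ι_add)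
  let g : PicLattice →+ Pic (S A) := (AddMonoidHom.mk' (ι A) ι_add).comp (AddMonoidHom.mk' w hw)
  have : f = g := hom_ext fun b => by
    change φ.pullPic (ι B (bdClass b)) = ι A (w (bdClass b))
    rw [← cls_bd hB, φ.pullPic_cls, h]
  exact fun F => DFunLike.congr_fun this F

theorem Induces.trans {A B C : Params} {φ : SurfaceIso (S A) (S B)} {ψ : SurfaceIso (S B) (S C)}
    {w w' : PicLattice → PicLattice} (h : Induces w A B φ) (h' : Induces w' B C ψ) :
    Induces (w ∘ w') A C (φ.trans ψ) := fun F => by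
  rw [φ.pullPic_trans, h', h]; rfl

/-! ### Matching towers -/

/-- A function with a pole keeps it when a regular function is added. -/
theorem IsPoint.inv_add {O : Subring K} (hO : IsPoint O) {x f : K} {v : ℂ} (h0 : x ≠ 0)
    (hx : HasValue O x⁻¹ 0) (hf : HasValue O f v) : HasValue O (x + f)⁻¹ 0 := by
  have h1 : HasValue O (1 + f * x⁻¹) 1 :=
    (hO.add (hO.con 1) (hO.mul hf hx)).congr (by simp) (by simp)
  have h2 := hO.ne_zero h1 one_ne_zero
  have h3 := hO.mul hx (hO.inv h1 one_ne_zero)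
  refine h3.congr ?_ (by simp)
  have h4 : x + f = x * (1 + f * x⁻¹) := by field_simp
  rw [h4, mul_inv]

/-- The values, at the points of the `j`-th tower of the first surface, of the pull-backs of the
coordinates on the `i`-th tower of the second surface are those at the centres. -/
structure TowerValues (A B : Params) (i j : Fin 4) (σ : K ≃ₐ[ℂ] K) : Prop where
  x : ∀ O, Over A j O → HasValue O (σ (tx i))⁻¹ 0
  y : ∀ O, Over A j O → HasValue O (σ (ty i)) (ts B i)
  u : HasValue (nearPt A j) (σ (tu B i)) (te B i)

/-- The automorphism matches the two centres of the `i`-th tower with those of the `j`-th. -/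
structure TowerMatch (A B : Params) (i j : Fin 4) (σ : K ≃ₐ[ℂ] K) : Prop where
  base : (basePt B i).map (σ : K →+* K) = basePt A j
  near : (nearPt B i).map (σ : K →+* K) = nearPt A j

theorem TowerValues.towerMatch {A B : Params} {i j : Fin 4} {σ τ : K ≃ₐ[ℂ] K} (h : ∀ f, σ (τ f) = f)
    (hσ : TowerValues A B i j σ) (hτ : TowerValues B A j i τ) : TowerMatch A B i j σ where
  base := by
    refine (good_tb i).map_localRing_eq (good_tb j) h ?_ (hσ.y _ (over_basePt A j)) ?_
      (hτ.y _ (over_basePt B i))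
    · exact (hσ.x _ (over_basePt A j)).congr (map_inv₀ σ _).symm rfl
    · exact (hτ.x _ (over_basePt B i)).congr (map_inv₀ τ _).symm rfl
  near := by
    refine (good_tW B i).map_localRing_eq (good_tW A j) h ?_ ?_ ?_ ?_
    · rw [tW_x]; exact hσ.u
    · rw [tW_y, map_inv₀]; exact hσ.x _ (over_nearPt A j)
    · rw [tW_x]; exact hτ.u
    · rw [tW_y, map_inv₀]; exact hτ.x _ (over_nearPt B i)

/-- The direction function takes the expected value at the second centre. -/
theorem nearPt_tu (A : Params) (i : Fin 4) : HasValue (nearPt A i) (tu A i) (te A i) := by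
  have := (good_tW A i).hasValue_x (te A i) 0
  rwa [tW_x] at this

/-- An automorphism of `ℙ¹ × ℙ¹` that matches the towers maps points of one surface to points of the
other. -/
theorem map_mem_S {A B : Params} (hA : A.t ≠ 0) (hB : B.t ≠ 0) {σ : K ≃ₐ[ℂ] K} {π : Fin 4 → Fin 4}
    (hπ : Function.Surjective π) (h : ∀ i, TowerMatch A B i (π i) σ)
    (hP : ∀ O ∈ P1P1, O.map (σ : K →+* K) ∈ P1P1) {O : Subring K} (hO : O ∈ S B) :
    O.map (σ : K →+* K) ∈ S A := by
  refine (mem_S hA).2 (((mem_S hB).1 hO).imp ?_ ?_)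
  · refine fun ⟨h1, h2⟩ => ⟨hP O h1, fun j hj => ?_⟩
    obtain ⟨i, rfl⟩ := hπ j
    exact h2 i (map_injective σ (hj.trans (h i).base.symm))
  · rintro ⟨i, hi⟩
    exact ⟨π i, map_mem_Tower (h i).base (h i).near hi⟩

theorem TowerMatch.fst {A B : Params} {i j : Fin 4} {σ : K ≃ₐ[ℂ] K} (h : TowerMatch A B i j σ) :
    (bdVal B (.fst i)).comap (σ.symm : K →+* K) = bdVal A (.fst j) :=
  comap_excVal (good_tb i) (good_tb j) h.base

theorem TowerMatch.snd {A B : Params} {i j : Fin 4} {σ : K ≃ₐ[ℂ] K} (h : TowerMatch A B i j σ) :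
    (bdVal B (.snd i)).comap (σ.symm : K →+* K) = bdVal A (.snd j) :=
  comap_excVal (good_tW B i) (good_tW A j) h.near

theorem preimage_bd {A B : Params} (hA : A.t ≠ 0) (hB : B.t ≠ 0) {φ : SurfaceIso (S A) (S B)}
    {b b' : Bdry} (h : (bdVal B b).comap (φ.pull.symm : K →+* K) = bdVal A b') :
    φ.preimage (bd B hB b) = bd A hA b' := PrimeDivisor.ext h

/-- An automorphism that matches two points of fibres at infinity matches the fibres, if the local
equation of the second is divisible by that of the first. -/
theorem fibVal_comap {σ : K ≃ₐ[ℂ] K} {k l : Fin 2} {d d' : ℂ}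
    (h : ((tb (k.castLE (by decide))).localRing 0 d).map (σ : K →+* K) =
      (tb (l.castLE (by decide))).localRing 0 d') {g : K} {v : ℂ}
    (hg : HasValue ((tb (l.castLE (by decide))).localRing 0 d') g v)
    (hgF : (tx (l.castLE (by decide)))⁻¹ = g * σ (tx (k.castLE (by decide)))⁻¹) :
    (fibVal k).comap (σ.symm : K →+* K) = fibVal l :=
  comap_curveVal_eq (good_tb _) (good_tb _) h _ _ (by simp) hg (by simpa [tb] using hgF)

/-! ### The transformation exchanging the two rulings -/

theorem good_rot {t : ℂ} (ht : t ≠ 0) : Good ⟨-(p / con t), q * con t⟩ := by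
  have h0 := con_ne_zero ht
  set ch : Chart := ⟨-(p / con t), q * con t⟩
  have hx := x_mem_adjoin (ch := ch)
  have hy := y_mem_adjoin (ch := ch)
  refine good_U₀₀.of_mem ?_ ?_
  · have := div_mem hy (con_mem_adjoin t (Set.range ![ch.x, ch.y]))
    rwa [show ch.y / con t = q from mul_div_cancel_right₀ _ h0] at this
  · have := neg_mem (mul_mem hx (con_mem_adjoin t (Set.range ![ch.x, ch.y])))
    rwa [show -(ch.x * con t) = p by simp [ch, h0]] at this

/-- The automorphism `(q, p) ↦ (-p / t, q t)`. -/
def rot {t : ℂ} (ht : t ≠ 0) : K ≃ₐ[ℂ] K := (good_rot ht).aut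

theorem rot_q {t : ℂ} (ht : t ≠ 0) : rot ht q = -(p / con t) := (good_rot ht).aut_q
theorem rot_p {t : ℂ} (ht : t ≠ 0) : rot ht p = q * con t := (good_rot ht).aut_p

theorem rot_rot {t : ℂ} (ht : t ≠ 0) (f : K) : rot (neg_ne_zero.2 ht) (rot ht f) = f := by
  have h0 := con_ne_zero ht
  have : (rot ht).trans (rot (neg_ne_zero.2 ht)) = AlgEquiv.refl := by
    apply algEquiv_ext
    · simp only [AlgEquiv.trans_apply, rot_q, rot_p, map_con, con_neg, map_neg, map_div₀]
      field_simp; simp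
    · simp only [AlgEquiv.trans_apply, rot_q, rot_p, map_con, con_neg, map_mul]
      field_simp; simp
  exact DFunLike.congr_fun this f

/-- The action of `σ₁` on the parameters. -/
def rotParams (A : Params) : Params := ⟨![A.a 3, A.a 2, A.a 1, A.a 0], -A.t⟩

theorem rotParams_rotParams (A : Params) : rotParams (rotParams A) = A := by
  refine Params.ext (funext fun i => ?_) (neg_neg _)
  fin_cases i <;> rfl

/-- The transformation rescales the coordinates of the towers, exchanging the two axes. -/
theorem rot_towerValues {A : Params} (ht : A.t ≠ 0) (i : Fin 4) :
    TowerValues A (rotParams A) i i.rev (rot ht) := by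
  have h0 := con_ne_zero ht
  have key : ∃ u v : ℂ, u ≠ 0 ∧ rot ht (tx i) = con u * tx i.rev ∧
      rot ht (ty i) = con v * ty i.rev ∧ ts (rotParams A) i = v * ts A i.rev ∧
      te (rotParams A) i = v * u * te A i.rev := by
    have e1 : -(p / con A.t) = con (-A.t⁻¹) * p := by rw [con_neg, con_inv]; field_simp
    fin_cases i
    · exact ⟨-A.t⁻¹, A.t, by simp [ht], (rot_q ht).trans e1, (rot_p ht).trans (mul_comm _ _),
        by simp [ts, rotParams], by simp [te, rotParams, ht]⟩
    · exact ⟨A.t, -A.t⁻¹, ht, (rot_p ht).trans (mul_comm _ _), (rot_q ht).trans e1,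
        by simp [ts, rotParams], by simp [te, rotParams, ht]⟩
    · exact ⟨-A.t⁻¹, A.t, by simp [ht], (rot_q ht).trans e1, (rot_p ht).trans (mul_comm _ _),
        by simp [ts, rotParams], by simp [te, rotParams, ht]⟩
    · exact ⟨A.t, -A.t⁻¹, ht, (rot_p ht).trans (mul_comm _ _), (rot_q ht).trans e1,
        by simp [ts, rotParams, ht], by simp [te, rotParams, ht]⟩
  obtain ⟨u, v, hu, hx, hy, hs, he⟩ := key
  refine ⟨fun O hO => ?_, fun O hO => ?_, ?_⟩
  · exact (hO.1.mul (hO.1.con u⁻¹) hO.2.1).congr (by rw [hx, mul_inv, con_inv]) (mul_zero _)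
  · exact (hO.1.mul (hO.1.con v) hO.2.2).congr hy.symm hs.symm
  · have hO := isPoint_nearPt A i.rev
    refine (hO.mul (hO.con (v * u)) (nearPt_tu A i.rev)).congr ?_ he.symm
    rw [tu, tu, map_mul, map_sub, hx, hy, map_con, hs, con_mul, con_mul]
    ring

theorem localRing_of_scaling {ch ch' : Chart} (hch : ch.Good) (hch' : ch'.Good) {u v : ℂ}
    (hu : u ≠ 0) (hv : v ≠ 0) (hx : ch.x = con u * ch'.x) (hy : ch.y = con v * ch'.y) (c d : ℂ) :
    ch.localRing c d = ch'.localRing (u⁻¹ * c) (v⁻¹ * d) := by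
  have hp := hch.isPoint c d
  have hp' := hch'.isPoint (u⁻¹ * c) (v⁻¹ * d)
  have hu' := con_ne_zero hu
  have hv' := con_ne_zero hv
  refine hch.localRing_eq hch' ?_ ?_ ?_ ?_
  · exact (hp.mul (hp.con u⁻¹) (hch.hasValue_x c d)).congr (by rw [hx, con_inv]; field_simp) rfl
  · exact (hp.mul (hp.con v⁻¹) (hch.hasValue_y c d)).congr (by rw [hy, con_inv]; field_simp) rfl
  · exact (hp'.mul (hp'.con u) (hch'.hasValue_x _ _)).congr hx.symm (by field_simp)
  · exact (hp'.mul (hp'.con v) (hch'.hasValue_y _ _)).congr hy.symm (by field_simp)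

theorem rot_P1P1 {t : ℂ} (ht : t ≠ 0) {O : Subring K} (hO : O ∈ P1P1) :
    O.map (rot ht : K →+* K) ∈ P1P1 := by
  have hq : rot ht q = con (-t⁻¹) * p := by rw [rot_q, con_neg, con_inv]; field_simp
  have hp : rot ht p = con t * q := by rw [rot_p, mul_comm]
  have hq' : rot ht q⁻¹ = con (-t) * p⁻¹ := by rw [map_inv₀, hq, mul_inv, ← con_inv]; simp
  have hp' : rot ht p⁻¹ = con t⁻¹ * q⁻¹ := by rw [map_inv₀, hp, mul_inv, ← con_inv]
  have h1 : -t⁻¹ ≠ 0 := by simp [ht]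
  have h2 : -t ≠ 0 := by simp [ht]
  have h3 := inv_ne_zero ht
  have key {ch ch' : Chart} (hch : ch.Good) (hch' : ch'.Good) {u v : ℂ} (hu : u ≠ 0) (hv : v ≠ 0)
      (hx : rot ht ch.x = con u * ch'.y) (hy : rot ht ch.y = con v * ch'.x) (c d : ℂ) :
      (ch.localRing c d).map (rot ht : K →+* K) = ch'.localRing (v⁻¹ * d) (u⁻¹ * c) := by
    rw [localRing_map, ← hch'.localRing_swap]
    exact localRing_of_scaling (hch.map _) hch'.swap hu hv hx hy c d
  obtain ⟨c, d, rfl | rfl | rfl | rfl⟩ := hO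
  · exact ⟨_, _, Or.inl (key good_U₀₀ good_U₀₀ h1 ht hq hp c d)⟩
  · exact ⟨_, _, Or.inr (Or.inr (Or.inl (key good_U₁₀ good_U₀₁ h2 ht hq' hp c d)))⟩
  · exact ⟨_, _, Or.inr (Or.inl (key good_U₀₁ good_U₁₀ h1 h3 hq hp' c d))⟩
  · exact ⟨_, _, Or.inr (Or.inr (Or.inr (key good_U₁₁ good_U₁₁ h2 h3 hq' hp' c d)))⟩

theorem rot_towerMatch {A : Params} (ht : A.t ≠ 0) (i : Fin 4) :
    TowerMatch A (rotParams A) i i.rev (rot ht) := by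
  have h (f) := rot_rot (t := -A.t) (neg_ne_zero.2 ht) f
  have h' := rot_towerValues (A := rotParams A) (neg_ne_zero.2 ht) i.rev
  rw [rotParams_rotParams, Fin.rev_rev] at h'
  simp only [neg_neg] at h
  exact (rot_towerValues ht i).towerMatch h h'

theorem rot_mem_S {A : Params} (ht : A.t ≠ 0) {O : Subring K} (hO : O ∈ S (rotParams A)) :
    O.map (rot ht : K →+* K) ∈ S A :=
  map_mem_S ht (neg_ne_zero.2 ht) Fin.rev_surjective (rot_towerMatch ht) (fun _ => rot_P1P1 ht) hO

/-- The isomorphism of surfaces inducing `σ₁`. -/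
def rotIso {A : Params} (ht : A.t ≠ 0) : SurfaceIso (S A) (S (rotParams A)) :=
  SurfaceIso.ofInverse (rot ht) (rot (neg_ne_zero.2 ht)) (rot_rot ht) (fun _ => rot_mem_S ht)
    fun O hO => rot_mem_S (A := rotParams A) (neg_ne_zero.2 ht) (by rwa [rotParams_rotParams])

theorem rotIso_induces {A : Params} (ht : A.t ≠ 0) : Induces σ₁ A (rotParams A) (rotIso ht) := by
  have hB : (rotParams A).t ≠ 0 := neg_ne_zero.2 ht
  have h0 := con_ne_zero ht
  let π : Bdry → Bdry
    | .fib k => .fib k.rev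
    | .fst i => .fst i.rev
    | .snd i => .snd i.rev
  have hπ (b : Bdry) : (bdVal (rotParams A) b).comap ((rot ht).symm : K →+* K) = bdVal A (π b) := by
    cases b with
    | fib k =>
      fin_cases k
      · have h : ((tb 0).localRing 0 0).map (rot ht : K →+* K) = (tb 1).localRing 0 0 := by
          rw [localRing_map, localRing_of_scaling (u := -A.t) (v := A.t) ((good_tb 0).map _)
            (good_tb 1) (by simp [ht]) ht]
          · simp
          · simp [Chart.map, tb, tx, rot_q, con_neg]; field_simp
          · simp [Chart.map, tb, ty, rot_p, mul_comm]
        refine fibVal_comap (k := 0) (l := 1) h (((good_tb 1).isPoint 0 0).con (-A.t⁻¹)) ?_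
        simp [tx, rot_q, con_neg, con_inv]; field_simp
      · have h : ((tb 1).localRing 0 0).map (rot ht : K →+* K) = (tb 0).localRing 0 0 := by
          rw [localRing_map, localRing_of_scaling (u := A.t⁻¹) (v := -A.t⁻¹) ((good_tb 1).map _)
            (good_tb 0) (by simp [ht]) (by simp [ht])]
          · simp
          · simp [Chart.map, tb, tx, rot_p, con_inv]
          · simp [Chart.map, tb, ty, rot_q, con_neg, con_inv]; ring
        refine fibVal_comap (k := 1) (l := 0) h (((good_tb 0).isPoint 0 0).con A.t) ?_
        simp [tx, rot_p]; field_simp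
    | fst i => exact (rot_towerMatch ht i).fst
    | snd i => exact (rot_towerMatch ht i).snd
  refine induces_of_bd hB σ₁_add fun b => ?_
  rw [preimage_bd (φ := rotIso ht) ht hB (hπ b), cls_bd]
  congr 1
  rcases b with k | i | i
  · revert k; decide
  · revert i; decide
  · revert i; decide

/-! ### The translation -/

theorem good_shift (t : ℂ) : Good ⟨q, p + con t⟩ := by
  set ch : Chart := ⟨q, p + con t⟩
  refine good_U₀₀.of_mem (x_mem_adjoin (ch := ch)) ?_
  have := sub_mem (y_mem_adjoin (ch := ch)) (con_mem_adjoin t (Set.range ![ch.x, ch.y]))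
  rwa [show ch.y - con t = p from add_sub_cancel_right _ _] at this

/-- The automorphism `(q, p) ↦ (q, p + t)`. -/
def shift (t : ℂ) : K ≃ₐ[ℂ] K := (good_shift t).aut

theorem shift_q (t : ℂ) : shift t q = q := (good_shift t).aut_q
theorem shift_p (t : ℂ) : shift t p = p + con t := (good_shift t).aut_p

theorem shift_shift (t : ℂ) (f : K) : shift (-t) (shift t f) = f := by
  have : (shift t).trans (shift (-t)) = AlgEquiv.refl := by
    apply algEquiv_ext <;> simp [shift_q, shift_p, map_con, con_neg]
  exact DFunLike.congr_fun this f

theorem shift_shift' (t : ℂ) (f : K) : shift t (shift (-t) f) = f := by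
  simpa using shift_shift (-t) f

/-- The action of `σ₂` on the parameters. -/
def shiftParams (A : Params) : Params := ⟨![A.a 2, A.a 1, A.a 0, A.a 3], -A.t⟩

theorem shiftParams_shiftParams (A : Params) : shiftParams (shiftParams A) = A := by
  refine Params.ext (funext fun i => ?_) (neg_neg _)
  fin_cases i <;> rfl

/-- The permutation of the towers by the translation. -/
def shiftPerm (i : Fin 4) : Fin 4 := ![2, 1, 0, 3] i

theorem shiftPerm_shiftPerm (i : Fin 4) : shiftPerm (shiftPerm i) = i := by revert i; decide

theorem shift_towerValues (A : Params) (i : Fin 4) :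
    TowerValues A (shiftParams A) i (shiftPerm i) (shift A.t) := by
  have even (i j : Fin 4) (hx : tx i = q) (hy : ty i = p) (hx' : tx j = q) (hy' : ty j = p)
      (hs : ts (shiftParams A) i = ts A j + A.t) (he : te (shiftParams A) i = te A j) :
      TowerValues A (shiftParams A) i j (shift A.t) := by
    refine ⟨fun O hO => ?_, fun O hO => ?_, ?_⟩
    · have := hO.2.1; rwa [hx, shift_q, ← hx']
    · have := hO.1.add hO.2.2 (hO.1.con A.t)
      rwa [hy, shift_p, hs, ← hy']
    · have := nearPt_tu A j
      rw [tu, hx', hy'] at this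
      rw [tu, hx, hy, map_mul, map_sub, shift_q, shift_p, map_con, hs, con_add, he,
        add_sub_add_right_eq_sub]
      exact this
  have odd (i : Fin 4) (hx : tx i = p) (hy : ty i = q) (hs : ts (shiftParams A) i = ts A i)
      (he : te (shiftParams A) i = te A i) : TowerValues A (shiftParams A) i i (shift A.t) := by
    refine ⟨fun O hO => ?_, fun O hO => ?_, ?_⟩
    · have := hO.2.1
      rw [hx] at this
      rw [hx, shift_p]
      exact hO.1.inv_add (hx ▸ tx_ne_zero i) this (hO.1.con _)
    · have := hO.2.2; rwa [hy, shift_q, hs, ← hy]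
    · obtain ⟨hO, -, h2⟩ := over_nearPt A i
      have h3 := hO.add (nearPt_tu A i) (hO.mul (hO.sub h2 (hO.con (ts A i))) (hO.con A.t))
      refine h3.congr ?_ (by rw [he]; ring)
      rw [tu, tu, map_mul, map_sub, hx, hy, shift_q, shift_p, map_con, hs]; ring
  fin_cases i
  · exact even 0 2 rfl rfl rfl rfl (by simp [ts, shiftParams]) rfl
  · exact odd 1 rfl rfl rfl rfl
  · exact even 2 0 rfl rfl rfl rfl (by simp [ts]) rfl
  · exact odd 3 rfl rfl rfl rfl

theorem shift_towerMatch (A : Params) (i : Fin 4) :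
    TowerMatch A (shiftParams A) i (shiftPerm i) (shift A.t) := by
  have h' := shift_towerValues (shiftParams A) (shiftPerm i)
  rw [shiftParams_shiftParams, shiftPerm_shiftPerm] at h'
  exact (shift_towerValues A i).towerMatch (shift_shift' A.t) h'

theorem shift_P1P1 (t : ℂ) {O : Subring K} (hO : O ∈ P1P1) :
    O.map (shift t : K →+* K) ∈ P1P1 := by
  have h := shift_shift' t
  have p0 : p ≠ 0 := tx_ne_zero 1
  have hq {O v} (s : ℂ) (h : HasValue O q v) : HasValue O (shift s q) v := by rwa [shift_q]
  have hQ {O v} (s : ℂ) (h : HasValue O q⁻¹ v) : HasValue O (shift s q⁻¹) v := by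
    rwa [map_inv₀, shift_q]
  have hp {O v} (s : ℂ) (hO : IsPoint O) (h : HasValue O p v) : HasValue O (shift s p) (v + s) := by
    rw [shift_p]; exact hO.add h (hO.con s)
  have hP {O} (s : ℂ) (hO : IsPoint O) (h : HasValue O p⁻¹ 0) : HasValue O (shift s p⁻¹) 0 := by
    rw [map_inv₀, shift_p]; exact hO.inv_add p0 h (hO.con s)
  rcases mem_P1P1.1 hO with ⟨c, d, rfl⟩ | ⟨d, rfl⟩ | ⟨c, rfl⟩ | rfl
  · refine ⟨c, d + -t, Or.inl (good_U₀₀.map_localRing_eq good_U₀₀ h (hq t (good_U₀₀.hasValue_x _ _))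
      ((hp t (good_U₀₀.isPoint _ _) (good_U₀₀.hasValue_y _ _)).congr rfl (by ring))
      (hq _ (good_U₀₀.hasValue_x _ _)) (hp _ (good_U₀₀.isPoint _ _) (good_U₀₀.hasValue_y _ _)))⟩
  · refine ⟨0, d + -t, Or.inr (Or.inl (good_U₁₀.map_localRing_eq good_U₁₀ h
      (hQ t (good_U₁₀.hasValue_x _ _))
      ((hp t (good_U₁₀.isPoint _ _) (good_U₁₀.hasValue_y _ _)).congr rfl (by ring))
      (hQ _ (good_U₁₀.hasValue_x _ _)) (hp _ (good_U₁₀.isPoint _ _) (good_U₁₀.hasValue_y _ _))))⟩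
  · exact ⟨c, 0, Or.inr (Or.inr (Or.inl (good_U₀₁.map_localRing_eq good_U₀₁ h
      (hq t (good_U₀₁.hasValue_x _ _)) (hP t (good_U₀₁.isPoint _ _) (good_U₀₁.hasValue_y _ _))
      (hq _ (good_U₀₁.hasValue_x _ _)) (hP _ (good_U₀₁.isPoint _ _) (good_U₀₁.hasValue_y _ _)))))⟩
  · exact ⟨0, 0, Or.inr (Or.inr (Or.inr (good_U₁₁.map_localRing_eq good_U₁₁ h
      (hQ t (good_U₁₁.hasValue_x _ _)) (hP t (good_U₁₁.isPoint _ _) (good_U₁₁.hasValue_y _ _))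
      (hQ _ (good_U₁₁.hasValue_x _ _)) (hP _ (good_U₁₁.isPoint _ _) (good_U₁₁.hasValue_y _ _)))))⟩

theorem shift_mem_S {A : Params} (ht : A.t ≠ 0) {O : Subring K} (hO : O ∈ S (shiftParams A)) :
    O.map (shift A.t : K →+* K) ∈ S A :=
  map_mem_S ht (neg_ne_zero.2 ht) (fun i => ⟨_, shiftPerm_shiftPerm i⟩) (shift_towerMatch A)
    (fun _ => shift_P1P1 A.t) hO

/-- The isomorphism of surfaces inducing `σ₂`. -/
def shiftIso {A : Params} (ht : A.t ≠ 0) : SurfaceIso (S A) (S (shiftParams A)) :=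
  SurfaceIso.ofInverse (shift A.t) (shift (-A.t)) (shift_shift A.t) (fun _ => shift_mem_S ht)
    fun O hO => shift_mem_S (A := shiftParams A) (neg_ne_zero.2 ht)
      (by rwa [shiftParams_shiftParams])

theorem shiftIso_induces {A : Params} (ht : A.t ≠ 0) :
    Induces σ₂ A (shiftParams A) (shiftIso ht) := by
  have hB : (shiftParams A).t ≠ 0 := neg_ne_zero.2 ht
  let π : Bdry → Bdry
    | .fib k => .fib k
    | .fst i => .fst (shiftPerm i)
    | .snd i => .snd (shiftPerm i)
  have hπ (b : Bdry) : (bdVal (shiftParams A) b).comap ((shift A.t).symm : K →+* K) =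
      bdVal A (π b) := by
    cases b with
    | fib k =>
      fin_cases k
      · refine fibVal_comap (k := 0) (l := 0) (shift_towerMatch A 2).base
          ((isPoint_basePt A 0).con 1) ?_
        simp [tx, shift_q]
      · refine fibVal_comap (k := 1) (l := 1) (shift_towerMatch A 1).base (v := 1)
          (g := 1 + con A.t * p⁻¹) ?_ ?_
        · obtain ⟨hO, h1, -⟩ := over_basePt A 1
          exact (hO.add (hO.con 1) (hO.mul (hO.con A.t) h1)).congr (by simp [tx]) (by simp)
        · have h0 : p ≠ 0 := tx_ne_zero 1
          have h1 : p + con A.t ≠ 0 := (good_shift A.t).y_ne_zero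
          simp [tx, shift_p]; field_simp
    | fst i => exact (shift_towerMatch A i).fst
    | snd i => exact (shift_towerMatch A i).snd
  refine induces_of_bd hB σ₂_add fun b => ?_
  rw [preimage_bd (φ := shiftIso ht) ht hB (hπ b), cls_bd]
  congr 1
  rcases b with k | i | i
  · revert k; decide
  · revert i; decide
  · revert i; decide

/-! ### The shear that induces the reflection in the first root -/

theorem p_add_ne_zero (t : ℂ) : p + con t ≠ 0 := (good_shift t).y_ne_zero

theorem good_shear (a t : ℂ) : Good ⟨q + con a / (p + con t), p⟩ := by
  set ch : Chart := ⟨q + con a / (p + con t), p⟩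
  have hx := x_mem_adjoin (ch := ch)
  have hy := y_mem_adjoin (ch := ch)
  have hc (c) := con_mem_adjoin c (Set.range ![ch.x, ch.y])
  refine good_U₀₀.of_mem ?_ hy
  have := sub_mem hx (div_mem (hc a) (add_mem hy (hc t)))
  rwa [show ch.x - con a / (ch.y + con t) = q from add_sub_cancel_right _ _] at this

/-- The automorphism `(q, p) ↦ (q + a / (p + t), p)`. -/
def shear (a t : ℂ) : K ≃ₐ[ℂ] K := (good_shear a t).aut

theorem shear_q (a t : ℂ) : shear a t q = q + con a / (p + con t) := (good_shear a t).aut_q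
theorem shear_p (a t : ℂ) : shear a t p = p := (good_shear a t).aut_p

theorem shear_shear (a t : ℂ) (f : K) : shear a t (shear (-a) t f) = f := by
  have : (shear (-a) t).trans (shear a t) = AlgEquiv.refl := by
    apply algEquiv_ext
    · simp only [AlgEquiv.trans_apply, shear_q, shear_p, map_con, con_neg, map_add, map_div₀,
        map_neg, AlgEquiv.coe_refl, id]
      ring
    · simp [shear_p]
  exact DFunLike.congr_fun this f

theorem shear_shear' (a t : ℂ) (f : K) : shear (-a) t (shear a t f) = f := by
  simpa using shear_shear (-a) t f

/-- The action of `r 0` on the parameters. -/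
def shearParams (A : Params) : Params :=
  ⟨![-A.a 0, A.a 0 + A.a 1, A.a 2, A.a 0 + A.a 3], A.t⟩

theorem shearParams_shearParams (A : Params) : shearParams (shearParams A) = A := by
  refine Params.ext (funext fun i => ?_) rfl
  fin_cases i <;> simp [shearParams]

section values
variable {O : Subring K} {a t v : ℂ}

theorem shear_val_q {c : ℂ} (hO : IsPoint O) (h : HasValue O (p + con t)⁻¹ v)
    (hq : HasValue O q c) : HasValue O (shear a t q) (c + a * v) := by
  rw [shear_q, div_eq_mul_inv]
  exact hO.add hq (hO.mul (hO.con a) h)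

theorem shear_val_inv_q (hO : IsPoint O) (h : HasValue O (p + con t)⁻¹ v)
    (hq : HasValue O q⁻¹ 0) : HasValue O (shear a t q)⁻¹ 0 := by
  rw [shear_q, div_eq_mul_inv]
  exact hO.inv_add (tx_ne_zero 0) hq (hO.mul (hO.con a) h)

theorem val_inv_of_val {d : ℂ} (hO : IsPoint O) (h : HasValue O p d) (hd : d ≠ -t) :
    HasValue O (p + con t)⁻¹ (d + t)⁻¹ :=
  hO.inv (hO.add h (hO.con t)) (by rwa [ne_eq, add_eq_zero_iff_eq_neg])

theorem val_inv_of_inv (hO : IsPoint O) (h : HasValue O p⁻¹ 0) : HasValue O (p + con t)⁻¹ 0 :=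
  hO.inv_add (tx_ne_zero 1) h (hO.con t)

end values

/-- The shear respects the three towers away from the fibre `p = -t`. It moves the second centres of
the two towers over `p = ∞` by `a₀`, because `q p` becomes `q p + a₀ p / (p + t)`. -/
theorem shear_towerValues {A : Params} (ht : A.t ≠ 0) (i : Fin 4) (hi : i ≠ 0) :
    TowerValues A (shearParams A) i i (shear (A.a 0) A.t) := by
  have odd (i : Fin 4) (hx : tx i = p) (hy : ty i = q) (hs : ts (shearParams A) i = ts A i)
      (he : te (shearParams A) i = A.a 0 + te A i) :
      TowerValues A (shearParams A) i i (shear (A.a 0) A.t) := by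
    have hp {O} (hO : Over A i O) : HasValue O p⁻¹ 0 := hx ▸ hO.2.1
    refine ⟨fun O hO => ?_, fun O hO => ?_, ?_⟩
    · rw [hx, shear_p]; exact hp hO
    · rw [hy, hs]
      have := hO.2.2
      rw [hy] at this
      exact (shear_val_q hO.1 (val_inv_of_inv hO.1 (hp hO)) this).congr rfl (by simp)
    · have hov := over_nearPt A i
      have hO := hov.1
      -- The correction term `a₀ p / (p + t)` tends to `a₀` as `p` tends to infinity.
      have h1 : HasValue (nearPt A i) (con (A.a 0) * (1 + con A.t * p⁻¹)⁻¹) (A.a 0) :=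
        (hO.mul (hO.con _) (hO.inv ((hO.add (hO.con 1) (hO.mul (hO.con A.t) (hp hov))).congr
          (by simp) (by simp : (1 : ℂ) + A.t * 0 = 1)) one_ne_zero)).congr rfl (by simp)
      refine (hO.add h1 (nearPt_tu A i)).congr ?_ he.symm
      have p0 : p ≠ 0 := tx_ne_zero 1
      have e : 1 + con A.t * p⁻¹ = (p + con A.t) * p⁻¹ := by field_simp
      rw [tu, tu, map_mul, map_sub, hx, hy, shear_q, shear_p, map_con, hs, e]
      have := p_add_ne_zero A.t
      field_simp
      ring
  fin_cases i
  · exact absurd rfl hi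
  · exact odd 1 rfl rfl rfl rfl
  · have hf {O} (hO : Over A 2 O) := val_inv_of_val (t := A.t) hO.1 (d := 0) hO.2.2
      (by simpa using ht)
    refine ⟨fun O hO => ?_, fun O hO => ?_, ?_⟩
    · exact shear_val_inv_q hO.1 (hf hO) hO.2.1
    · change HasValue O (shear _ _ p) _
      rw [shear_p]; exact hO.2.2
    · have hov := over_nearPt A 2
      have hO := hov.1
      have hp : HasValue (nearPt A 2) p 0 := hov.2.2
      refine (hO.add (nearPt_tu A 2) (hO.mul hp (hO.mul (hO.con (A.a 0)) (hf hov)))).congr ?_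
        (by simp [te, shearParams])
      simp only [tu, tx, ty, map_mul, map_sub, map_con, ts]
      simp [shear_q, shear_p]
      ring
  · exact odd 3 rfl rfl rfl rfl

theorem shear_towerMatch {A : Params} (ht : A.t ≠ 0) (i : Fin 4) (hi : i ≠ 0) :
    TowerMatch A (shearParams A) i i (shear (A.a 0) A.t) := by
  have h' := shear_towerValues (A := shearParams A) ht i hi
  rw [shearParams_shearParams] at h'
  exact (shear_towerValues ht i hi).towerMatch (shear_shear _ _) h'

section fibre
variable (A : Params) {a : ℂ} (ha : a ≠ 0)

theorem tu_zero : tu A 0 = (p + con A.t) * q := by simp [tu, tx, ty, ts, con_neg]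

theorem shear_tu (a : ℂ) : shear a A.t (tu A 0) = tu A 0 + con a := by
  have := p_add_ne_zero A.t
  rw [tu_zero, map_mul, map_add, shear_p, shear_q, map_con]; field_simp

theorem tu_ne_zero : tu A 0 ≠ 0 := by rw [← tW_x]; exact (good_tW A 0).x_ne_zero

theorem tu_add_ne_zero (a : ℂ) : tu A 0 + con a ≠ 0 := by
  have := (good_tW A 0).x_sub_ne_zero (-a)
  rwa [tW_x, con_neg, sub_neg_eq_add] at this

theorem shear_inv_q (a : ℂ) :
    (shear a A.t q)⁻¹ = q⁻¹ * (tu A 0 * (tu A 0 + con a)⁻¹) := by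
  have h0 := p_add_ne_zero A.t
  have h1 := tu_add_ne_zero A a
  have h2 : q ≠ 0 := tx_ne_zero 0
  have e : shear a A.t q = (tu A 0 + con a) * (p + con A.t)⁻¹ := by
    rw [shear_q, tu_zero]; field_simp
  rw [e, tu_zero] at *
  field_simp

/-- The shear translates the exceptional curve over `b₁`. -/
theorem shear_W {e : ℂ} (he : e ≠ 0) (hea : e ≠ a) :
    ((tW A 0).localRing e 0).map (shear a A.t : K →+* K) = (tW A 0).localRing (e - a) 0 := by
  have hW := good_tW A 0
  have key {b c : ℂ} (hb : c + b ≠ 0) :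
      HasValue ((tW A 0).localRing c 0) (shear b A.t (tW A 0).x) (c + b) ∧
      HasValue ((tW A 0).localRing c 0) (shear b A.t (tW A 0).y) 0 := by
    have hp := hW.isPoint c 0
    have hx := hW.hasValue_x c 0
    have hy := hW.hasValue_y c 0
    rw [tW_x] at hx ⊢
    rw [tW_y] at hy ⊢
    have h1 := hp.add hx (hp.con b)
    refine ⟨by rwa [shear_tu], ?_⟩
    rw [map_inv₀]
    exact (hp.mul hy (hp.mul hx (hp.inv h1 hb))).congr (shear_inv_q A b).symm (by simp)
  have h1 := key (c := e - a) (b := a) (by simpa using he)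
  have h2 := key (c := e) (b := -a) (by rwa [← sub_eq_add_neg, sub_ne_zero])
  rw [sub_add_cancel] at h1
  rw [← sub_eq_add_neg] at h2
  exact hW.map_localRing_eq hW (shear_shear a A.t) h1.1 h1.2 h2.1 h2.2

include ha in
/-- The shear separates the fibre `p = -t` from the exceptional curve over `b₁`. -/
theorem shear_W_zero : ((tW A 0).localRing 0 0).map (shear a A.t : K →+* K) =
    ((tW A 0).blowUp₀ (-a) 0).localRing 0 0 := by
  have hW := good_tW A 0
  have hY := hW.blowUp₀ (-a) 0
  have hp := hY.isPoint 0 0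
  have hp' := hW.isPoint 0 0
  have h1 := tu_add_ne_zero A a
  have h2 := tu_ne_zero A
  have eX : ((tW A 0).blowUp₀ (-a) 0).x = q⁻¹ / (tu A 0 + con a) := by
    simp [Chart.blowUp₀, tW_x, tW_y, con_neg, tx]
  have eY : ((tW A 0).blowUp₀ (-a) 0).y = tu A 0 + con a := by
    simp [Chart.blowUp₀, tW_x, con_neg]
  have hX := hY.hasValue_x 0 0
  have hYy := hY.hasValue_y 0 0
  have hu := hW.blowUp₀_val_x (-a) 0 0
  have hx := hW.hasValue_x 0 0
  have hy := hW.hasValue_y 0 0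
  rw [eX] at hX
  rw [eY] at hYy
  rw [tW_x] at hu hx
  rw [tW_y] at hy
  refine hW.map_localRing_eq hY (shear_shear a A.t) ?_ ?_ ?_ ?_
  · rw [tW_x, shear_tu]; exact hYy
  · rw [tW_y, map_inv₀]
    refine (hp.mul hX hu).congr ?_ (by simp)
    change _ = (shear a A.t q)⁻¹
    rw [shear_inv_q]; field_simp
  · have h3 : (0 : ℂ) - a ≠ 0 := by simpa using ha
    refine (hp'.mul hy (hp'.inv (hp'.sub hx (hp'.con a)) h3)).congr ?_ (by simp)
    have h4 := tu_add_ne_zero A (-a)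
    rw [con_neg, ← sub_eq_add_neg] at h4
    rw [eX, map_div₀, map_inv₀, shear_inv_q, map_add, shear_tu, map_con, con_neg]
    simp only [← sub_eq_add_neg, sub_add_cancel]
    change (q)⁻¹ * _ = _
    field_simp
  · rw [eY, map_add, shear_tu, map_con]
    exact hx.congr (by rw [con_neg]; ring) rfl

include ha in
/-- The shear maps the fibre `p = -t` to the exceptional curve over `b₂`. -/
theorem shear_U₀₀ (c : ℂ) : (U₀₀.localRing c (-A.t)).map (shear a A.t : K →+* K) =
    ((tW A 0).blowUp₁ (-a) 0).localRing (-a * c) 0 := by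
  have hW := good_tW A 0
  have hY := hW.blowUp₁ (-a) 0
  have hp := hY.isPoint (-a * c) 0
  have hp' := good_U₀₀.isPoint c (-A.t)
  have h0 := p_add_ne_zero A.t
  have h2 := tu_ne_zero A
  have hq0 : q ≠ 0 := tx_ne_zero 0
  have eX : ((tW A 0).blowUp₁ (-a) 0).x = (tu A 0 + con a) * q := by
    simp [Chart.blowUp₁, tW_x, tW_y, con_neg, tx]
  have eY : ((tW A 0).blowUp₁ (-a) 0).y = q⁻¹ := by
    simp [Chart.blowUp₁, tW_y, tx]
  have hX := hY.hasValue_x (-a * c) 0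
  have hYy := hY.hasValue_y (-a * c) 0
  have hu := hW.blowUp₁_val_x (-a) 0 (-a * c)
  have hx : HasValue _ q c := good_U₀₀.hasValue_x c (-A.t)
  have hy : HasValue _ p (-A.t) := good_U₀₀.hasValue_y c (-A.t)
  have hpt := hp'.add hy (hp'.con A.t)
  have hu' := hp'.mul hpt hx
  rw [← tu_zero] at hu'
  rw [eX] at hX
  rw [eY] at hYy
  rw [tW_x] at hu
  refine good_U₀₀.map_localRing_eq hY (shear_shear a A.t) ?_ ?_ ?_ ?_
  · refine (hp.div hX hu (by simpa using ha)).congr ?_ (by field_simp)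
    change _ = shear a A.t q
    rw [shear_q, tu_zero]; field_simp
  · change HasValue _ (shear a A.t p) _
    rw [shear_p]
    refine (hp.sub (hp.mul hu hYy) (hp.con A.t)).congr ?_ (by simp)
    rw [tu_zero]; field_simp; ring
  · refine (hp'.mul (hp'.sub hu' (hp'.con a)) hx).congr ?_ (by simp)
    rw [eX, map_mul, map_add, shear_tu, map_con, shear_q, con_neg, tu_zero]; field_simp; ring
  · have h3 : (-A.t + A.t) * c + -a ≠ 0 := by simpa using ha
    have := hp'.mul hpt (hp'.inv (hp'.add hu' (hp'.con (-a))) h3)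
    refine this.congr ?_ (by simp)
    rw [eY, map_inv₀, shear_inv_q]
    conv_rhs => rw [← mul_assoc]
    congr 1
    rw [tu_zero]; field_simp

/-- The shear fixes the point of the fibre `p = -t` at infinity. -/
theorem shear_infinity : (((tb 0).blowUp₁ 0 (-A.t)).localRing 0 0).map (shear a A.t : K →+* K) =
    ((tb 0).blowUp₁ 0 (-A.t)).localRing 0 0 := by
  have hZ := (good_tb 0).blowUp₁ 0 (-A.t)
  have hp := hZ.isPoint 0 0
  have hq0 : q ≠ 0 := tx_ne_zero 0
  have h0 := p_add_ne_zero A.t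
  have eX : ((tb 0).blowUp₁ 0 (-A.t)).x = (tu A 0)⁻¹ := by
    simp [Chart.blowUp₁, tb, tx, ty, con_neg, tu_zero]; field_simp
  have eY : ((tb 0).blowUp₁ 0 (-A.t)).y = p + con A.t := by
    simp [Chart.blowUp₁, tb, ty, con_neg]
  have hX := hZ.hasValue_x 0 0
  have hY := hZ.hasValue_y 0 0
  have key (b : ℂ) : HasValue (((tb 0).blowUp₁ 0 (-A.t)).localRing 0 0)
      (shear b A.t ((tb 0).blowUp₁ 0 (-A.t)).x) 0 ∧
      HasValue (((tb 0).blowUp₁ 0 (-A.t)).localRing 0 0)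
      (shear b A.t ((tb 0).blowUp₁ 0 (-A.t)).y) 0 := by
    rw [eX] at hX ⊢
    rw [eY] at hY ⊢
    constructor
    · rw [map_inv₀, shear_tu]
      exact hp.inv_add (tu_ne_zero A) hX (hp.con b)
    · rwa [map_add, shear_p, map_con]
  exact hZ.map_localRing_eq hZ (shear_shear a A.t) (key _).1 (key _).2 (key _).1 (key _).2

end fibre

/-- The points of an exceptional curve, parametrised by its second chart. -/
theorem Exc.cases {ch : Chart} (hch : ch.Good) {c d : ℂ} {O : Subring K} (hO : O ∈ Exc ch c d) :
    (∃ e, O = (ch.blowUp₁ c d).localRing e 0) ∨ O = (ch.blowUp₀ c d).localRing 0 0 := by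
  obtain ⟨e, rfl | rfl⟩ := hO
  · by_cases he : e = 0
    · subst he; exact Or.inr rfl
    · left
      have h := hch.blowUp₀ c d
      have h' := hch.blowUp₁ c d
      have hp := h.isPoint e 0
      have hp' := h'.isPoint e⁻¹ 0
      have hx := hch.x_sub_ne_zero c
      have hy := hch.y_sub_ne_zero d
      refine ⟨e⁻¹, h.localRing_eq h' ?_ ?_ ?_ ?_⟩
      · exact (hp.inv (h.hasValue_x e 0) he).congr (inv_div _ _) rfl
      · exact (hp.mul (h.hasValue_x e 0) (h.hasValue_y e 0)).congr
          (by simp only [Chart.blowUp₀, Chart.blowUp₁]; field_simp) (by simp)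
      · exact (hp'.inv (h'.hasValue_x _ 0) (inv_ne_zero he)).congr (inv_div _ _) (inv_inv e)
      · exact (hp'.mul (h'.hasValue_x _ 0) (h'.hasValue_y _ 0)).congr
          (by simp only [Chart.blowUp₀, Chart.blowUp₁]; field_simp) (by simp)
  · exact Or.inl ⟨e, rfl⟩

/-- The shear maps points to points: it is regular over the complement of the fibre `p = -t`, maps
the first exceptional curve of the tower `0` to itself and exchanges the second one with the fibre.
-/
theorem shear_mem_S_of_ne_zero {A : Params} (ht : A.t ≠ 0) (ha : A.a 0 ≠ 0) {O : Subring K}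
    (hO : O ∈ S (shearParams A)) : O.map (shear (A.a 0) A.t : K →+* K) ∈ S A := by
  set σ := shear (A.a 0) A.t with hσ
  have hinv := shear_shear (A.a 0) A.t
  have hmap {O O' : Subring K} (h : O'.map (shear (-A.a 0) A.t : K →+* K) = O) :
      O.map (σ : K →+* K) = O' := by rw [← h, map_map_of_inverse hinv]
  have inE {O} (h : O ∈ Exc (tW A 0) (-A.a 0) 0) : O ∈ S A := (mem_S ht).2 (Or.inr ⟨0, Or.inr h⟩)
  rcases (mem_S (A := shearParams A) ht).1 hO with ⟨hP, hb⟩ | ⟨i, hi⟩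
  · -- Away from the fibre `p = -t` the shear is an automorphism of the product of two lines.
    have reg {O' : Subring K} {v : ℂ} (hO' : IsPoint O') (hP' : O' ∈ P1P1)
        (hv : HasValue O' (p + con A.t)⁻¹ v) (h : O.map (σ : K →+* K) = O') :
        O.map (σ : K →+* K) ∈ S A := by
      refine (mem_S ht).2 (Or.inl ⟨h ▸ hP', fun i hi => ?_⟩)
      by_cases h0 : i = 0
      · subst h0
        rw [h.symm.trans hi] at hv hO'
        have h1 : HasValue (basePt A 0) p (-A.t) := (over_basePt A 0).2.2
        have h2 := hO'.mul (hO'.add h1 (hO'.con A.t)) hv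
        rw [mul_inv_cancel₀ (p_add_ne_zero _)] at h2
        exact one_ne_zero (hO'.unique (by simpa using hO'.con 1) (h2.congr rfl (by simp)))
      · exact hb i (map_injective σ (hi.trans (shear_towerMatch ht i h0).base.symm))
    have regmap {ch : Chart} (hch : ch.Good) {c d c' v : ℂ}
        (hv : ∀ c, HasValue (ch.localRing c d) (p + con A.t)⁻¹ v) (hy : ch.y = p ∨ ch.y = p⁻¹)
        (h1 : HasValue (ch.localRing c' d) (σ ch.x) c)
        (h2 : HasValue (ch.localRing c d) (shear (-A.a 0) A.t ch.x) c')
        (hP' : ch.localRing c' d ∈ P1P1) (hc : O = ch.localRing c d) :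
        O.map (σ : K →+* K) ∈ S A := by
      have hyσ (b : ℂ) : shear b A.t ch.y = ch.y := by
        rcases hy with hy | hy <;> rw [hy]
        · exact shear_p _ _
        · rw [map_inv₀, shear_p]
      refine reg (hch.isPoint c' d) hP' (hv c') (hc ▸ hch.map_localRing_eq hch hinv h1 ?_ h2 ?_)
      · rw [hyσ]; exact hch.hasValue_y _ _
      · rw [hyσ]; exact hch.hasValue_y _ _
    have inv_q {ch : Chart} (hch : ch.Good) (hx : ch.x = q⁻¹) {d v : ℂ} (b : ℂ)
        (hv : ∀ c, HasValue (ch.localRing c d) (p + con A.t)⁻¹ v) :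
        HasValue (ch.localRing 0 d) (shear b A.t ch.x) 0 := by
      have := hch.hasValue_x 0 d
      rw [hx] at this ⊢
      rw [map_inv₀]
      exact shear_val_inv_q (hch.isPoint _ _) (hv 0) this
    have plain_q {ch : Chart} (hch : ch.Good) (hx : ch.x = q) {c d v : ℂ} (b : ℂ)
        (hv : ∀ c, HasValue (ch.localRing c d) (p + con A.t)⁻¹ v) :
        HasValue (ch.localRing c d) (shear b A.t ch.x) (c + b * v) := by
      have := hch.hasValue_x c d
      rw [hx] at this ⊢
      exact shear_val_q (hch.isPoint _ _) (hv c) this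
    rcases mem_P1P1.1 hP with ⟨c, d, h⟩ | ⟨d, h⟩ | ⟨c, h⟩ | h
    · by_cases hd : d = -A.t
      · subst hd
        rw [h, hσ, shear_U₀₀ A ha]
        exact inE ⟨_, Or.inr rfl⟩
      · have hv (c) := val_inv_of_val (good_U₀₀.isPoint c d) (good_U₀₀.hasValue_y c d) hd
        refine regmap good_U₀₀ hv (Or.inl rfl) ?_ (plain_q good_U₀₀ rfl _ hv)
          (mem_P1P1.2 (Or.inl ⟨_, _, rfl⟩)) h
        exact (plain_q good_U₀₀ rfl _ hv).congr rfl (by ring)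
    · by_cases hd : d = -A.t
      · subst hd; exact absurd h (hb 0)
      · have hv (c) := val_inv_of_val (good_U₁₀.isPoint c d) (good_U₁₀.hasValue_y c d) hd
        exact regmap good_U₁₀ hv (Or.inl rfl) (inv_q good_U₁₀ rfl _ hv) (inv_q good_U₁₀ rfl _ hv)
          (mem_P1P1.2 (Or.inr (Or.inl ⟨_, rfl⟩))) h
    · have hv (c) := val_inv_of_inv (t := A.t) (good_U₀₁.isPoint c 0) (good_U₀₁.hasValue_y c 0)
      refine regmap good_U₀₁ hv (Or.inr rfl) ?_ (plain_q good_U₀₁ rfl _ hv)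
        (mem_P1P1.2 (Or.inr (Or.inr (Or.inl ⟨_, rfl⟩)))) h
      exact (plain_q good_U₀₁ rfl _ hv).congr rfl (by ring)
    · have hv (c) := val_inv_of_inv (t := A.t) (good_U₁₁.isPoint c 0) (good_U₁₁.hasValue_y c 0)
      exact regmap good_U₁₁ hv (Or.inr rfl) (inv_q good_U₁₁ rfl _ hv) (inv_q good_U₁₁ rfl _ hv)
        (mem_P1P1.2 (Or.inr (Or.inr (Or.inr rfl)))) h
  · by_cases h0 : i = 0
    · subst h0
      have hA' : te (shearParams A) 0 = A.a 0 := neg_neg _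
      have onW {e : ℂ} (he : O = (tW A 0).localRing e 0) (hne : e ≠ A.a 0) :
          O.map (σ : K →+* K) ∈ S A := by
        by_cases h0 : e = 0
        · subst h0
          rw [he, hσ, shear_W_zero A ha]
          exact inE ⟨_, Or.inl rfl⟩
        · rw [he, hσ, shear_W A h0 hne]
          exact (mem_S ht).2 (Or.inr ⟨0, mem_Tower_fst (i := 0) (fun h => h0 (by
            have : e - A.a 0 = -A.a 0 := h
            linear_combination this))⟩)
      rcases hi with ⟨hi, hn⟩ | hi
      · rcases Exc.cases (good_tb 0).swap ((Exc_swap _ _ _).symm ▸ hi) with ⟨e, he⟩ | he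
        · refine onW he fun h => hn ?_
          rw [he, h, nearPt, hA']; rfl
        · have he' : O = ((tb 0).blowUp₁ 0 (-A.t)).localRing 0 0 := he
          rw [he', hσ, shear_infinity]
          refine (mem_S ht).2 (Or.inr ⟨0, Or.inl ⟨⟨0, Or.inr rfl⟩, fun h => ?_⟩⟩)
          have h' : ((tb 0).blowUp₁ 0 (-A.t)).localRing 0 0 = nearPt A 0 := h
          have hp := isPoint_nearPt A 0
          have h1 := ((good_tb 0).blowUp₁ 0 (-A.t)).hasValue_x 0 0
          rw [h'] at h1
          refine not_hasValue_of_inv hp (tu_ne_zero A) (h1.congr ?_ rfl) (nearPt_tu A 0)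
          have := p_add_ne_zero A.t
          have hq0 : q ≠ 0 := tx_ne_zero 0
          simp [Chart.blowUp₁, tb, tx, ty, con_neg, tu_zero]; field_simp
      · rw [hA'] at hi
        have hi' : O ∈ Exc (tW A 0) (A.a 0) 0 := hi
        rcases Exc.cases (good_tW A 0) hi' with ⟨e, he⟩ | he
        · have h1 := shear_U₀₀ A (a := -A.a 0) (by simpa using ha) (e / A.a 0)
          rw [neg_neg, mul_div_cancel₀ _ ha, ← he] at h1
          rw [hmap h1]
          exact U₀₀_mem_S ht _ _
        · have h1 := shear_W_zero A (a := -A.a 0) (by simpa using ha)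
          rw [neg_neg, ← he] at h1
          rw [hmap h1]
          refine (mem_S ht).2 (Or.inr ⟨0, mem_Tower_fst (i := 0) fun h => ha ?_⟩)
          exact neg_eq_zero.1 (Eq.symm h)
    · have h := shear_towerMatch ht i h0
      exact (mem_S ht).2 (Or.inr ⟨i, map_mem_Tower h.base h.near hi⟩)

/-- For `a = 0` the fibre `p = -t` is not exchanged with an exceptional curve. -/
theorem shear_zero (t : ℂ) : shear 0 t = AlgEquiv.refl := by
  apply algEquiv_ext <;> simp [shear_q, shear_p]

theorem shear_mem_S {A : Params} (ht : A.t ≠ 0) {O : Subring K}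
    (hO : O ∈ S (shearParams A)) : O.map (shear (A.a 0) A.t : K →+* K) ∈ S A := by
  by_cases ha : A.a 0 = 0
  · have hA : shearParams A = A := by
      refine Params.ext (funext fun i => ?_) rfl
      fin_cases i <;> simp [shearParams, ha]
    rw [ha, shear_zero]
    rw [hA] at hO
    exact (Subring.map_id O).symm ▸ hO
  · exact shear_mem_S_of_ne_zero ht ha hO

/-- The isomorphism of surfaces given by the shear. -/
def shearIso {A : Params} (ht : A.t ≠ 0) : SurfaceIso (S A) (S (shearParams A)) :=
  SurfaceIso.ofInverse (shear (A.a 0) A.t) (shear (-A.a 0) A.t) (shear_shear' _ _)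
    (fun _ => shear_mem_S ht) fun O hO => shear_mem_S (A := shearParams A) ht
      (by rwa [shearParams_shearParams])

/-- All boundary curves are preserved, except that the second exceptional curve of the tower `0` is
replaced by the line through its base point; so does `r 0`, as the class of this line is
`α 0 + E₂ 0`. -/
theorem shearIso_induces {A : Params} (ht : A.t ≠ 0) (ha : A.a 0 ≠ 0) :
    Induces (r 0) A (shearParams A) (shearIso ht) := by
  have hB : (shearParams A).t ≠ 0 := ht
  have hW := good_tW A 0
  have hta : te A 0 ≠ 0 := neg_ne_zero.2 ha
  have fixed (b : Bdry) (hb : b ≠ .snd 0) :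
      (bdVal (shearParams A) b).comap ((shear (A.a 0) A.t).symm : K →+* K) = bdVal A b := by
    cases b with
    | fib k =>
      fin_cases k
      · have hov := over_basePt A 2
        have hO := hov.1
        have hf := val_inv_of_val (t := A.t) hO (d := 0) hov.2.2 (by simpa using ht)
        refine fibVal_comap (k := 0) (l := 0) (shear_towerMatch ht 2 (by decide)).base (v := 1)
          (g := 1 + con (A.a 0) * (p + con A.t)⁻¹ * q⁻¹) ?_ ?_
        · exact (hO.add (hO.con 1) (hO.mul (hO.mul (hO.con (A.a 0)) hf) hov.2.1)).congr
            (by simp [tx]) (by simp)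
        · have h0 : q ≠ 0 := tx_ne_zero 0
          have h1 := (good_shear (A.a 0) A.t).x_ne_zero
          simp only [show tx (Fin.castLE (by decide) (0 : Fin 2)) = q from rfl]
          rw [map_inv₀, shear_q]
          refine (eq_mul_inv_iff_mul_eq₀ h1).2 ?_
          simp only [div_eq_mul_inv]; field_simp
      · refine fibVal_comap (k := 1) (l := 1) (shear_towerMatch ht 1 (by decide)).base
          ((isPoint_basePt A 1).con 1) ?_
        simp [tx, shear_p]
    | fst i =>
      by_cases hi : i = 0
      · subst hi
        -- The point `u = 2 a₀` of the first exceptional curve is moved to `u = a₀`; neither of them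
        -- is the point `0` of the line or the respective second centre.
        have h := shear_W A (e := 2 * A.a 0) (a := A.a 0) (by simpa using ha)
          (fun h => ha (by linear_combination h))
        rw [show 2 * A.a 0 - A.a 0 = A.a 0 by ring] at h
        have hO := hW.isPoint (A.a 0) 0
        have hu := hW.hasValue_x (A.a 0) 0
        rw [tW_x] at hu
        refine comap_curveVal_eq hW hW h (irreducible_X 1) (irreducible_X 1) (by simp)
          (hO.div (hO.add hu (hO.con (A.a 0))) hu ha) ?_
        rw [poly_X1, tW_y, map_inv₀]
        change q⁻¹ = _ * (shear _ _ q)⁻¹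
        rw [shear_inv_q]
        have h1 := tu_ne_zero A
        have h2 := tu_add_ne_zero A (A.a 0)
        field_simp
      · exact (shear_towerMatch ht i hi).fst
    | snd i =>
      exact (shear_towerMatch ht i fun h => hb (h ▸ rfl)).snd
  have moved : (bdVal (shearParams A) (.snd 0)).comap ((shear (A.a 0) A.t).symm : K →+* K) =
      (towerLine A ht 0).ring := by
    have h1 := shear_W_zero A (a := -A.a 0) (by simpa using ha)
    rw [neg_neg] at h1
    have h2 := map_map_of_inverse (shear_shear (A.a 0) A.t) ((tW A 0).localRing 0 0)
    rw [h1] at h2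
    have hv : te (shearParams A) 0 = A.a 0 := neg_neg _
    rw [towerLine_ring, bdVal]
    simp only [hv]
    refine comap_curveVal_eq (hW.blowUp₀ (A.a 0) 0) hW h2 (irreducible_X 1) (irreducible_X 0)
      (by simp) ((hW.isPoint 0 0).con 1) ?_
    simp [Chart.blowUp₀, tW_x, map_con, shear_tu]
  refine induces_of_bd hB (r_add 0) fun b => ?_
  by_cases hb : b = .snd 0
  · subst hb
    have : (shearIso ht).preimage (bd (shearParams A) hB (.snd 0)) = towerLine A ht 0 :=
      PrimeDivisor.ext moved
    rw [this, cls_towerLine, if_neg hta]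
    exact congrArg (ι A) (by decide)
  · rw [preimage_bd (φ := shearIso ht) ht hB (fixed b hb), cls_bd]
    congr 1
    rcases b with k | i | i
    · clear hb; revert k; decide
    · clear hb; revert i; decide
    · have hi : i ≠ 0 := fun h => hb (h ▸ rfl)
      clear hb; revert i; decide

/-! ### The six generators -/

theorem lattice_fun_ext {w w' : PicLattice → PicLattice} (hw : ∀ F G, w (F + G) = w F + w G)
    (hw' : ∀ F G, w' (F + G) = w' F + w' G) (h : ∀ b, w (bdClass b) = w' (bdClass b)) : w = w' := by
  have : AddMonoidHom.mk' w hw = AddMonoidHom.mk' w' hw' := hom_ext h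
  exact funext fun F => DFunLike.congr_fun this F

theorem conj_add {s u : PicLattice → PicLattice} (hs : ∀ F G, s (F + G) = s F + s G)
    (hu : ∀ F G, u (F + G) = u F + u G) (F G : PicLattice) :
    (s ∘ u ∘ s) (F + G) = (s ∘ u ∘ s) F + (s ∘ u ∘ s) G := by simp [hs, hu]

/-- The reflections are conjugate under the diagram automorphisms. -/
theorem r_two : σ₂ ∘ r 0 ∘ σ₂ = r 2 := by
  refine lattice_fun_ext (conj_add σ₂_add (r_add 0)) (r_add 2) ?_
  rintro (k | i | i)
  · revert k; decide
  · revert i; decide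
  · revert i; decide

theorem r_three : σ₁ ∘ r 0 ∘ σ₁ = r 3 := by
  refine lattice_fun_ext (conj_add σ₁_add (r_add 0)) (r_add 3) ?_
  rintro (k | i | i)
  · revert k; decide
  · revert i; decide
  · revert i; decide

theorem r_one : σ₁ ∘ r 2 ∘ σ₁ = r 1 := by
  refine lattice_fun_ext (conj_add σ₁_add (r_add 2)) (r_add 1) ?_
  rintro (k | i | i)
  · revert k; decide
  · revert i; decide
  · revert i; decide

/-- `(q, p) ↦ (q', p')` lifts to an isomorphism, inducing `w` under the hypothesis `nd`. -/
def Lifts (w : PicLattice → PicLattice) (nd : Prop) (A B : Params) (q' p' : K) : Prop :=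
  ∃ φ : SurfaceIso (S A) (S B), φ.pull q = q' ∧ φ.pull p = p' ∧ (nd → Induces w A B φ)

/-- Composition of lifts; the coordinates are composed by pulling `q₂`, `p₂` back along the first
map. -/
theorem Lifts.comp {w w' : PicLattice → PicLattice} {nd nd' : Prop} {A B C : Params}
    {q₁ p₁ q₂ p₂ q₃ p₃ : K} (h : Lifts w nd A B q₁ p₁) (h' : Lifts w' nd' B C q₂ p₂)
    (hq : ∀ σ : K ≃ₐ[ℂ] K, σ q = q₁ → σ p = p₁ → σ q₂ = q₃)
    (hp : ∀ σ : K ≃ₐ[ℂ] K, σ q = q₁ → σ p = p₁ → σ p₂ = p₃) :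
    Lifts (w ∘ w') (nd ∧ nd') A C q₃ p₃ := by
  obtain ⟨φ, h1, h2, h3⟩ := h
  obtain ⟨ψ, h4, h5, h6⟩ := h'
  refine ⟨φ.trans ψ, ?_, ?_, fun hn => (h3 hn.1).trans (h6 hn.2)⟩
  · rw [← hq _ h1 h2, ← h4]; rfl
  · rw [← hp _ h1 h2, ← h5]; rfl

section lifts
variable {A : Params} (ht : A.t ≠ 0)
include ht

theorem lifts_σ₁ : Lifts σ₁ True A (rotParams A) (-(p / con A.t)) (q * con A.t) :=
  ⟨rotIso ht, rot_q ht, rot_p ht, fun _ => rotIso_induces ht⟩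

theorem lifts_σ₂ : Lifts σ₂ True A (shiftParams A) q (p + con A.t) :=
  ⟨shiftIso ht, shift_q _, shift_p _, fun _ => shiftIso_induces ht⟩

theorem lifts_r₀ : Lifts (r 0) (A.a 0 ≠ 0) A (shearParams A) (q + con (A.a 0) / (p + con A.t)) p :=
  ⟨shearIso ht, shear_q _ _, shear_p _ _, shearIso_induces ht⟩

theorem lifts_r₂ : Lifts (r 2) (A.a 2 ≠ 0) A (shiftParams (shearParams (shiftParams A)))
    (q + con (A.a 2) / p) p := by
  have ht' : -A.t ≠ 0 := neg_ne_zero.2 ht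
  have h1 := lifts_σ₂ ht
  have h2 : Lifts (r 0) (A.a 2 ≠ 0) (shiftParams A) (shearParams (shiftParams A))
    (q + con (A.a 2) / (p + con (-A.t))) p := lifts_r₀ (A := shiftParams A) ht'
  have h3 : Lifts σ₂ True (shearParams (shiftParams A)) _ q (p + con (-A.t)) := lifts_σ₂ ht'
  have h4 := h1.comp (h2.comp h3 (q₃ := q + con (A.a 2) / (p + con (-A.t))) (p₃ := p + con (-A.t))
    (fun σ hq _ => hq) (fun σ _ hp => by rw [map_add, map_con, hp]))
    (q₃ := q + con (A.a 2) / p) (p₃ := p)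
    (fun σ hq hp => by rw [map_add, map_div₀, map_add, map_con, map_con, hq, hp, con_neg,
      add_neg_cancel_right])
    (fun σ _ hp => by rw [map_add, map_con, hp, con_neg, add_neg_cancel_right])
  rwa [r_two, true_and, and_true] at h4

theorem lifts_r₃ : Lifts (r 3) (A.a 3 ≠ 0) A (rotParams (shearParams (rotParams A)))
    q (p - con (A.a 3) / (q - 1)) := by
  have ht' : -A.t ≠ 0 := neg_ne_zero.2 ht
  have h0 := con_ne_zero ht
  have h1 := lifts_σ₁ ht
  have h2 : Lifts (r 0) (A.a 3 ≠ 0) (rotParams A) (shearParams (rotParams A))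
    (q + con (A.a 3) / (p + con (-A.t))) p := lifts_r₀ (A := rotParams A) ht'
  have h3 : Lifts σ₁ True (shearParams (rotParams A)) _ (-(p / con (-A.t))) (q * con (-A.t)) :=
    lifts_σ₁ ht'
  have h4 := h1.comp (h2.comp h3 (q₃ := -(p / con (-A.t)))
    (p₃ := (q + con (A.a 3) / (p + con (-A.t))) * con (-A.t))
    (fun σ _ hp => by rw [map_neg, map_div₀, map_con, hp])
    (fun σ hq _ => by rw [map_mul, map_con, hq]))
    (q₃ := q) (p₃ := p - con (A.a 3) / (q - 1))
    (fun σ _ hp => by rw [map_neg, map_div₀, map_con, hp, con_neg]; field_simp)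
    (fun σ hq hp => by
      have h5 : q - 1 ≠ 0 := by
        rw [← con_one]; exact good_U₀₀.x_sub_ne_zero 1
      have h6 : q * con A.t + -con A.t = (q - 1) * con A.t := by ring
      rw [map_mul, map_add, map_div₀, map_add, map_con, map_con, hq, hp, con_neg, h6]
      field_simp
      ring)
  rwa [r_three, true_and, and_true] at h4

theorem lifts_r₁ : Lifts (r 1) (A.a 1 ≠ 0) A
    (rotParams (shiftParams (shearParams (shiftParams (rotParams A)))))
    q (p - con (A.a 1) / q) := by
  have ht' : -A.t ≠ 0 := neg_ne_zero.2 ht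
  have h0 := con_ne_zero ht
  have h1 := lifts_σ₁ ht
  have h2 : Lifts (r 2) (A.a 1 ≠ 0) (rotParams A)
    (shiftParams (shearParams (shiftParams (rotParams A)))) (q + con (A.a 1) / p) p :=
    lifts_r₂ (A := rotParams A) ht'
  have h7 : (shiftParams (shearParams (shiftParams (rotParams A)))).t = -A.t := neg_neg _
  have h3 := lifts_σ₁ (A := shiftParams (shearParams (shiftParams (rotParams A)))) (by rwa [h7])
  rw [h7] at h3
  have h4 := h1.comp (h2.comp h3 (q₃ := -(p / con (-A.t)))
    (p₃ := (q + con (A.a 1) / p) * con (-A.t))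
    (fun σ _ hp => by rw [map_neg, map_div₀, map_con, hp])
    (fun σ hq _ => by rw [map_mul, map_con, hq]))
    (q₃ := q) (p₃ := p - con (A.a 1) / q)
    (fun σ _ hp => by rw [map_neg, map_div₀, map_con, hp, con_neg]; field_simp)
    (fun σ hq hp => by
      have h5 : q ≠ 0 := tx_ne_zero 0
      rw [map_mul, map_add, map_div₀, map_con, map_con, hq, hp, con_neg]
      field_simp
      ring)
  rwa [r_one, true_and, and_true] at h4

end lifts

/-! ### Preservation of the two-form and of the periods -/

theorem dwedge_eq_ω {f g a b a' b' : K} (hf : HasD f a b) (hg : HasD g a' b')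
    (h : a * b' - b * a' = 1) : dwedge f g = ω := by rw [hf.dwedge hg, h, one_smul]

theorem hasPeriod_r {A : Params} (ht : A.t ≠ 0) (i j : Fin 4) :
    HasPeriod A (r i (α j)) (A.a j + inter (α j) (α i) * A.a i) := by
  have := (periodGraph A).add_mem (hasPeriod_α ht j)
    ((periodGraph A).zsmul_mem (hasPeriod_α ht i) (inter (α j) (α i)))
  simpa [HasPeriod, r] using this

/-- The Cartan matrix of type `A₃⁽¹⁾`. -/
theorem inter_α (i j : Fin 4) : inter (α j) (α i) =
    ![![-2, 1, 0, 1], ![1, -2, 1, 0], ![0, 1, -2, 1], ![1, 0, 1, -2]] i j := by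
  revert i j; decide

theorem σ₁_α (i : Fin 4) : σ₁ (α i) = α i.rev := by revert i; decide
theorem σ₂_α (i : Fin 4) : σ₂ (α i) = α (shiftPerm i) := by revert i; decide

/-! ### Functions without poles in the affine plane -/

/-- The Nullstellensatz. -/
theorem exists_zero_of_irreducible {F : MvPolynomial (Fin 2) ℂ} (hF : Irreducible F) :
    ∃ c d : ℂ, MvPolynomial.eval ![c, d] F = 0 := by
  obtain ⟨M, hM, hFM⟩ := exists_max_ideal_of_mem_nonunits hF.not_isUnit
  obtain ⟨x, rfl⟩ := MvPolynomial.isMaximal_iff_eq_vanishingIdeal_singleton.1 hM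
  rw [MvPolynomial.mem_vanishingIdeal_singleton_iff] at hFM
  refine ⟨x 0, x 1, ?_⟩
  rw [show ![x 0, x 1] = x by ext i; fin_cases i <;> rfl]
  simpa [MvPolynomial.aeval_eq_eval] using hFM

/-- A rational function that is regular along all curves of the affine plane is a polynomial. -/
theorem exists_poly_of_regular {A : Params} (ht : A.t ≠ 0) {f : K}
    (hf : ∀ C : PrimeDivisor (S A), Loc U₀₀ C.ring → f ∈ C.ring) : ∃ g, f = U₀₀.poly g := by
  obtain ⟨a, ⟨b, hb⟩, hab, rfl⟩ := IsFractionRing.exists_reduced_fraction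
    (A := MvPolynomial (Fin 2) ℂ) (K := K) f
  have e (g) : algebraMap (MvPolynomial (Fin 2) ℂ) K g = U₀₀.poly g := by
    rw [← good_U₀₀.aut_algebraMap, show good_U₀₀.aut = AlgEquiv.refl by
      apply algEquiv_ext <;> simp [U₀₀]]
    rfl
  have hb0 : b ≠ 0 := nonZeroDivisors.ne_zero hb
  rw [IsFractionRing.mk'_eq_div, e, e] at *
  by_cases hu : IsUnit b
  · obtain ⟨c, hc⟩ := hu.exists_right_inv
    refine ⟨a * c, ?_⟩
    rw [div_eq_iff (good_U₀₀.poly_ne_zero hb0), ← poly_mul, mul_assoc, mul_comm c, hc, mul_one]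
  · obtain ⟨F, hF, hFb⟩ := WfDvdMonoid.exists_irreducible_factor hu hb0
    obtain ⟨c, d, hcd⟩ := exists_zero_of_irreducible hF
    obtain ⟨g, h, hFh, hh, hgh⟩ := hf (planeCurve A ht F hF hcd) (loc_curveVal good_U₀₀ hF)
    rw [div_eq_div_iff (good_U₀₀.poly_ne_zero hb0) hh, ← poly_mul, ← poly_mul] at hgh
    have h1 := good_U₀₀.poly_injective hgh
    have hFa : F ∣ a := (hF.prime.dvd_or_dvd (h1 ▸ hFb.mul_left g)).resolve_right hFh
    exact (hF.not_isUnit (hab hFa hFb)).elim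

theorem poly_eq_sum (ch : Chart) (g : MvPolynomial (Fin 2) ℂ) :
    ch.poly g = ∑ m ∈ g.support, con (g.coeff m) * (ch.x ^ m 0 * ch.y ^ m 1) := by
  rw [Chart.poly, MvPolynomial.aeval_def, MvPolynomial.eval₂_eq']
  simp [Fin.prod_univ_two, con]

/-- The order of the pole of a polynomial along the line at infinity is its degree. -/
theorem Chart.Good.degree_le {x y : K} (hch : Good ⟨x, y⟩) {g : MvPolynomial (Fin 2) ℂ} {n : ℕ}
    (hg : ((⟨x⁻¹, y⟩ : Chart).curveVal hch.inv (.X 0) (irreducible_X 0)).valuation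
      ((⟨x, y⟩ : Chart).poly g * x⁻¹ ^ n) ≤ 1) : ∀ m ∈ g.support, m 0 ≤ n := by
  classical
  by_contra! hcon
  obtain ⟨m₁, hm₁, hn⟩ := hcon
  obtain ⟨m₀, hm₀, hmax⟩ := g.support.exists_max_image (fun m => m 0) ⟨m₁, hm₁⟩
  set N := m₀ 0
  have hx0 : x ≠ 0 := hch.x_ne_zero
  have hnN : n < N := hn.trans_le (hmax m₁ hm₁)
  -- The polynomial `x⁻ᴺ g` in the coordinates at infinity.
  let G : MvPolynomial (Fin 2) ℂ := ∑ m ∈ g.support,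
    MvPolynomial.monomial (Finsupp.single 0 (N - m 0) + Finsupp.single 1 (m 1)) (g.coeff m)
  have hG : (⟨x⁻¹, y⟩ : Chart).poly G = (⟨x, y⟩ : Chart).poly g * x⁻¹ ^ N := by
    rw [poly_eq_sum ⟨x, y⟩, Finset.sum_mul]
    change MvPolynomial.aeval _ G = _
    rw [map_sum]
    refine Finset.sum_congr rfl fun m hm => ?_
    have e : x⁻¹ ^ N = x⁻¹ ^ (N - m 0) * x⁻¹ ^ m 0 := by
      rw [← pow_add, Nat.sub_add_cancel (hmax m hm)]
    rw [MvPolynomial.aeval_monomial, e, Finsupp.prod_fintype _ _ (by simp)]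
    simp [Fin.prod_univ_two, con]
    field_simp
  have hdvd : ¬ (.X 0 : MvPolynomial (Fin 2) ℂ) ∣ G := by
    rintro ⟨H, hH⟩
    have h1 : MvPolynomial.coeff (Finsupp.single 1 (m₀ 1)) G = g.coeff m₀ := by
      simp only [G, MvPolynomial.coeff_sum, MvPolynomial.coeff_monomial]
      rw [Finset.sum_eq_single m₀]
      · simp [N]
      · intro m hm hne
        refine if_neg fun h => hne ?_
        have e0 := DFunLike.congr_fun h 0
        have e1 := DFunLike.congr_fun h 1
        simp at e0 e1
        have := hmax m hm
        ext i
        fin_cases i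
        · change m 0 = N; omega
        · exact e1
      · exact fun h => absurd hm₀ h
    rw [hH, MvPolynomial.coeff_X_mul', if_neg (by simp)] at h1
    exact MvPolynomial.mem_support_iff.1 hm₀ h1.symm
  have h1 := curveVal_poly hch.inv (irreducible_X 0) hdvd
  have h2 := curveVal_poly_self_lt hch.inv (irreducible_X 0)
  rw [poly_X0] at h2
  have e : x⁻¹ ^ N = x⁻¹ ^ n * x⁻¹ ^ (N - n) := by rw [← pow_add, Nat.add_sub_cancel' hnN.le]
  rw [hG, e, ← mul_assoc] at h1
  refine (val_mul_lt hg ?_).ne h1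
  rw [map_pow]
  exact pow_lt_one₀ zero_le h2 (Nat.sub_ne_zero_of_lt hnN)

theorem poly_swap (ch : Chart) (g : MvPolynomial (Fin 2) ℂ) :
    ch.poly g = ch.swap.poly (MvPolynomial.rename (Equiv.swap 0 1) g) := by
  rw [Chart.poly, Chart.poly, MvPolynomial.aeval_rename]
  congr 2
  ext i
  fin_cases i <;> simp [Chart.swap]

theorem fib_degree_le {k : Fin 2} {g : MvPolynomial (Fin 2) ℂ} {n : ℕ}
    (hg : (fibVal k).valuation (U₀₀.poly g * (ax k)⁻¹ ^ n) ≤ 1) : ∀ m ∈ g.support, m k ≤ n := by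
  classical
  fin_cases k
  · exact Chart.Good.degree_le (x := q) (y := p) good_U₀₀ hg
  · have h : ∀ m ∈ (MvPolynomial.rename (Equiv.swap 0 1) g).support, m 0 ≤ n := by
      refine Chart.Good.degree_le (x := p) (y := q) good_U₀₀.swap ?_
      have := poly_swap U₀₀ g
      rw [this] at hg
      exact hg
    intro m hm
    rw [MvPolynomial.support_rename_of_injective (Equiv.injective _)] at h
    have := h _ (Finset.mem_image_of_mem _ hm)
    rwa [Finsupp.mapDomain_equiv_apply] at this

/-- A polynomial that has at most a simple pole along one line at infinity and no pole along the
other is linear in one variable. -/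
theorem exists_linear_of_regular {k : Fin 2} {g : MvPolynomial (Fin 2) ℂ} {n : ℤ}
    (hk : HasOrd (fibVal k) (U₀₀.poly g) n) (hn : -1 ≤ n) {j : Fin 2} (hj : j ≠ k)
    (hj' : (fibVal j).valuation (U₀₀.poly g) ≤ 1) :
    ∃ a b, U₀₀.poly g = con a * ax k + con b := by
  classical
  have h0 : ∀ m ∈ g.support, m j ≤ 0 := fib_degree_le (by simpa using hj')
  have h1 : ∀ m ∈ g.support, m k ≤ 1 := by
    refine fib_degree_le ?_
    have : IsDiscreteValuationRing (fibVal k) := isDVR_curveVal _ _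
    have hx : HasOrd (fibVal k) (ax k)⁻¹ 1 := by
      have := hasOrd_curveVal_self (good_tb (k.castLE (by decide))) (irreducible_X 0)
      rw [poly_X0] at this
      fin_cases k <;> exact this
    rw [pow_one, (hk.mul hx).le_one_iff]
    omega
  refine ⟨g.coeff (Finsupp.single k 1), g.coeff 0, ?_⟩
  have hg : g = .C (g.coeff (Finsupp.single k 1)) * .X k + .C (g.coeff 0) := by
    ext m
    rw [MvPolynomial.coeff_add, MvPolynomial.coeff_C_mul, MvPolynomial.coeff_C,
      MvPolynomial.coeff_X]
    by_cases hm0 : m = 0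
    · subst hm0
      simp
    · by_cases hm1 : m = Finsupp.single k 1
      · subst hm1
        simp [Ne.symm hm0]
      · rw [if_neg (Ne.symm hm1), if_neg (Ne.symm hm0), mul_zero, add_zero]
        by_contra hm
        have hs := MvPolynomial.mem_support_iff.2 hm
        have h2 := h0 m hs
        have h3 := h1 m hs
        have h4 (i : Fin 2) : i = j ∨ i = k := by omega
        rcases Nat.le_one_iff_eq_zero_or_eq_one.1 h3 with h5 | h5
        · refine hm0 (Finsupp.ext fun i => ?_)
          rcases h4 i with rfl | rfl <;> simp_all
        · refine hm1 (Finsupp.ext fun i => ?_)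
          rcases h4 i with rfl | rfl <;> simp_all
  conv_lhs => rw [hg]
  rw [poly_add, poly_mul, poly_C, poly_C]
  congr 2
  fin_cases k
  · exact poly_X0
  · exact poly_X1

/-! ### Boundary curves are alone in their classes -/

theorem hasOrd_con {R : ValuationSubring K} [IsDiscreteValuationRing R] {c : ℂ} (hc : c ≠ 0)
    (hR : ∀ c, con c ∈ R) : HasOrd R (con c) 0 := HasOrd.of_val (val_con hc hR)

theorem con_mem_bdVal (A : Params) (b : Bdry) (c : ℂ) : con c ∈ bdVal A b := by
  cases b with
  | fib k => exact (loc_curveVal (good_tb _) (irreducible_X 0)).con_mem c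
  | fst i => exact (loc_curveVal ((good_tb i).blowUp₀ _ _) (irreducible_X 1)).con_mem c
  | snd i => exact (loc_curveVal ((good_tW A i).blowUp₀ _ _) (irreducible_X 1)).con_mem c

/-- The orders of a linear function along the boundary. -/
theorem hasOrd_linear (A : Params) {a b : ℂ} (ha : a ≠ 0) (k : Fin 2) (c : Bdry) :
    HasOrd (bdVal A c) (con a * ax k + con b) (ordLin A k (-(b / a)) c) := by
  have h := (hasOrd_con ha (con_mem_bdVal A c)).mul (hasOrd_ordLin A k (-(b / a)) c)
  rw [zero_add] at h
  have h0 := con_ne_zero ha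
  rwa [con_neg, con_div, sub_neg_eq_add, mul_add, mul_div_cancel₀ _ h0] at h

theorem exists_axis (k : Fin 2) : ∃ i, axis i = k := by revert k; decide

theorem other_ne (k : Fin 2) : 1 - k ≠ k := by revert k; decide

/-- A boundary curve is the only curve in its class. -/
theorem eq_bd_of_cls_eq {A : Params} (ht : A.t ≠ 0) {C : PrimeDivisor (S A)} {b : Bdry}
    (h : C.cls = (bd A ht b).cls) : C = bd A ht b := by
  classical
  by_contra hC
  obtain ⟨f, hf0, hf⟩ := QuotientAddGroup.eq.1 h.symm
  have hord (D : PrimeDivisor (S A)) :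
      HasOrd D.ring f ((if C = D then 1 else 0) - if bd A ht b = D then 1 else 0) := by
    have := hf D
    rw [Finsupp.add_apply, Finsupp.neg_apply, Finsupp.single_apply, Finsupp.single_apply,
      neg_add_eq_sub] at this
    exact this
  have hb : HasOrd (bdVal A b) f (-1) := by simpa [hC] using hord (bd A ht b)
  have nonneg (b' : Bdry) (hb' : b' ≠ b) : ∃ n : ℤ, 0 ≤ n ∧ HasOrd (bdVal A b') f n := by
    refine ⟨_, ?_, hord (bd A ht b')⟩
    rw [if_neg fun h => hb' (bd_injective ht h).symm]
    split_ifs <;> simp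
  obtain ⟨g, rfl⟩ := exists_poly_of_regular ht (f := f) fun D hD => by
    have := D.isDVR
    have hne : bd A ht b ≠ D := by
      rintro rfl; exact not_loc_bdVal (A := A) b hD
    rw [mem_iff_val, (hord D).le_one_iff, if_neg hne]
    split_ifs <;> simp
  -- As `f` has only one simple pole, it is linear in one coordinate.
  have lin : ∃ k a c, U₀₀.poly g = con a * ax k + con c ∧ ∀ i, axis i = k → Bdry.fst i ≠ b := by
    have at_fib (k : Fin 2) (hk : .fib k ≠ b) : ∃ n : ℤ, 0 ≤ n ∧ HasOrd (fibVal k) (U₀₀.poly g) n :=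
      nonneg _ hk
    have key (k : Fin 2) (n : ℤ) (hn : HasOrd (fibVal k) (U₀₀.poly g) n) (hn' : -1 ≤ n)
        (hk : .fib (1 - k) ≠ b) : ∃ a c, U₀₀.poly g = con a * ax k + con c := by
      obtain ⟨m, hm0, hm⟩ := at_fib _ hk
      have : IsDiscreteValuationRing (fibVal (1 - k)) := isDVR_curveVal _ _
      exact exists_linear_of_regular hn hn' (other_ne k) (hm.le_one_iff.2 hm0)
    have aux (k : Fin 2) (hne : ∀ j, .fib j ≠ b) : ∃ a c, U₀₀.poly g = con a * ax k + con c := by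
      obtain ⟨n, hn, hn'⟩ := at_fib k (hne k)
      exact key k n hn' (by omega) (hne _)
    cases b with
    | fib k =>
      obtain ⟨a, c, e⟩ := key k (-1) hb le_rfl fun h => other_ne k (Bdry.fib.inj h)
      exact ⟨k, a, c, e, fun i _ h => nomatch h⟩
    | fst i =>
      obtain ⟨a, c, e⟩ := aux (1 - axis i) fun k h => nomatch h
      exact ⟨_, a, c, e, fun j hj h => other_ne (axis i) (by rw [← hj, Bdry.fst.inj h])⟩
    | snd i =>
      obtain ⟨a, c, e⟩ := aux 0 fun k h => nomatch h
      exact ⟨_, a, c, e, fun j _ h => nomatch h⟩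
  obtain ⟨k, a, c, e, hk⟩ := lin
  rw [e] at hb nonneg hf0
  by_cases ha : a = 0
  · subst ha
    rw [con_zero, zero_mul, zero_add] at hb hf0
    have hc : c ≠ 0 := fun h => hf0 (by rw [h, con_zero])
    exact absurd (hb.unique (hasOrd_con hc (con_mem_bdVal A b))) (by decide)
  · obtain ⟨i, hi⟩ := exists_axis k
    obtain ⟨n, hn, hn'⟩ := nonneg (.fst i) (hk i hi)
    have h1 := hn'.unique (hasOrd_linear A ha k (.fst i))
    rw [ordLin, if_pos hi] at h1
    omega

/-! ### Isomorphisms acting trivially on the Picard lattice -/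

section rigidity
variable {A B : Params} (hA : A.t ≠ 0) (hB : B.t ≠ 0) {θ : SurfaceIso (S A) (S B)}
  (hθ : ∀ F, θ.pullPic (ι B F) = ι A F)
include hθ

/-- The preimage of a boundary curve corresponds to the same element of the lattice, and is
therefore the boundary curve with the same label. -/
theorem preimage_bd_of_trivial (b : Bdry) : θ.preimage (bd B hB b) = bd A hA b := by
  apply eq_bd_of_cls_eq
  rw [← θ.pullPic_cls, cls_bd, hθ, cls_bd]

include hA hB in
theorem pull_hasOrd {b : Bdry} {f : K} {n : ℤ} (h : HasOrd (bdVal B b) f n) :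
    HasOrd (bdVal A b) (θ.pull f) n := by
  have := θ.hasOrd_preimage (bd B hB b) h
  rwa [preimage_bd_of_trivial hA hB hθ] at this

include hA hB in
/-- An isomorphism acting trivially on the Picard lattice preserves the two fibrations, and acts
on the coordinates by affine transformations. -/
theorem pull_ax (k : Fin 2) : ∃ a b, a ≠ 0 ∧ θ.pull (ax k) = con a * ax k + con b := by
  have hpoly : ∃ g, θ.pull (ax k) = U₀₀.poly g := by
    refine exists_poly_of_regular hA fun C hC => ?_
    have e : θ.preimage (θ.symm.preimage C) = C := θ.primeEquiv.apply_symm_apply C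
    rcases loc_or_bd hB (θ.symm.preimage C) with h | ⟨b, hb⟩
    · rw [← e]
      refine mem_comap_symm.2 ?_
      fin_cases k
      · exact h.x_mem
      · exact h.y_mem
    · rw [hb, preimage_bd_of_trivial hA hB hθ] at e
      rw [← e] at hC
      exact (not_loc_bdVal b hC).elim
  obtain ⟨g, hg⟩ := hpoly
  have hord (j : Fin 2) : HasOrd (fibVal j) (U₀₀.poly g) (if j = k then -1 else 0) := by
    have h1 := hasOrd_ordLin B k 0 (.fib j)
    rw [con_zero, sub_zero] at h1
    have h2 := pull_hasOrd hA hB hθ h1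
    rw [hg] at h2
    exact h2
  have h1 := hord k
  have h2 := hord (1 - k)
  rw [if_pos rfl] at h1
  rw [if_neg (other_ne k)] at h2
  have : IsDiscreteValuationRing (fibVal (1 - k)) := isDVR_curveVal _ _
  obtain ⟨a, b, e⟩ := exists_linear_of_regular h1 le_rfl (other_ne k) (h2.le_one_iff.2 le_rfl)
  refine ⟨a, b, ?_, hg.trans e⟩
  rintro rfl
  rw [con_zero, zero_mul, zero_add, ← hg, ← map_con θ.pull] at e
  have h3 := (U₀₀_poly_lin k b).trans (sub_eq_zero.2 (θ.pull.injective e))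
  exact (good_U₀₀.poly_ne_zero (irreducible_X_sub_C k b).ne_zero) h3

include hA hB in
/-- The affine transformations match the base points. -/
theorem pull_ts {k : Fin 2} {a b : ℂ} (ha : a ≠ 0) (h : θ.pull (ax k) = con a * ax k + con b)
    {i : Fin 4} (hi : axis i ≠ k) : ts B i = a * ts A i + b := by
  have h1 := pull_hasOrd hA hB hθ (hasOrd_ordLin B k (ts B i) (.fst i))
  rw [map_sub, map_con, h, add_sub_assoc, ← con_sub] at h1
  have h2 := h1.unique (hasOrd_linear A ha k (.fst i))
  have h3 : 0 < ordLin A k (-((b - ts B i) / a)) (.fst i) := by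
    rw [← h2, ordLin_fst_pos]; exact ⟨hi, rfl⟩
  have h4 := (ordLin_fst_pos A i).1 h3 |>.2
  rw [← h4]; field_simp; ring

/-- A surface of the family is determined by its marking of the Picard group, and has no nontrivial
automorphism that preserves the marking. -/
theorem rigid (hA : A ∈ paramSpace) (hB : B ∈ paramSpace) :
    B = A ∧ θ.pull q = q ∧ θ.pull p = p := by
  obtain ⟨hsA, hA⟩ := hA
  obtain ⟨hsB, hB⟩ := hB
  obtain ⟨a, b, ha, hq⟩ := pull_ax hA hB hθ 0
  obtain ⟨c, d, hc, hp⟩ := pull_ax hA hB hθ 1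
  have h1 := pull_ts hA hB hθ ha hq (i := 1) (by decide)
  have h3 := pull_ts hA hB hθ ha hq (i := 3) (by decide)
  have h0 := pull_ts hA hB hθ hc hp (i := 0) (by decide)
  have h2 := pull_ts hA hB hθ hc hp (i := 2) (by decide)
  simp only [ts] at h0 h1 h2 h3
  have hb0 : b = 0 := by simpa using h1.symm
  have ha1 : a = 1 := by simpa [hb0] using h3.symm
  have hd0 : d = 0 := by simpa using h2.symm
  have ht : B.t = c * A.t := by simpa [hd0] using h0
  subst hb0 ha1 hd0
  have hq' : θ.pull q = q := by simpa [ax] using hq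
  have hp' : θ.pull p = con c * p := by simpa [ax] using hp
  have htu (i : Fin 4) : θ.pull (tu B i) = con c * tu A i := by
    rw [tu, tu, map_mul, map_sub, map_con]
    fin_cases i
    · simp only [tx, ty, ts]; simp [hq', hp', ht, con_neg, con_mul]; ring
    · simp only [tx, ty, ts]; simp [hq', hp']; ring
    · simp only [tx, ty, ts]; simp [hq', hp']; ring
    · simp only [tx, ty, ts]; simp [hq', hp']; ring
  -- The function `u - te B i` vanishes on the second exceptional curve, and so does its pull-back,
  -- which is `c u - te B i`.
  have hte (i : Fin 4) : te B i = c * te A i := by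
    by_contra hne
    have h4 := pull_hasOrd hA hB hθ (snd_tu B i)
    have h5 := (hasOrd_con hc (con_mem_bdVal A (.snd i))).mul
      (snd_tu_zero A i (te B i / c) fun h => hne (by rw [← h]; field_simp))
    have h6 := con_ne_zero hc
    rw [con_div, mul_sub, mul_div_cancel₀ _ h6] at h5
    rw [map_sub, map_con, htu] at h4
    exact absurd (h4.unique h5) (by decide)
  have hac (i : Fin 4) : B.a i = c * A.a i := by
    rw [← sgn_te, ← sgn_te, hte]; ring
  have hc1 : c = 1 := by
    rw [hac, hac, hac, hac, ← mul_add, ← mul_add, ← mul_add, hsA, mul_one] at hsB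
    exact hsB
  subst hc1
  exact ⟨Params.ext (funext fun i => by rw [hac, one_mul]) (by rw [ht, one_mul]), hq',
    by simpa using hp'⟩

end rigidity

/-! ### The Cremona action -/

/-- If `φ` and `ψ` pull back `d` and `c` to the same class, then `c` is pulled back to `d` along
`ψ ∘ φ⁻¹`. -/
theorem SurfaceIso.symm_trans_pullPic {X Y Z : Set (Subring K)} (φ : SurfaceIso X Y)
    (ψ : SurfaceIso X Z) {c : Pic Z} {d : Pic Y} (h : φ.pullPic d = ψ.pullPic c) :
    (φ.symm.trans ψ).pullPic c = d := by
  have e : φ.symm.pullPic (φ.pullPic d) = d := by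
    rw [← SurfaceIso.pullPic_trans]
    obtain ⟨D, rfl⟩ := QuotientAddGroup.mk_surjective d
    refine congrArg (QuotientAddGroup.mk (s := principal Y)) ?_
    ext C
    change D ((φ.symm.trans φ).primeEquiv.symm C) = D C
    congr 1
    refine PrimeDivisor.ext ?_
    ext f
    simp [primeEquiv, preimage, SurfaceIso.trans, SurfaceIso.symm, ValuationSubring.mem_comap]
  rw [SurfaceIso.pullPic_trans, ← h, e]

/-- The lift of the Cremona action is determined by its action on the Picard lattice. -/
theorem unique_of_induces {w : PicLattice → PicLattice} {A B B' : Params} (hB : B ∈ paramSpace)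
    (hB' : B' ∈ paramSpace) {φ : SurfaceIso (S A) (S B)} {ψ : SurfaceIso (S A) (S B')}
    (hφ : Induces w A B φ) (hψ : Induces w A B' ψ) : B' = B ∧ ψ.pull = φ.pull := by
  obtain ⟨h1, h2, h3⟩ := rigid (θ := φ.symm.trans ψ)
    (fun F => φ.symm_trans_pullPic ψ ((hφ F).trans (hψ F).symm)) hB hB'
  refine ⟨h1, algEquiv_ext ?_ ?_⟩
  · exact φ.pull.symm_apply_eq.1 h2
  · exact φ.pull.symm_apply_eq.1 h3

/-- The conditions on the lift that remain to be checked for each generator: the two-form and the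
periods of the transformed roots. -/
theorem Lifts.cremona {w : PicLattice → PicLattice} {nd : Prop} {A B : Params} {q' p' : K}
    (h : Lifts w nd A B q' p') (hA : A ∈ paramSpace) (hB : B ∈ paramSpace) (hω : dwedge q' p' = ω)
    (hχ : ∀ i, HasPeriod A (w (α i)) (B.a i)) : CremonaGivenBy w nd A B q' p' := by
  obtain ⟨φ, hq, hp, hφ⟩ := h
  refine ⟨hB, φ, hq, hp, ⟨?_, fun i => ⟨hasPeriod_α hA.2 i, hasPeriod_α hB.2 i, hχ i⟩⟩, fun hn =>
    ⟨hφ hn, fun B' hB' ψ _ hψ => unique_of_induces hB hB' (hφ hn) hψ⟩⟩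
  rwa [PreservesForm, hq, hp]

end D5Surface

end

theorem mainTheorem9 (a₀ a₁ a₂ a₃ t : ℂ) (ha : a₀ + a₁ + a₂ + a₃ = 1) (ht : t ≠ 0) :
    D5Surface.CremonaGivenBy (D5Surface.r 0) (a₀ ≠ 0) ⟨![a₀, a₁, a₂, a₃], t⟩
      ⟨![-a₀, a₀ + a₁, a₂, a₀ + a₃], t⟩
      (D5Surface.q + D5Surface.con a₀ / (D5Surface.p + D5Surface.con t)) D5Surface.p ∧
    D5Surface.CremonaGivenBy (D5Surface.r 1) (a₁ ≠ 0) ⟨![a₀, a₁, a₂, a₃], t⟩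
      ⟨![a₀ + a₁, -a₁, a₁ + a₂, a₃], t⟩
      D5Surface.q (D5Surface.p - D5Surface.con a₁ / D5Surface.q) ∧
    D5Surface.CremonaGivenBy (D5Surface.r 2) (a₂ ≠ 0) ⟨![a₀, a₁, a₂, a₃], t⟩
      ⟨![a₀, a₁ + a₂, -a₂, a₂ + a₃], t⟩
      (D5Surface.q + D5Surface.con a₂ / D5Surface.p) D5Surface.p ∧
    D5Surface.CremonaGivenBy (D5Surface.r 3) (a₃ ≠ 0) ⟨![a₀, a₁, a₂, a₃], t⟩
      ⟨![a₀ + a₃, a₁, a₂ + a₃, -a₃], t⟩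
      D5Surface.q (D5Surface.p - D5Surface.con a₃ / (D5Surface.q - 1)) ∧
    D5Surface.CremonaGivenBy D5Surface.σ₁ True ⟨![a₀, a₁, a₂, a₃], t⟩
      ⟨![a₃, a₂, a₁, a₀], -t⟩
      (-(D5Surface.p / D5Surface.con t)) (D5Surface.q * D5Surface.con t) ∧
    D5Surface.CremonaGivenBy D5Surface.σ₂ True ⟨![a₀, a₁, a₂, a₃], t⟩
      ⟨![a₂, a₁, a₀, a₃], -t⟩
      D5Surface.q (D5Surface.p + D5Surface.con t) := by
  open D5Surface in
  set A : Params := ⟨![a₀, a₁, a₂, a₃], t⟩ with hA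
  have hA' : A ∈ paramSpace := ⟨ha, ht⟩
  have hA0 : A.t ≠ 0 := ht
  have ht' : -t ≠ 0 := neg_ne_zero.2 ht
  have hper (w : PicLattice → PicLattice) (B : Params) (i : Fin 4) (hw : w = r i)
      (hB : ∀ j, B.a j = A.a j + (![![-2, 1, 0, 1], ![1, -2, 1, 0], ![0, 1, -2, 1],
        ![1, 0, 1, -2]] i j : ℤ) * A.a i) (j : Fin 4) : HasPeriod A (w (α j)) (B.a j) := by
    rw [hB, hw, ← inter_α]
    exact hasPeriod_r hA0 i j
  have hq : HasD q 1 0 := HasD.q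
  have hp : HasD p 0 1 := HasD.p
  refine ⟨?_, ?_, ?_, ?_, ?_, ?_⟩
  · refine (lifts_r₀ hA0).cremona hA' ⟨?_, ht⟩ ?_ (hper _ _ 0 rfl fun j => ?_)
    · simp [shearParams, hA]; linear_combination ha
    · exact dwedge_eq_ω (hq.add ((HasD.con _).div (hp.add (HasD.con _)))) hp (by simp)
    · fin_cases j <;> simp [shearParams, hA] <;> ring
  · have h := lifts_r₁ hA0
    rw [show rotParams (shiftParams (shearParams (shiftParams (rotParams A)))) =
      ⟨![a₀ + a₁, -a₁, a₁ + a₂, a₃], t⟩ from Params.ext (funext fun i => by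
        fin_cases i <;> simp [rotParams, shiftParams, shearParams, hA, add_comm])
        (by simp [rotParams, shiftParams, shearParams, hA])] at h
    refine h.cremona hA' ⟨?_, ht⟩ ?_ (hper _ _ 1 rfl fun j => ?_)
    · simp; linear_combination ha
    · exact dwedge_eq_ω hq (hp.sub ((HasD.con _).div hq)) (by simp)
    · fin_cases j <;> simp [hA] <;> ring
  · have h := lifts_r₂ hA0
    rw [show shiftParams (shearParams (shiftParams A)) =
      ⟨![a₀, a₁ + a₂, -a₂, a₂ + a₃], t⟩ from Params.ext (funext fun i => by
        fin_cases i <;> simp [shiftParams, shearParams, hA, add_comm])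
        (by simp [shiftParams, shearParams, hA])] at h
    refine h.cremona hA' ⟨?_, ht⟩ ?_ (hper _ _ 2 rfl fun j => ?_)
    · simp; linear_combination ha
    · exact dwedge_eq_ω (hq.add ((HasD.con _).div hp)) hp (by simp)
    · fin_cases j <;> simp [hA] <;> ring
  · have h := lifts_r₃ hA0
    rw [show rotParams (shearParams (rotParams A)) =
      ⟨![a₀ + a₃, a₁, a₂ + a₃, -a₃], t⟩ from Params.ext (funext fun i => by
        fin_cases i <;> simp [rotParams, shearParams, hA, add_comm])
        (by simp [rotParams, shearParams, hA])] at h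
    refine h.cremona hA' ⟨?_, ht⟩ ?_ (hper _ _ 3 rfl fun j => ?_)
    · simp; linear_combination ha
    · have h1 : HasD (q - 1) 1 0 := by simpa using hq.sub (HasD.con 1)
      exact dwedge_eq_ω hq (hp.sub ((HasD.con _).div h1)) (by simp)
    · fin_cases j <;> simp [hA]
      ring
  · refine (lifts_σ₁ hA0).cremona hA' ⟨?_, ht'⟩ ?_ fun j => ?_
    · simp [rotParams, hA]; linear_combination ha
    · have h0 := con_ne_zero ht
      refine dwedge_eq_ω (hp.div (HasD.con t)).neg (hq.mul (HasD.con t)) ?_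
      simp; field_simp; rfl
    · rw [σ₁_α]
      convert hasPeriod_α hA0 j.rev using 1
      fin_cases j <;> rfl
  · refine (lifts_σ₂ hA0).cremona hA' ⟨?_, ht'⟩ ?_ fun j => ?_
    · simp [shiftParams, hA]; linear_combination ha
    · exact dwedge_eq_ω hq (hp.add (HasD.con _)) (by simp)
    · rw [σ₂_α]
      convert hasPeriod_α hA0 (shiftPerm j) using 1
      fin_cases j <;> rfl
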